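/- Let $d\ge 2$ and $0<R<\infty$, and let $B_r\subseteq\mathbb R^d$ denote the open ball of radius $r$ centred at $0$, $\mathscr L^d$ Lebesgue measure and $\omega_d=\mathscr L^d(B_1)$. For $p\in[1,\infty]$ let $|M|_p$ be the Schatten $p$-norm of $M\in\mathbb R^{d\times d}$, i.e. the $\ell^p$ norm of its vector of singular values. For $f\in L^1_{\rm loc}(B_R)$ and $A\subseteq B_R$ open put $$|{\rm D}^2_pf|(A)=\sup\Big\{\int_A\sum_{i,j=1}^d f\,\partial_i\partial_jF_{i,j}\,d\mathscr L^d:\ F\in C_c^\infty(A)^{d\times d},\ \sup_x|F(x)|_{p^*}\le1\Big\},\qquad \tfrac1p+\tfrac1{p^*}=1.$$ We say that $f$ has bounded Hessian–Schatten variation in $B_R$ if $|{\rm D}^2_pf|(B_R)<\infty$ for some $p\in[1,\infty]$ (equivalently, for every $p\in[1,\infty]$). Let $g\in L^1_{\rm loc}((0,R))$ be real-valued with $\int_0^r s^{d-1}|g(s)|\,ds<\infty$ for every $r\in(0,R)$, and let $f(x)=g(|x|)$. Then $f\in L^1_{\rm loc}(B_R)$ and the following hold. (i) If $f$ has bounded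 Hessian–Schatten variation in $B_R$, then $g\in W^{1,1}_{\rm loc}((0,R))$ and $g'\in BV_{\rm loc}((0,R))$; and, writing the Lebesgue decomposition ${\rm D}g'={\rm D}^sg'+g''\mathscr L^1$ with ${\rm D}^sg'\perp\mathscr L^1$, for every $r\in(0,R]$ and every $p\in[1,\infty]$ one has $$|{\rm D}^2_pf|(B_r)=d\,\omega_d\Big(\int_{(0,r)}s^{d-1}\,d|{\rm D}^sg'|(s)+\int_0^r\big\|(s\,g''(s),g'(s),\dots,g'(s))\big\|_{\ell^p}\,s^{d-2}\,ds\Big),\tag{$*$}$$ where $g'(s)$ is repeated $d-1$ times. (ii) Conversely, if $g\in W^{1,1}_{\rm loc}((0,R))$, $g'\in BV_{\rm loc}((0,R))$ and, with the same notation, for some $q\in[1,\infty]$ $$\int_{(0,R)}s^{d-1}\,d|{\rm D}^sg'|(s)+\int_0^R\big\|(s\,g''(s),g'(s),\dots,g'(s))\big\|_{\ell^q}\,s^{d-2}\,ds<\infty,$$ then $f$ has bounded Hessian–Schatten variation in $B_R$ and $(*)$ holds for every $r\in(0,R]$ and every $p\in[1,\infty]$. -/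

import Mathlib

open MeasureTheory
open scoped ENNReal ContDiff

noncomputable section

/-! ### Schatten norms -/

/-- The `ℓ^p` norm of a finite family of real numbers, for `p ∈ [1,∞]`. -/
def ellpNorm {ι : Type*} [Fintype ι] (p : ℝ≥0∞) (v : ι → ℝ) : ℝ :=
  ‖WithLp.toLp p v‖

/-- The Schatten `p`-norm of a real `d × d` matrix: the `ℓ^p` norm of the vector of its `d` singular
values, counted with multiplicity. -/
def schattenNorm {d : ℕ} (p : ℝ≥0∞) (M : Matrix (Fin d) (Fin d) ℝ) : ℝ :=
  ellpNorm p (fun i : Fin d => (Matrix.toEuclideanLin M).singularValues (i : ℕ))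

/-! ### Hessian–Schatten variation -/

/-- The partial derivative `∂_i u` of a scalar function on `ℝ^d`. -/
def partialDeriv {d : ℕ} (i : Fin d) (u : EuclideanSpace ℝ (Fin d) → ℝ) :
    EuclideanSpace ℝ (Fin d) → ℝ :=
  fun x => fderiv ℝ u x (EuclideanSpace.single i 1)

/-- `F ∈ C_c^∞(A)^{d × d}` with `‖F‖_{p*,∞} ≤ 1`, where `1/p + 1/p* = 1`. Since `F` is continuous,
the essential supremum of `|F(x)|_{p*}` is at most `1` if and only if `|F(x)|_{p*} ≤ 1` at all
points `x`. -/
structure IsHessianTestField {d : ℕ} (p : ℝ≥0∞) (A : Set (EuclideanSpace ℝ (Fin d)))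
    (F : EuclideanSpace ℝ (Fin d) → Matrix (Fin d) (Fin d) ℝ) : Prop where
  smooth : ∀ i j, ContDiff ℝ ∞ (fun x => F x i j)
  hasCompactSupport : HasCompactSupport F
  tsupport_subset : tsupport F ⊆ A
  schattenNorm_le_one : ∀ x, schattenNorm (ENNReal.conjExponent p) (F x) ≤ 1

/-- The `p`-Hessian–Schatten variation of `f` on the open set `A`,
`sup_F ∫_A ∑_{i,j} f ∂_i ∂_j F_{i,j}`, with values in `[0,∞]`. (The field `F = 0` is admissible, so
the supremum is nonnegative and truncating each integral at `0` does not change it.) -/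
def hessianSchattenVar {d : ℕ} (p : ℝ≥0∞) (f : EuclideanSpace ℝ (Fin d) → ℝ)
    (A : Set (EuclideanSpace ℝ (Fin d))) : ℝ≥0∞ :=
  ⨆ (F : EuclideanSpace ℝ (Fin d) → Matrix (Fin d) (Fin d) ℝ) (_ : IsHessianTestField p A F),
    ENNReal.ofReal (∫ x in A,
      ∑ i, ∑ j, f x * partialDeriv i (partialDeriv j (fun y => F y i j)) x)

/-- `f` has bounded `p`-Hessian–Schatten variation in the open set `Ω`. -/
def HasBoundedHessianSchattenVar {d : ℕ} (p : ℝ≥0∞) (f : EuclideanSpace ℝ (Fin d) → ℝ)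
    (Ω : Set (EuclideanSpace ℝ (Fin d))) : Prop :=
  LocallyIntegrableOn f Ω ∧ hessianSchattenVar p f Ω < ⊤

/-! ### Weak derivatives, signed Radon measures and `BV_loc` on an open subset of the line -/

/-- `φ ∈ C_c^∞(I)`. -/
structure IsTestFunction (I : Set ℝ) (φ : ℝ → ℝ) : Prop where
  smooth : ContDiff ℝ ∞ φ
  hasCompactSupport : HasCompactSupport φ
  tsupport_subset : tsupport φ ⊆ I

/-- `u, u' ∈ L^1_loc(I)` and `u'` is the weak derivative of `u` on the open set `I`. -/
structure IsWeakDeriv (I : Set ℝ) (u u' : ℝ → ℝ) : Prop where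
  locallyIntegrableOn : LocallyIntegrableOn u I
  locallyIntegrableOn_deriv : LocallyIntegrableOn u' I
  integral_eq : ∀ φ, IsTestFunction I φ →
    ∫ s in I, u s * deriv φ s = -∫ s in I, u' s * φ s

/-- `u ∈ W^{1,1}_loc(I)`. -/
def MemW11Loc (I : Set ℝ) (u : ℝ → ℝ) : Prop :=
  ∃ u', IsWeakDeriv I u u'

/-- A real (signed) Radon measure on the open set `I`, possibly of infinite total variation, given
by its Jordan decomposition: two mutually singular positive measures carried by `I` which are
finite on the compact subsets of `I`. -/
structure RealRadonMeasure (I : Set ℝ) where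
  pos : Measure ℝ
  neg : Measure ℝ
  pos_compl : pos Iᶜ = 0
  neg_compl : neg Iᶜ = 0
  pos_lt_top : ∀ K ⊆ I, IsCompact K → pos K < ⊤
  neg_lt_top : ∀ K ⊆ I, IsCompact K → neg K < ⊤
  mutuallySingular : pos ⟂ₘ neg

/-- The variation `|μ^s|` of the singular part `μ^s` in the Lebesgue decomposition
`μ = μ^s + μ^a ℒ^1`. -/
def RealRadonMeasure.singularVariation {I : Set ℝ} (μ : RealRadonMeasure I) : Measure ℝ :=
  μ.pos.singularPart volume + μ.neg.singularPart volume

/-- The density `μ^a` in the Lebesgue decomposition `μ = μ^s + μ^a ℒ^1`. -/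
def RealRadonMeasure.density {I : Set ℝ} (μ : RealRadonMeasure I) : ℝ → ℝ :=
  fun s => (μ.pos.rnDeriv volume s).toReal - (μ.neg.rnDeriv volume s).toReal

/-- The distributional derivative `D u` of `u ∈ L^1_loc(I)` is the real Radon measure `μ` on `I`. -/
structure IsDerivMeasure (I : Set ℝ) (u : ℝ → ℝ) (μ : RealRadonMeasure I) : Prop where
  locallyIntegrableOn : LocallyIntegrableOn u I
  integral_eq : ∀ φ, IsTestFunction I φ →
    ∫ s in I, u s * deriv φ s = -(∫ s, φ s ∂μ.pos - ∫ s, φ s ∂μ.neg)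

/-- `u ∈ BV_loc(I)`. -/
def MemBVLoc (I : Set ℝ) (u : ℝ → ℝ) : Prop :=
  ∃ μ : RealRadonMeasure I, IsDerivMeasure I u μ

/-- For a function `g` on `(0,R)` with weak derivative `g'` and `D g' = μ = D^s g' + g'' ℒ^1`, the
quantity `∫_{(0,r)} s^{d-1} d|D^s g'|(s) + ∫_0^r ‖(s g''(s), g'(s), …, g'(s))‖_{ℓ^p} s^{d-2} ds`, in
which `g'(s)` is repeated `d - 1` times. -/
def radialEnergy {R : ℝ} (d : ℕ) (p : ℝ≥0∞) (g' : ℝ → ℝ) (μ : RealRadonMeasure (Set.Ioo 0 R))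
    (r : ℝ) : ℝ≥0∞ :=
  (∫⁻ s in Set.Ioo 0 r, ENNReal.ofReal (s ^ (d - 1)) ∂μ.singularVariation) +
  ∫⁻ s in Set.Ioo 0 r, ENNReal.ofReal
    (ellpNorm p (Fin.cons (s * μ.density s) (fun _ : Fin (d - 1) => g' s) : Fin (d - 1 + 1) → ℝ)
      * s ^ (d - 2))

end

/-!
For a smooth radial function `f(x) = g(|x|)` the Hessian at `x = s n`, `|n| = 1`, is
`g''(s) n⊗n + (g'(s)/s) (I - n⊗n)`. Its eigenvalues are `g''(s)`, and `g'(s)/s` with multiplicity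
`d - 1`, so the formula is integration in polar coordinates of its Schatten norm. In general
`g''` is a measure and everything has to be read off the pairings `∫ f ∂_i∂_j F_{ij}`.

*Reduction to the half-line.* Averaging a test field over spheres turns the pairing into
`∫ g D ds`, where `D` is the integral of the double divergence of `F` over the sphere of radius
`s` (`setIntegral_radial_doubleDivergence`). The divergence theorem on spheres (`hasDerivAt_flux`,
obtained by testing with radial functions) shows `E' = D` and `A' = E + B`, where `E` is the flux of
the divergence of `F`, `A` is the integral of `n·Fn` and `B` is `s⁻¹` times the integral of
`tr F - n·Fn` over that sphere. Hence, away from the origin, the pairing is `∫ A dDg' + ∫ g' B ds`.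

*Upper bound.* The diagonal of a matrix in an orthonormal basis is controlled by its singular values
(`ellpNorm_diag_le_schattenNorm`), so Hölder's inequality bounds `x n·Fn + y (tr F - n·Fn)` by the
`ℓ^p` norm of `(x, y, …, y)` (`radial_pairing_le`). The origin is removed by a cutoff whose
contribution vanishes in the limit, because `s^{d-1} g` and `s^{d-2} g'` are integrable there and
`E = O(s^d)`, `A = O(s^{d-1})` (`integral_mul_doubleDivergence_le`).

*Lower bound.* The fields `a(|x|) n⊗n + b(|x|) (I - n⊗n)` are admissible when the dual `ℓ^{p*}` norm
of `(a, b, …, b)` is at most `1`, and this class is norming (`exists_radialNorm_dual`). What remains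
is a duality statement on the line for a pair of measures: the integral of a norm of a density is
attained by test functions with values in the dual unit ball
(`lintegral_le_of_forall_pairing_le`). It is applied to the polar decomposition of `(Dg', g')` with
respect to `|D^s g'| + ℒ^1` (`radialEnergy_le_of_radialField`). Both bounds together give the
formula whenever `g'` and `Dg'` exist, with both sides possibly infinite
(`hessianSchattenVar_radial`).

*Regularity.* If `f` has bounded variation, the fields `φ(|x|) |x|^{1-d} n⊗n` give
`|∫ g φ''| ≤ C sup |φ|` away from the origin. Taking primitives, `|∫ g φ'| ≤ C ∫ |φ|`, which makes
the mollifications of `g` locally Lipschitz in the limit, so that `g` is weakly differentiable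
(`memW11Loc_of_bound`). Moreover `|∫ g' φ'| ≤ C sup |φ|`, so that `g'` has locally bounded variation
on a set of full measure; there it is a difference of monotone functions, and their
Lebesgue–Stieltjes measures give `Dg'` (`memBVLoc_of_bound`).
-/

/-! ### Finite `ℓ^p` norms -/

section EllpNorm

variable {ι κ : Type*} [Fintype ι] [Fintype κ] {p : ℝ≥0∞}

theorem ellpNorm_top (v : ι → ℝ) : ellpNorm ⊤ v = ⨆ i, |v i| := by
  simp [ellpNorm, PiLp.norm_eq_ciSup]

theorem ellpNorm_ofReal {r : ℝ} (hr : 1 ≤ r) (v : ι → ℝ) :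
    ellpNorm (ENNReal.ofReal r) v = (∑ i, |v i| ^ r) ^ (1 / r) := by
  have h : (ENNReal.ofReal r).toReal = r := ENNReal.toReal_ofReal (by linarith)
  rw [ellpNorm, PiLp.norm_eq_sum (by rw [h]; linarith), h]
  simp

theorem ellpNorm_one (v : ι → ℝ) : ellpNorm 1 v = ∑ i, |v i| := by
  have := ellpNorm_ofReal (le_refl 1) v
  simpa using this

theorem eq_top_or_eq_ofReal (hp : 1 ≤ p) : p = ⊤ ∨ ∃ r : ℝ, 1 ≤ r ∧ p = ENNReal.ofReal r := by
  rcases eq_or_ne p ⊤ with h | h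
  · exact Or.inl h
  · refine Or.inr ⟨p.toReal, ?_, (ENNReal.ofReal_toReal h).symm⟩
    simpa using ENNReal.toReal_mono h hp

theorem one_le_conjExponent (p : ℝ≥0∞) : 1 ≤ ENNReal.conjExponent p := by
  simp [ENNReal.conjExponent]

theorem conjExponent_ofReal {r : ℝ} (hr : 1 < r) :
    ENNReal.conjExponent (ENNReal.ofReal r) = ENNReal.ofReal (r / (r - 1)) := by
  have h1 : 0 < r - 1 := by linarith
  rw [ENNReal.conjExponent, ← ENNReal.ofReal_one, ← ENNReal.ofReal_sub _ zero_le_one,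
    ← ENNReal.ofReal_inv_of_pos h1, ← ENNReal.ofReal_add zero_le_one (by positivity)]
  congr 1
  field_simp
  ring

theorem ellpNorm_nonneg (hp : 1 ≤ p) (v : ι → ℝ) : 0 ≤ ellpNorm p v := by
  have : Fact (1 ≤ p) := ⟨hp⟩
  exact norm_nonneg _

theorem abs_le_ellpNorm (hp : 1 ≤ p) (v : ι → ℝ) (i : ι) : |v i| ≤ ellpNorm p v := by
  have : Fact (1 ≤ p) := ⟨hp⟩
  exact PiLp.norm_apply_le (WithLp.toLp p v) i

theorem ellpNorm_smul (hp : 1 ≤ p) (c : ℝ) (v : ι → ℝ) :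
    ellpNorm p (fun i => c * v i) = |c| * ellpNorm p v := by
  have : Fact (1 ≤ p) := ⟨hp⟩
  exact norm_smul c (WithLp.toLp p v)

theorem ellpNorm_le_sum_abs (hp : 1 ≤ p) (v : ι → ℝ) : ellpNorm p v ≤ ∑ i, |v i| := by
  classical
  have : Fact (1 ≤ p) := ⟨hp⟩
  have h : WithLp.toLp p v = ∑ i, PiLp.single p i (v i) := by
    ext j
    simp [Pi.single_apply]
  rw [ellpNorm, h]
  refine (norm_sum_le _ _).trans (Finset.sum_le_sum fun i _ => ?_)
  simp [PiLp.norm_single]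

/-- Hölder's inequality for finite sums, for all pairs of conjugate exponents in `[1,∞]`. -/
theorem sum_mul_le_ellpNorm_mul (hp : 1 ≤ p) (v w : ι → ℝ) :
    ∑ i, v i * w i ≤ ellpNorm p v * ellpNorm (ENNReal.conjExponent p) w := by
  have key : ∀ v w : ι → ℝ, ∑ i, v i * w i ≤ ellpNorm 1 v * ellpNorm ⊤ w := fun v w => by
    rw [ellpNorm_one, Finset.sum_mul]
    refine Finset.sum_le_sum fun i _ => (le_abs_self _).trans ?_
    rw [abs_mul]
    exact mul_le_mul_of_nonneg_left (abs_le_ellpNorm le_top w i) (abs_nonneg _)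
  rcases eq_top_or_eq_ofReal hp with rfl | ⟨r, hr, rfl⟩
  · have : ENNReal.conjExponent ⊤ = 1 := by simp [ENNReal.conjExponent]
    rw [this, mul_comm]
    simpa only [mul_comm] using key w v
  · rcases hr.eq_or_lt with rfl | hr1
    · have : ENNReal.conjExponent (ENNReal.ofReal 1) = ⊤ := by simp [ENNReal.conjExponent]
      rw [this, ENNReal.ofReal_one]
      exact key v w
    · have hc : r.HolderConjugate (r / (r - 1)) :=
        (Real.holderConjugate_iff_eq_conjExponent hr1).2 rfl
      rw [conjExponent_ofReal hr1, ellpNorm_ofReal hr, ellpNorm_ofReal hc.symm.lt.le]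
      exact Real.inner_le_Lp_mul_Lq _ v w hc

/-- A matrix whose rows and columns all have `ℓ^1` norm at most `1` is a contraction for every
`ℓ^p` norm. -/
theorem ellpNorm_le_of_substochastic (hp : 1 ≤ p) (c : κ → ι → ℝ)
    (hrow : ∀ k, ∑ i, |c k i| ≤ 1) (hcol : ∀ i, ∑ k, |c k i| ≤ 1) (x : ι → ℝ) :
    ellpNorm p (fun k => ∑ i, c k i * x i) ≤ ellpNorm p x := by
  rcases eq_top_or_eq_ofReal hp with rfl | ⟨r, hr, rfl⟩
  · rw [ellpNorm_top]
    refine Real.iSup_le (fun k => ?_) (ellpNorm_nonneg hp x)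
    calc |∑ i, c k i * x i| ≤ ∑ i, |c k i| * |x i| := by
          refine (Finset.abs_sum_le_sum_abs _ _).trans (le_of_eq ?_)
          simp [abs_mul]
      _ ≤ ∑ i, |c k i| * ellpNorm ⊤ x := Finset.sum_le_sum fun i _ =>
          mul_le_mul_of_nonneg_left (abs_le_ellpNorm le_top x i) (abs_nonneg _)
      _ = (∑ i, |c k i|) * ellpNorm ⊤ x := (Finset.sum_mul _ _ _).symm
      _ ≤ ellpNorm ⊤ x := mul_le_of_le_one_left (ellpNorm_nonneg hp x) (hrow k)
  · have hr0 : 0 < r := by linarith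
    rw [ellpNorm_ofReal hr, ellpNorm_ofReal hr]
    refine Real.rpow_le_rpow (Finset.sum_nonneg fun k _ => Real.rpow_nonneg (abs_nonneg _) _) ?_
      (by positivity)
    have hk : ∀ k, |∑ i, c k i * x i| ^ r ≤ ∑ i, |c k i| * |x i| ^ r := fun k => by
      have hS : 0 ≤ ∑ i, |c k i| * |x i| ^ r :=
        Finset.sum_nonneg fun i _ => mul_nonneg (abs_nonneg _) (Real.rpow_nonneg (abs_nonneg _) _)
      have h1 : |∑ i, c k i * x i| ≤ ∑ i, |c k i| * |x i| := by
        refine (Finset.abs_sum_le_sum_abs _ _).trans (le_of_eq ?_)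
        simp [abs_mul]
      have h2 := Real.inner_le_weight_mul_Lp_of_nonneg Finset.univ hr (fun i => |c k i|)
        (fun i => |x i|) (fun i => abs_nonneg _) (fun i => abs_nonneg _)
      have h3 : (∑ i, |c k i|) ^ (1 - r⁻¹) ≤ 1 :=
        Real.rpow_le_one (Finset.sum_nonneg fun i _ => abs_nonneg _) (hrow k)
          (sub_nonneg.2 (inv_le_one_of_one_le₀ hr))
      have h4 : |∑ i, c k i * x i| ≤ (∑ i, |c k i| * |x i| ^ r) ^ r⁻¹ :=
        h1.trans (h2.trans (mul_le_of_le_one_left (Real.rpow_nonneg hS _) h3))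
      calc _ ≤ ((∑ i, |c k i| * |x i| ^ r) ^ r⁻¹) ^ r :=
            Real.rpow_le_rpow (abs_nonneg _) h4 hr0.le
        _ = _ := by rw [← Real.rpow_mul hS, inv_mul_cancel₀ hr0.ne', Real.rpow_one]
    calc ∑ k, |∑ i, c k i * x i| ^ r ≤ ∑ k, ∑ i, |c k i| * |x i| ^ r :=
          Finset.sum_le_sum fun k _ => hk k
      _ = ∑ i, (∑ k, |c k i|) * |x i| ^ r := by
          rw [Finset.sum_comm]
          simp [Finset.sum_mul]
      _ ≤ ∑ i, |x i| ^ r := Finset.sum_le_sum fun i _ =>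
          mul_le_of_le_one_left (Real.rpow_nonneg (abs_nonneg _) _) (hcol i)

end EllpNorm

/-! ### The norm of the vector `(x, y, …, y)` -/

/-- The `ℓ^p` norm of `(x, y, …, y)`, where `y` is repeated `m` times. The eigenvalues of the Hessian
of a radial function on `ℝ^d` have this shape, with `m = d - 1`. -/
noncomputable def radialNorm (m : ℕ) (p : ℝ≥0∞) (x y : ℝ) : ℝ :=
  ellpNorm p (Fin.cons x (fun _ : Fin m => y) : Fin (m + 1) → ℝ)

section RadialNorm

variable {m : ℕ} {p : ℝ≥0∞}

theorem radialNorm_nonneg (hp : 1 ≤ p) (x y : ℝ) : 0 ≤ radialNorm m p x y := ellpNorm_nonneg hp _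

theorem abs_fst_le_radialNorm (hp : 1 ≤ p) (x y : ℝ) : |x| ≤ radialNorm m p x y := by
  simpa [radialNorm] using abs_le_ellpNorm hp (Fin.cons x (fun _ : Fin m => y) : Fin (m + 1) → ℝ) 0

theorem abs_snd_le_radialNorm (hm : 1 ≤ m) (hp : 1 ≤ p) (x y : ℝ) : |y| ≤ radialNorm m p x y := by
  obtain ⟨k, rfl⟩ : ∃ k, m = k + 1 := ⟨m - 1, by omega⟩
  simpa [radialNorm] using
    abs_le_ellpNorm hp (Fin.cons x (fun _ : Fin (k + 1) => y) : Fin (k + 1 + 1) → ℝ) (Fin.succ 0)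

theorem radialNorm_le (hp : 1 ≤ p) (x y : ℝ) : radialNorm m p x y ≤ |x| + m * |y| := by
  refine (ellpNorm_le_sum_abs hp _).trans (le_of_eq ?_)
  simp [Fin.sum_univ_succ]

theorem radialNorm_zero_right (hp : 1 ≤ p) (x : ℝ) : radialNorm m p x 0 = |x| :=
  le_antisymm (by simpa using radialNorm_le (m := m) hp x 0) (abs_fst_le_radialNorm hp x 0)

theorem radialNorm_mul (hp : 1 ≤ p) {c : ℝ} (hc : 0 ≤ c) (x y : ℝ) :
    radialNorm m p (c * x) (c * y) = c * radialNorm m p x y := by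
  have := ellpNorm_smul hp c (Fin.cons x (fun _ : Fin m => y) : Fin (m + 1) → ℝ)
  rw [abs_of_nonneg hc] at this
  rw [radialNorm, radialNorm, ← this]
  congr 1
  funext i
  refine Fin.cases ?_ (fun j => ?_) i <;> simp

theorem radialNorm_ofReal {r : ℝ} (hr : 1 ≤ r) (x y : ℝ) :
    radialNorm m (ENNReal.ofReal r) x y = (|x| ^ r + m * |y| ^ r) ^ (1 / r) := by
  rw [radialNorm, ellpNorm_ofReal hr]
  simp [Fin.sum_univ_succ]

/-- The dual norm is attained within vectors of the same shape `(a, b, …, b)`. -/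
theorem exists_radialNorm_dual (hm : 1 ≤ m) (hp : 1 ≤ p) (x y : ℝ) :
    ∃ a b : ℝ, radialNorm m (ENNReal.conjExponent p) a b ≤ 1 ∧
      radialNorm m p x y = a * x + m * (b * y) := by
  have hm0 : (0 : ℝ) < m := by exact_mod_cast hm
  have hsign : ∀ z : ℝ, |(SignType.sign z : ℝ)| ≤ 1 := fun z => by
    rcases lt_trichotomy z 0 with h | h | h <;> simp [h]
  have hsignmul : ∀ z : ℝ, (SignType.sign z : ℝ) * z = |z| := fun z => sign_mul_self z
  rcases eq_top_or_eq_ofReal hp with rfl | ⟨r, hr, rfl⟩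
  · have hq : ENNReal.conjExponent ⊤ = 1 := by simp [ENNReal.conjExponent]
    have hN : radialNorm m ⊤ x y ≤ max |x| |y| := by
      rw [radialNorm, ellpNorm_top]
      refine Real.iSup_le (fun i => ?_) (le_max_of_le_left (abs_nonneg _))
      refine Fin.cases ?_ (fun j => ?_) i <;> simp
    have h1 := abs_fst_le_radialNorm (m := m) hp x y
    have h2 := abs_snd_le_radialNorm hm hp x y
    rw [hq]
    rcases le_total |y| |x| with h | h
    · refine ⟨SignType.sign x, 0, ?_, ?_⟩
      · rw [radialNorm_zero_right le_rfl]
        exact hsign x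
      · rw [hsignmul]
        rw [max_eq_left h] at hN
        linarith
    · refine ⟨0, SignType.sign y / m, ?_, ?_⟩
      · refine (radialNorm_le le_rfl _ _).trans ?_
        rw [abs_zero, zero_add, abs_div, abs_of_pos hm0, mul_div_cancel₀ _ hm0.ne']
        exact hsign y
      · rw [max_eq_right h] at hN
        have : (m : ℝ) * ((SignType.sign y : ℝ) / m * y) = |y| := by
          rw [← hsignmul]
          field_simp
        rw [this]
        linarith
  · rcases hr.eq_or_lt with rfl | hr1
    · have hq : ENNReal.conjExponent (ENNReal.ofReal 1) = ⊤ := by simp [ENNReal.conjExponent]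
      refine ⟨SignType.sign x, SignType.sign y, ?_, ?_⟩
      · rw [hq, radialNorm, ellpNorm_top]
        refine Real.iSup_le (fun i => ?_) zero_le_one
        refine Fin.cases ?_ (fun j => ?_) i
        · simpa using hsign x
        · simpa using hsign y
      · rw [radialNorm_ofReal le_rfl, hsignmul, hsignmul]
        simp
    · have hc : r.HolderConjugate (r / (r - 1)) :=
        (Real.holderConjugate_iff_eq_conjExponent hr1).2 rfl
      set q := r / (r - 1) with hqdef
      have hr0 : 0 < r := by linarith
      have hq0 : 0 < q := hc.symm.pos
      have hrq : (r - 1) * q = r := hc.sub_one_mul_conj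
      have hx := Real.rpow_nonneg (abs_nonneg x) r
      have hy := Real.rpow_nonneg (abs_nonneg y) r
      set S := |x| ^ r + m * |y| ^ r with hS
      have hS0 : 0 ≤ S := by positivity
      rw [conjExponent_ofReal hr1, ← hqdef, radialNorm_ofReal hr, ← hS]
      rcases hS0.eq_or_lt with h0 | hpos
      · refine ⟨0, 0, ?_, ?_⟩
        · rw [radialNorm_zero_right (by simpa using ENNReal.ofReal_le_ofReal hc.symm.lt.le)]
          simp
        · rw [← h0, Real.zero_rpow (by positivity)]
          simp
      -- the extremal vector is `sign(z)|z|^{r-1}`, normalised by the `(r-1)`-st power of the norm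
      · have hmul : ∀ z : ℝ, (SignType.sign z : ℝ) * |z| ^ (r - 1) * z = |z| ^ r := fun z => by
          rw [mul_right_comm, hsignmul]
          rcases eq_or_ne z 0 with rfl | hz
          · simp [Real.zero_rpow hr0.ne']
          · have hz' : 0 < |z| := abs_pos.2 hz
            nth_rewrite 1 [← Real.rpow_one |z|]
            rw [← Real.rpow_add hz']
            congr 1
            ring
        have hpw : ∀ z : ℝ, |(SignType.sign z : ℝ) * |z| ^ (r - 1) * S ^ (-(1 / q))| ^ q
            ≤ |z| ^ r * S⁻¹ := fun z => by
          rw [abs_mul, abs_mul, abs_of_nonneg (Real.rpow_nonneg hS0 _),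
            abs_of_nonneg (Real.rpow_nonneg (abs_nonneg z) _),
            Real.mul_rpow (by positivity) (by positivity), Real.mul_rpow (by positivity)
            (by positivity), ← Real.rpow_mul (abs_nonneg z), ← Real.rpow_mul hS0, hrq]
          have : -(1 / q) * q = -1 := by field_simp
          rw [this, Real.rpow_neg_one]
          have h1 : |(SignType.sign z : ℝ)| ^ q ≤ 1 :=
            Real.rpow_le_one (abs_nonneg _) (hsign z) hq0.le
          have h2 := Real.rpow_nonneg (abs_nonneg z) r
          have h3 : 0 ≤ S⁻¹ := by positivity
          nlinarith [mul_nonneg h2 h3]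
        refine ⟨SignType.sign x * |x| ^ (r - 1) * S ^ (-(1 / q)),
          SignType.sign y * |y| ^ (r - 1) * S ^ (-(1 / q)), ?_, ?_⟩
        · rw [radialNorm_ofReal hc.symm.lt.le]
          refine Real.rpow_le_one (by positivity) ?_ (by positivity)
          have h1 := hpw x
          have h2 := mul_le_mul_of_nonneg_left (hpw y) hm0.le
          calc _ ≤ |x| ^ r * S⁻¹ + m * (|y| ^ r * S⁻¹) := add_le_add h1 h2
            _ = S * S⁻¹ := by rw [hS]; ring
            _ = 1 := mul_inv_cancel₀ hpos.ne'
        · have e1 := hmul x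
          have e2 := hmul y
          calc S ^ (1 / r) = S * S ^ (-(1 / q)) := by
                nth_rewrite 2 [← Real.rpow_one S]
                rw [← Real.rpow_add hpos]
                congr 1
                have := hc.inv_add_inv_eq_one
                simp only [one_div]
                linarith
            _ = _ := by
                nth_rewrite 1 [hS]
                rw [← e1, ← e2]
                ring

end RadialNorm

/-! ### Singular values and Schatten norms -/

section Schatten

variable {d : ℕ} {p : ℝ≥0∞}

local notation "𝔼" => EuclideanSpace ℝ (Fin d)

/-- A singular value decomposition `M v_k = σ_k u_k`. The vectors `v_k` form an orthonormal basis;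
`u_k = 0` where `σ_k = 0`, so that the `u_k` only satisfy Bessel's inequality. -/
theorem exists_singularValue_decomposition (T : 𝔼 →ₗ[ℝ] 𝔼) :
    ∃ (v : OrthonormalBasis (Fin d) ℝ 𝔼) (u : Fin d → 𝔼),
      (∀ x, ∑ k, inner ℝ (u k) x ^ 2 ≤ ‖x‖ ^ 2) ∧ (∀ k, ‖u k‖ ≤ 1) ∧
      (∀ k, T (v k) = T.singularValues k • u k) ∧
      (∀ k, inner ℝ (u k) (T (v k)) = T.singularValues k) := by
  have hd : Module.finrank ℝ 𝔼 = d := by simp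
  set hT := T.isSymmetric_adjoint_comp_self
  set v := hT.eigenvectorBasis hd
  have hev : ∀ i, hT.eigenvalues hd i = T.singularValues i ^ 2 := fun i =>
    (T.sq_singularValues_fin hd i).symm
  have hin : ∀ k l, inner ℝ (T (v k)) (T (v l)) =
      T.singularValues k ^ 2 * (if k = l then 1 else 0) := fun k l => by
    have h1 : (LinearMap.adjoint T ∘ₗ T) (v k) = (hT.eigenvalues hd k : ℝ) • v k :=
      hT.apply_eigenvectorBasis hd k
    rw [← LinearMap.adjoint_inner_left, ← LinearMap.comp_apply, h1, inner_smul_left, hev]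
    simp [orthonormal_iff_ite.1 v.orthonormal k l]
  set u : Fin d → 𝔼 := fun k => (T.singularValues k)⁻¹ • T (v k) with hu
  have huu : ∀ k l : Fin d, T.singularValues k ≠ 0 →
      inner ℝ (u k) (u l) = if k = l then (1 : ℝ) else 0 := fun k l hk => by
    simp only [hu, inner_smul_left, inner_smul_right, hin]
    by_cases h : k = l
    · subst h
      simp only [if_true, conj_trivial]
      field_simp
    · simp [h]
  have hzero : ∀ k : Fin d, T.singularValues k = 0 → T (v k) = 0 := fun k hk => by
    have := hin k k
    rw [hk] at this
    simpa using this
  have hu0 : ∀ k : Fin d, T.singularValues k = 0 → u k = 0 := fun k hk => by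
    simp [hu, hk]
  refine ⟨v, u, fun x => ?_, fun k => ?_, fun k => ?_, fun k => ?_⟩
  · have hon : Orthonormal ℝ (fun k : {k : Fin d // T.singularValues k ≠ 0} => u k) := by
      rw [orthonormal_iff_ite]
      intro k l
      rw [huu k l k.2]
      simp [Subtype.ext_iff]
    have := hon.sum_inner_products_le (s := Finset.univ) x
    refine le_trans (le_of_eq ?_) this
    rw [← Finset.sum_subtype (Finset.univ.filter fun k : Fin d => T.singularValues k ≠ 0)
      (by simp) (fun k => ‖inner ℝ (u k) x‖ ^ 2), Finset.sum_filter_of_ne]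
    · simp
    · intro k _ hk h0
      apply hk
      simp [hu0 k h0]
  · by_cases hk : T.singularValues k = 0
    · simp [hu0 k hk]
    · have := huu k k hk
      rw [real_inner_self_eq_norm_sq] at this
      simp only [if_true] at this
      nlinarith [norm_nonneg (u k)]
  · by_cases hk : T.singularValues k = 0
    · simp [hk, hzero k hk]
    · simp [hu, smul_smul, mul_inv_cancel₀ hk]
  · by_cases hk : T.singularValues k = 0
    · simp [hk, hzero k hk]
    · simp only [hu, inner_smul_left, hin]
      simp
      field_simp

/-- The products of coefficients of two systems satisfying Bessel's inequality are
substochastic. -/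
theorem sum_abs_mul_le_one {ι : Type*} [Fintype ι] {a b : ι → ℝ} (ha : ∑ i, a i ^ 2 ≤ 1)
    (hb : ∑ i, b i ^ 2 ≤ 1) : ∑ i, |a i * b i| ≤ 1 := by
  calc ∑ i, |a i * b i| ≤ ∑ i, (a i ^ 2 + b i ^ 2) / 2 := Finset.sum_le_sum fun i _ => by
        rw [abs_mul]
        nlinarith [sq_nonneg (|a i| - |b i|), sq_abs (a i), sq_abs (b i)]
    _ = (∑ i, a i ^ 2 + ∑ i, b i ^ 2) / 2 := by
        rw [← Finset.sum_add_distrib, Finset.sum_div]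
    _ ≤ 1 := by linarith

variable {ι : Type*} [Fintype ι]

/-- The diagonal of a matrix in any orthonormal basis is bounded by its singular values. -/
theorem ellpNorm_diag_le_schattenNorm (hp : 1 ≤ p) (M : Matrix (Fin d) (Fin d) ℝ)
    (e : OrthonormalBasis ι ℝ 𝔼) :
    ellpNorm p (fun i => inner ℝ (e i) (Matrix.toEuclideanLin M (e i))) ≤ schattenNorm p M := by
  set T := Matrix.toEuclideanLin M with hT
  obtain ⟨v, u, hu, hu1, hTv, -⟩ := exists_singularValue_decomposition T
  have h : (fun i => inner ℝ (e i) (T (e i))) = fun i => ∑ k : Fin d,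
      (inner ℝ (e i) (u k) * inner ℝ (v k) (e i)) * T.singularValues k := by
    funext i
    nth_rewrite 2 [← v.sum_repr' (e i)]
    rw [map_sum, inner_sum]
    refine Finset.sum_congr rfl fun k _ => ?_
    rw [map_smul, hTv, inner_smul_right, inner_smul_right]
    ring
  rw [h, schattenNorm]
  refine ellpNorm_le_of_substochastic hp _ (fun i => ?_) (fun k => ?_) _
  · refine sum_abs_mul_le_one ?_ ?_
    · have := hu (e i)
      simpa [real_inner_comm] using this
    · have := v.sum_sq_norm_inner_right (e i)
      simp only [Real.norm_eq_abs, sq_abs] at this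
      simp [this]
  · refine sum_abs_mul_le_one ?_ ?_
    · have := e.sum_sq_norm_inner_right (u k)
      simp only [Real.norm_eq_abs, sq_abs] at this
      rw [this]
      nlinarith [hu1 k, norm_nonneg (u k)]
    · have := e.sum_sq_norm_inner_left (v k)
      simp only [Real.norm_eq_abs, sq_abs] at this
      simp [this]

/-- The singular values of a matrix which is diagonal in an orthonormal basis are bounded by its
eigenvalues. -/
theorem schattenNorm_le_of_diagonal (hp : 1 ≤ p) (M : Matrix (Fin d) (Fin d) ℝ)
    (e : OrthonormalBasis ι ℝ 𝔼) (l : ι → ℝ)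
    (hM : ∀ i, Matrix.toEuclideanLin M (e i) = l i • e i) :
    schattenNorm p M ≤ ellpNorm p l := by
  set T := Matrix.toEuclideanLin M with hT
  obtain ⟨v, u, hu, hu1, -, huv⟩ := exists_singularValue_decomposition T
  have h : (fun k : Fin d => T.singularValues k) = fun k : Fin d => ∑ i,
      (inner ℝ (u k) (e i) * inner ℝ (e i) (v k)) * l i := by
    funext k
    rw [← huv k]
    nth_rewrite 1 [← e.sum_repr' (v k)]
    rw [map_sum, inner_sum]
    refine Finset.sum_congr rfl fun i _ => ?_
    rw [map_smul, hM, inner_smul_right, inner_smul_right]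
    ring
  rw [schattenNorm, ← hT, h]
  refine ellpNorm_le_of_substochastic hp _ (fun k => ?_) (fun i => ?_) _
  · refine sum_abs_mul_le_one ?_ ?_
    · have := e.sum_sq_norm_inner_left (u k)
      simp only [Real.norm_eq_abs, sq_abs] at this
      rw [this]
      nlinarith [hu1 k, norm_nonneg (u k)]
    · have := e.sum_sq_norm_inner_right (v k)
      simp only [Real.norm_eq_abs, sq_abs] at this
      simp [this]
  · refine sum_abs_mul_le_one ?_ ?_
    · simpa using hu (e i)
    · have := v.sum_sq_norm_inner_left (e i)
      simp only [Real.norm_eq_abs, sq_abs] at this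
      simp [this]

/-- Every unit vector is the first vector of an orthonormal basis. -/
theorem exists_orthonormalBasis_zero_eq (hd : 1 ≤ d) {n : 𝔼} (hn : ‖n‖ = 1) :
    ∃ e : OrthonormalBasis (Fin (d - 1 + 1)) ℝ 𝔼, e 0 = n := by
  have hcard : Module.finrank ℝ 𝔼 = Fintype.card (Fin (d - 1 + 1)) := by
    simp
    omega
  obtain ⟨e, he⟩ := Orthonormal.exists_orthonormalBasis_extension_of_card_eq hcard
    (v := fun _ : Fin (d - 1 + 1) => n) (s := {0}) (by
      rw [orthonormal_iff_ite]
      rintro ⟨i, hi⟩ ⟨j, hj⟩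
      simp only [Set.mem_singleton_iff] at hi hj
      subst hi hj
      simp [hn])
  exact ⟨e, he 0 rfl⟩

theorem inner_toEuclideanLin (M : Matrix (Fin d) (Fin d) ℝ) (x : 𝔼) :
    inner ℝ x (Matrix.toEuclideanLin M x) = ∑ i, ∑ j, x i * x j * M i j := by
  simp only [PiLp.inner_apply, Matrix.toLpLin_apply, Matrix.mulVec, dotProduct, RCLike.inner_apply,
    conj_trivial, Finset.sum_mul]
  refine Finset.sum_congr rfl fun i _ => Finset.sum_congr rfl fun j _ => ?_
  ring

theorem sum_inner_toEuclideanLin (M : Matrix (Fin d) (Fin d) ℝ) (e : OrthonormalBasis ι ℝ 𝔼) :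
    ∑ i, inner ℝ (e i) (Matrix.toEuclideanLin M (e i)) = ∑ i, M i i := by
  rw [← LinearMap.trace_eq_sum_inner, LinearMap.trace_eq_sum_inner _ (EuclideanSpace.basisFun _ ℝ)]
  refine Finset.sum_congr rfl fun i _ => ?_
  rw [inner_toEuclideanLin]
  simp [PiLp.single_apply]

/-- Duality between the eigenvalues `x, y, …, y` of the radial Hessian `x n⊗n + y (I - n⊗n)` and the
Schatten norm of a matrix. -/
theorem radial_pairing_le (hd : 1 ≤ d) (hp : 1 ≤ p) (M : Matrix (Fin d) (Fin d) ℝ) {n : 𝔼}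
    (hn : ‖n‖ = 1) (x y : ℝ) :
    x * (∑ i, ∑ j, n i * n j * M i j)
        + y * (∑ i, ∑ j, ((if i = j then 1 else 0) - n i * n j) * M i j)
      ≤ radialNorm (d - 1) p x y * schattenNorm (ENNReal.conjExponent p) M := by
  obtain ⟨e, he⟩ := exists_orthonormalBasis_zero_eq hd hn
  have h1 : ∑ i, ∑ j, n i * n j * M i j = inner ℝ (e 0) (Matrix.toEuclideanLin M (e 0)) := by
    rw [he, inner_toEuclideanLin]
  have h2 : ∑ i, ∑ j, ((if i = j then 1 else 0) - n i * n j) * M i j =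
      ∑ k : Fin (d - 1), inner ℝ (e k.succ) (Matrix.toEuclideanLin M (e k.succ)) := by
    have h3 := sum_inner_toEuclideanLin M e
    rw [Fin.sum_univ_succ, ← h1] at h3
    simp only [sub_mul, Finset.sum_sub_distrib, ite_mul, one_mul, zero_mul,
      Finset.sum_ite_eq, Finset.mem_univ, if_true]
    linarith
  calc _ = ∑ k, (Fin.cons x (fun _ : Fin (d - 1) => y) : Fin (d - 1 + 1) → ℝ) k *
        inner ℝ (e k) (Matrix.toEuclideanLin M (e k)) := by
        rw [Fin.sum_univ_succ, h1, h2]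
        simp [Finset.mul_sum]
    _ ≤ radialNorm (d - 1) p x y * ellpNorm (ENNReal.conjExponent p)
        (fun k => inner ℝ (e k) (Matrix.toEuclideanLin M (e k))) := sum_mul_le_ellpNorm_mul hp _ _
    _ ≤ _ := mul_le_mul_of_nonneg_left (ellpNorm_diag_le_schattenNorm (one_le_conjExponent p) M e)
        (radialNorm_nonneg hp x y)

/-- The matrix `a n⊗n + b (I - n⊗n)` is diagonal in any orthonormal basis starting with `n`, with
eigenvalues `a, b, …, b`. -/
theorem schattenNorm_radial_le (hd : 1 ≤ d) (hp : 1 ≤ p) {n : 𝔼} (hn : ‖n‖ = 1) (a b : ℝ) :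
    schattenNorm p (Matrix.of fun i j : Fin d =>
      a * (n i * n j) + b * ((if i = j then 1 else 0) - n i * n j))
      ≤ radialNorm (d - 1) p a b := by
  obtain ⟨e, he⟩ := exists_orthonormalBasis_zero_eq hd hn
  have happ : ∀ x : 𝔼, Matrix.toEuclideanLin (Matrix.of fun i j : Fin d =>
      a * (n i * n j) + b * ((if i = j then 1 else 0) - n i * n j)) x =
      (a * inner ℝ n x) • n + b • (x - (inner ℝ n x : ℝ) • n) := fun x => by
    ext i
    simp only [Matrix.toLpLin_apply, Matrix.mulVec, dotProduct, Matrix.of_apply, PiLp.add_apply,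
      PiLp.smul_apply, PiLp.sub_apply, smul_eq_mul, PiLp.inner_apply, RCLike.inner_apply,
      conj_trivial, add_mul, mul_sub, sub_mul, Finset.sum_add_distrib, Finset.sum_sub_distrib,
      mul_ite, ite_mul, mul_one, mul_zero, zero_mul, Finset.sum_ite_eq, Finset.mem_univ, if_true,
      Finset.mul_sum, Finset.sum_mul]
    congr 1
    · exact Finset.sum_congr rfl fun j _ => by ring
    · congr 1
      exact Finset.sum_congr rfl fun j _ => by ring
  refine schattenNorm_le_of_diagonal hp _ e _ fun k => ?_
  rw [happ, ← he, orthonormal_iff_ite.1 e.orthonormal 0 k]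
  refine Fin.cases ?_ (fun j => ?_) k
  · simp
  · simp [(Fin.succ_ne_zero j).symm]

end Schatten

/-! ### Polar coordinates and spherical integrals -/

section Polar

open Metric Set

variable {d : ℕ}

local notation "𝔼" => EuclideanSpace ℝ (Fin d)
local notation "𝕊" => Metric.sphere (0 : EuclideanSpace ℝ (Fin d)) 1
local notation "σ" => Measure.toSphere (volume : Measure (EuclideanSpace ℝ (Fin d)))

/-- Integration in polar coordinates, with the inner integral over the sphere. -/
theorem integral_eq_integral_Ioi_sphere (hd : 1 ≤ d) {G : 𝔼 → ℝ} (hG : Integrable G) :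
    ∫ x, G x = ∫ s in Ioi (0 : ℝ), s ^ (d - 1) * ∫ n : 𝕊, G (s • n) ∂σ := by
  have : Nonempty (Fin d) := ⟨⟨0, hd⟩⟩
  have hfin : Module.finrank ℝ 𝔼 = d := by simp
  have hmp := (volume : Measure 𝔼).measurePreserving_homeomorphUnitSphereProd
  set H : 𝕊 × Ioi (0 : ℝ) → ℝ := fun p => G ((p.2 : ℝ) • (p.1 : 𝔼)) with hH
  have hcomp : ∀ x : ({0}ᶜ : Set 𝔼), H (homeomorphUnitSphereProd 𝔼 x) = G x := fun x => by
    have := homeomorphUnitSphereProd_symm_apply_coe 𝔼 (homeomorphUnitSphereProd 𝔼 x)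
    rw [Homeomorph.symm_apply_apply] at this
    rw [hH, this]
  have hint : Integrable H ((volume : Measure 𝔼).toSphere.prod
      (.volumeIoiPow (Module.finrank ℝ 𝔼 - 1))) := by
    rw [← hmp.integrable_comp_emb (Homeomorph.measurableEmbedding _)]
    have h2 : H ∘ (homeomorphUnitSphereProd 𝔼) = G ∘ (↑) := funext hcomp
    rw [h2, ← integrableOn_iff_comap_subtypeVal (measurableSet_singleton _).compl]
    exact hG.integrableOn
  calc ∫ x, G x = ∫ x : ({0}ᶜ : Set 𝔼), G x ∂(volume.comap Subtype.val) := by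
        rw [integral_subtype_comap (measurableSet_singleton _).compl, restrict_compl_singleton]
    _ = ∫ p, H p ∂(volume : Measure 𝔼).toSphere.prod (.volumeIoiPow (Module.finrank ℝ 𝔼 - 1)) := by
        rw [← hmp.integral_comp (Homeomorph.measurableEmbedding _)]
        simp only [hcomp]
    _ = ∫ s : Ioi (0 : ℝ), (∫ n : 𝕊, G ((s : ℝ) • n) ∂σ)
        ∂.volumeIoiPow (Module.finrank ℝ 𝔼 - 1) := integral_prod_symm _ hint
    _ = _ := by
        simp only [Measure.volumeIoiPow, ENNReal.ofReal]
        rw [integral_withDensity_eq_integral_smul, integral_subtype_comap measurableSet_Ioi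
          fun a : ℝ => Real.toNNReal (a ^ (Module.finrank ℝ 𝔼 - 1)) • ∫ n : 𝕊, G (a • n) ∂σ,
          setIntegral_congr_fun measurableSet_Ioi fun x hx => ?_]
        · rw [NNReal.smul_def, Real.coe_toNNReal _ (pow_nonneg (le_of_lt hx) _), hfin, smul_eq_mul]
        · exact (measurable_subtype_coe.pow_const _).real_toNNReal

instance : CompactSpace 𝕊 := isCompact_iff_compactSpace.1 (isCompact_sphere _ _)

theorem integrable_sphere {H : 𝕊 → ℝ} (hH : Continuous H) : Integrable H σ :=
  hH.integrable_of_hasCompactSupport (HasCompactSupport.of_compactSpace H)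

theorem hasDerivAt_integral_sphere {H : ℝ × 𝔼 → ℝ} (hH : ContDiff ℝ 1 H) (s : ℝ) :
    HasDerivAt (fun s => ∫ n : 𝕊, H (s, n) ∂σ) (∫ n : 𝕊, fderiv ℝ H (s, n) (1, 0) ∂σ) s := by
  have hc : Continuous fun z : ℝ × 𝔼 => fderiv ℝ H z (1, 0) :=
    (hH.continuous_fderiv one_ne_zero).clm_apply continuous_const
  obtain ⟨C, hC⟩ := ((isCompact_closedBall s 1).prod
    (isCompact_sphere (0 : 𝔼) 1)).exists_bound_of_continuousOn hc.continuousOn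
  refine (hasDerivAt_integral_of_dominated_loc_of_deriv_le (bound := fun _ => C)
    (closedBall_mem_nhds s one_pos) ?_ ?_ (F' := fun s (n : 𝕊) => fderiv ℝ H (s, n) (1, 0)) ?_ ?_ ?_
    ?_).2
  · refine Filter.Eventually.of_forall fun t => Continuous.aestronglyMeasurable ?_
    exact hH.continuous.comp (by fun_prop)
  · exact integrable_sphere (hH.continuous.comp (by fun_prop))
  · exact (hc.comp (by fun_prop : Continuous fun n : 𝕊 => (s, (n : 𝔼)))).aestronglyMeasurable
  · exact Filter.Eventually.of_forall fun n t ht => hC (t, n) ⟨ht, n.2⟩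
  · exact integrable_const C
  · refine Filter.Eventually.of_forall fun n t _ => ?_
    have h1 : HasDerivAt (fun t : ℝ => (t, (n : 𝔼))) (1, 0) t :=
      (hasDerivAt_id t).prodMk (hasDerivAt_const t _)
    exact ((hH.differentiable one_ne_zero _).hasFDerivAt).comp_hasDerivAt t h1

/-- Integrals over the sphere depend smoothly on a parameter. -/
theorem contDiff_integral_sphere {H : ℝ × 𝔼 → ℝ} (hH : ContDiff ℝ ∞ H) :
    ContDiff ℝ ∞ (fun s => ∫ n : 𝕊, H (s, n) ∂σ) := by
  rw [contDiff_infty]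
  intro m
  induction m generalizing H with
  | zero =>
    rw [Nat.cast_zero, contDiff_zero, continuous_iff_continuousAt]
    exact fun s => (hasDerivAt_integral_sphere (hH.of_le (by simp)) s).continuousAt
  | succ m ih =>
    have hder := hasDerivAt_integral_sphere (hH.of_le (by simp) : ContDiff ℝ 1 H)
    rw [Nat.cast_succ, contDiff_succ_iff_deriv]
    refine ⟨fun s => (hder s).differentiableAt, by simp, ?_⟩
    have : deriv (fun s => ∫ n : 𝕊, H (s, n) ∂σ) = fun s => ∫ n : 𝕊, fderiv ℝ H (s, n) (1, 0) ∂σ :=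
      funext fun s => (hder s).deriv
    rw [this]
    exact ih (H := fun z => fderiv ℝ H z (1, 0))
      ((hH.fderiv_right (m := ∞) (by simp)).clm_apply contDiff_const)

/-- The spherical integral `∫_{|n|=1} c(n) G(s n) dn`. -/
noncomputable def sphereIntegral (c G : 𝔼 → ℝ) (s : ℝ) : ℝ :=
  ∫ n : 𝕊, c n * G (s • n) ∂σ

theorem contDiff_sphereIntegral {c G : 𝔼 → ℝ} (hc : ContDiff ℝ ∞ c) (hG : ContDiff ℝ ∞ G) :
    ContDiff ℝ ∞ (sphereIntegral c G) := by
  refine contDiff_integral_sphere (H := fun z => c z.2 * G (z.1 • z.2)) ?_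
  fun_prop

/-! ### Radial test functions and the divergence theorem on spheres -/

/-- A profile supported away from `0` gives a smooth radial function, although the norm is not
differentiable at the origin. -/
theorem contDiff_comp_norm {ψ : ℝ → ℝ} (hψ : ContDiff ℝ ∞ ψ) (h0 : tsupport ψ ⊆ Ioi 0) :
    ContDiff ℝ ∞ (fun x : 𝔼 => ψ ‖x‖) := by
  rw [contDiff_iff_contDiffAt]
  intro x
  by_cases hx : x = 0
  · subst hx
    have h : (0 : ℝ) ∉ tsupport ψ := fun h => lt_irrefl (0 : ℝ) (h0 h)
    have h2 : ∀ᶠ y : 𝔼 in nhds 0, ψ ‖y‖ = 0 := by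
      have h3 := notMem_tsupport_iff_eventuallyEq.1 h
      have h4 : Filter.Tendsto (fun y : 𝔼 => ‖y‖) (nhds 0) (nhds 0) := by
        simpa using (continuous_norm (E := 𝔼)).tendsto 0
      exact h4.eventually h3
    exact contDiffAt_const.congr_of_eventuallyEq h2
  · exact hψ.contDiffAt.comp x (contDiffAt_norm ℝ hx)

theorem hasCompactSupport_comp_norm {ψ : ℝ → ℝ} (hψ : HasCompactSupport ψ) :
    HasCompactSupport (fun x : 𝔼 => ψ ‖x‖) := by
  obtain ⟨C, hC⟩ := hψ.isBounded.exists_norm_le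
  refine HasCompactSupport.intro (isCompact_closedBall (0 : 𝔼) C) fun x hx => ?_
  by_contra h
  have := hC ‖x‖ (subset_tsupport _ h)
  simp only [norm_norm] at this
  exact hx (by simpa using this)

theorem hasFDerivAt_norm_apply {x : 𝔼} (hx : x ≠ 0) (j : Fin d) :
    fderiv ℝ (fun y : 𝔼 => ‖y‖) x (EuclideanSpace.single j 1) = x j / ‖x‖ := by
  have hn : ‖x‖ ≠ 0 := norm_ne_zero_iff.2 hx
  have h1 : HasFDerivAt (fun y : 𝔼 => √(‖y‖ ^ 2)) _ x :=
    ((hasStrictFDerivAt_norm_sq x).hasFDerivAt).sqrt (by positivity)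
  have h2 : (fun y : 𝔼 => √(‖y‖ ^ 2)) = fun y => ‖y‖ := by
    funext y
    rw [Real.sqrt_sq (norm_nonneg y)]
  rw [h2] at h1
  rw [h1.fderiv]
  simp [Real.sqrt_sq, EuclideanSpace.inner_single_right]
  field_simp

theorem partialDeriv_comp_norm {ψ : ℝ → ℝ} (hψ : ContDiff ℝ ∞ ψ) {x : 𝔼} (hx : x ≠ 0)
    (j : Fin d) : partialDeriv j (fun y => ψ ‖y‖) x = deriv ψ ‖x‖ * (x j / ‖x‖) := by
  have h1 : DifferentiableAt ℝ (fun y : 𝔼 => ‖y‖) x :=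
    (contDiffAt_norm ℝ hx (n := 1)).differentiableAt one_ne_zero
  have h2 := ((hψ.differentiable (by simp) ‖x‖).hasDerivAt).comp_hasFDerivAt x h1.hasFDerivAt
  rw [partialDeriv]
  have h3 : (fun y : 𝔼 => ψ ‖y‖) = ψ ∘ fun y => ‖y‖ := rfl
  rw [h3, h2.fderiv]
  simp only [smul_apply, hasFDerivAt_norm_apply hx, smul_eq_mul]

theorem ContDiff.partialDeriv {u : 𝔼 → ℝ} (hu : ContDiff ℝ ∞ u) (j : Fin d) :
    ContDiff ℝ ∞ (partialDeriv j u) :=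
  (hu.fderiv_right (m := ∞) (by simp)).clm_apply contDiff_const

theorem HasCompactSupport.partialDeriv {u : 𝔼 → ℝ} (hu : HasCompactSupport u) (j : Fin d) :
    HasCompactSupport (partialDeriv j u) := hu.fderiv_apply ℝ _

theorem tsupport_partialDeriv_subset (u : 𝔼 → ℝ) (j : Fin d) :
    tsupport (partialDeriv j u) ⊆ tsupport u :=
  tsupport_fderiv_apply_subset ℝ _

/-- The fundamental lemma of the calculus of variations, for continuous functions. -/
theorem eq_of_forall_integral_mul_eq {U : Set ℝ} (hU : IsOpen U) {u v : ℝ → ℝ} (hu : Continuous u)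
    (hv : Continuous v) (h : ∀ ψ, IsTestFunction U ψ → ∫ s, ψ s * u s = ∫ s, ψ s * v s) :
    EqOn u v U := by
  have h1 : ∀ᵐ s, s ∈ U → u s - v s = 0 := by
    refine hU.ae_eq_zero_of_integral_contDiff_smul_eq_zero
      ((hu.sub hv).locallyIntegrable.locallyIntegrableOn U) fun ψ hψ hc hs => ?_
    have hi : ∀ w : ℝ → ℝ, Continuous w → Integrable fun s => ψ s * w s := fun w hw =>
      (hψ.continuous.mul hw).integrable_of_hasCompactSupport hc.mul_right
    simp only [smul_eq_mul, mul_sub]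
    rw [integral_sub (hi u hu) (hi v hv), h ψ ⟨hψ, hc, hs⟩, sub_self]
  refine Measure.eqOn_open_of_ae_eq (μ := volume) ?_ hU hu.continuousOn hv.continuousOn
  rw [Filter.EventuallyEq, ae_restrict_iff' hU.measurableSet]
  filter_upwards [h1] with s hs hsU using sub_eq_zero.1 (hs hsU)

theorem integral_comp_norm_mul (hd : 1 ≤ d) {ψ : ℝ → ℝ} {K : 𝔼 → ℝ}
    (hi : Integrable fun x => ψ ‖x‖ * K x) :
    ∫ x, ψ ‖x‖ * K x = ∫ s in Ioi (0 : ℝ), ψ s * (s ^ (d - 1) * ∫ n : 𝕊, K (s • n) ∂σ) := by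
  rw [integral_eq_integral_Ioi_sphere hd hi]
  refine setIntegral_congr_fun measurableSet_Ioi fun s hs => ?_
  have h : ∀ n : 𝕊, ‖s • (n : 𝔼)‖ = s := fun n => by
    rw [norm_smul, norm_eq_of_mem_sphere, mul_one, Real.norm_of_nonneg (le_of_lt hs)]
  simp only [h, integral_const_mul]
  ring

theorem integral_eq_setIntegral_of_tsupport_subset {U : Set ℝ} {ψ w : ℝ → ℝ}
    (h : tsupport ψ ⊆ U) : ∫ s, ψ s * w s = ∫ s in U, ψ s * w s := by
  refine (setIntegral_eq_integral_of_forall_compl_eq_zero fun s hs => ?_).symm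
  rw [image_eq_zero_of_notMem_tsupport fun hs' => hs (h hs'), zero_mul]

/-- The divergence theorem on spheres, in differentiated form: the flux of `G e_j` through the
sphere of radius `s` has derivative the integral of `∂_j G` over that sphere. It is obtained by
testing the integration by parts formula on `ℝ^d` with radial functions. -/
theorem hasDerivAt_flux (hd : 1 ≤ d) {G : 𝔼 → ℝ} (hG : ContDiff ℝ ∞ G) (j : Fin d) {s : ℝ}
    (hs : 0 < s) :
    HasDerivAt (fun s => s ^ (d - 1) * sphereIntegral (fun n => n j) G s)
      (s ^ (d - 1) * sphereIntegral (fun _ => 1) (partialDeriv j G) s) s := by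
  set u : ℝ → ℝ := fun s => s ^ (d - 1) * sphereIntegral (fun n => n j) G s with hu
  set v : ℝ → ℝ := fun s => s ^ (d - 1) * sphereIntegral (fun _ => 1) (partialDeriv j G) s with hv
  have hcu : ContDiff ℝ ∞ u :=
    (contDiff_id.pow _).mul (contDiff_sphereIntegral (by fun_prop) hG)
  have hcv : ContDiff ℝ ∞ v :=
    (contDiff_id.pow _).mul (contDiff_sphereIntegral contDiff_const (hG.partialDeriv j))
  have hdu : Continuous (deriv u) := hcu.continuous_deriv (by simp)
  suffices h : EqOn (deriv u) v (Ioi 0) by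
    have h1 := h hs
    simp only [hv] at h1
    rw [← h1]
    exact (hcu.differentiable (by simp) s).hasDerivAt
  refine eq_of_forall_integral_mul_eq isOpen_Ioi hdu hcv.continuous fun ψ hψ => ?_
  have hψn := contDiff_comp_norm (d := d) hψ.smooth hψ.tsupport_subset
  have hψc := hasCompactSupport_comp_norm (d := d) hψ.hasCompactSupport
  have hdψc : HasCompactSupport (deriv ψ) := hψ.hasCompactSupport.deriv
  have hdψ : Continuous (deriv ψ) := hψ.smooth.continuous_deriv (by simp)
  have hdψs : ContDiff ℝ ∞ (deriv ψ) := (contDiff_infty_iff_deriv.1 hψ.smooth).2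
  have hds : tsupport (deriv ψ) ⊆ Ioi 0 := (tsupport_deriv_subset (𝕜 := ℝ)).trans hψ.tsupport_subset
  have hi1 : Integrable fun x : 𝔼 => ψ ‖x‖ * partialDeriv j G x :=
    (hψn.continuous.mul (hG.partialDeriv j).continuous).integrable_of_hasCompactSupport
      hψc.mul_right
  have hi2 : Integrable fun x : 𝔼 => partialDeriv j (fun y => ψ ‖y‖) x * G x :=
    ((hψn.partialDeriv j).continuous.mul hG.continuous).integrable_of_hasCompactSupport
      (hψc.partialDeriv j).mul_right
  have hi3 : Integrable fun x : 𝔼 => ψ ‖x‖ * G x :=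
    (hψn.continuous.mul hG.continuous).integrable_of_hasCompactSupport hψc.mul_right
  have hibp : ∫ x : 𝔼, ψ ‖x‖ * partialDeriv j G x =
      -∫ x : 𝔼, partialDeriv j (fun y => ψ ‖y‖) x * G x :=
    integral_mul_fderiv_eq_neg_fderiv_mul_of_integrable hi2 hi1 hi3
      (fun x _ => hψn.differentiable (by simp) x) (fun x _ => hG.differentiable (by simp) x)
  have heq : ∀ x : 𝔼, partialDeriv j (fun y => ψ ‖y‖) x * G x =
      deriv ψ ‖x‖ * (x j / ‖x‖ * G x) := fun x => by
    by_cases hx : x = 0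
    · subst hx
      have h0 : (0 : 𝔼) ∉ tsupport (partialDeriv j fun y : 𝔼 => ψ ‖y‖) := fun h => by
        have h1 := tsupport_partialDeriv_subset _ j h
        have h2 := tsupport_comp_subset_preimage ψ (continuous_norm (E := 𝔼)) h1
        simpa using hψ.tsupport_subset h2
      rw [image_eq_zero_of_notMem_tsupport h0]
      simp
    · rw [partialDeriv_comp_norm hψ.smooth hx]
      ring
  simp only [heq] at hibp hi2
  rw [integral_comp_norm_mul hd hi1, integral_comp_norm_mul hd hi2] at hibp
  have e1 : ∫ s in Ioi (0 : ℝ), ψ s * (s ^ (d - 1) * ∫ n : 𝕊, partialDeriv j G (s • n) ∂σ) =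
      ∫ s, ψ s * v s := by
    rw [integral_eq_setIntegral_of_tsupport_subset hψ.tsupport_subset]
    simp [hv, sphereIntegral]
  have e2 : ∫ s in Ioi (0 : ℝ), deriv ψ s * (s ^ (d - 1) * ∫ n : 𝕊,
      (s • (n : 𝔼)) j / ‖s • (n : 𝔼)‖ * G (s • n) ∂σ) = ∫ s, deriv ψ s * u s := by
    rw [integral_eq_setIntegral_of_tsupport_subset hds]
    refine setIntegral_congr_fun measurableSet_Ioi fun s hs => ?_
    have hs' : s ≠ 0 := ne_of_gt hs
    have h : ∀ n : 𝕊, (s • (n : 𝔼)) j / ‖s • (n : 𝔼)‖ = (n : 𝔼) j := fun n => by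
      rw [norm_smul, norm_eq_of_mem_sphere, mul_one, Real.norm_of_nonneg (le_of_lt hs)]
      simp [hs']
    simp only [h, hu, sphereIntegral]
  rw [e1, e2] at hibp
  rw [hibp]
  refine integral_mul_deriv_eq_deriv_mul_of_integrable
    (fun s _ => (hψ.smooth.differentiable (by simp) s).hasDerivAt)
    (fun s _ => (hcu.differentiable (by simp) s).hasDerivAt) ?_ ?_ ?_
  · exact (hψ.smooth.continuous.mul hdu).integrable_of_hasCompactSupport
      hψ.hasCompactSupport.mul_right
  · exact (hdψ.mul hcu.continuous).integrable_of_hasCompactSupport hdψc.mul_right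
  · exact (hψ.smooth.continuous.mul hcu.continuous).integrable_of_hasCompactSupport
      hψ.hasCompactSupport.mul_right

end Polar

/-! ### Spherical averages of matrix fields -/

section Fields

open Metric Set

variable {d : ℕ}

local notation "𝔼" => EuclideanSpace ℝ (Fin d)
local notation "𝕊" => Metric.sphere (0 : EuclideanSpace ℝ (Fin d)) 1
local notation "σ" => Measure.toSphere (volume : Measure (EuclideanSpace ℝ (Fin d)))

/-- The total area of the unit sphere, as a real number; it equals `d ω_d` (`ofReal_sphereArea`). -/
noncomputable def sphereArea (d : ℕ) : ℝ :=
  (volume : Measure (EuclideanSpace ℝ (Fin d))).toSphere.real univ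

/-- `s^{d-1} ∫_{|n|=1} n·F(s n)n dn`. -/
noncomputable def radialPart (F : 𝔼 → Matrix (Fin d) (Fin d) ℝ) (s : ℝ) : ℝ :=
  s ^ (d - 1) * ∑ i, ∑ j, sphereIntegral (fun n => n i * n j) (fun x => F x i j) s

/-- `s^{d-2} ∫_{|n|=1} (tr F(s n) - n·F(s n)n) dn`. -/
noncomputable def tangentialPart (F : 𝔼 → Matrix (Fin d) (Fin d) ℝ) (s : ℝ) : ℝ :=
  s ^ (d - 2) * ∑ i, ∑ j,
    sphereIntegral (fun n => (if i = j then 1 else 0) - n i * n j) (fun x => F x i j) s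

/-- The flux of the row-wise divergence of `F` through the sphere of radius `s`. -/
noncomputable def divergenceFlux (F : 𝔼 → Matrix (Fin d) (Fin d) ℝ) (s : ℝ) : ℝ :=
  s ^ (d - 1) * ∑ i, ∑ j,
    sphereIntegral (fun n => n i) (partialDeriv j fun x => F x i j) s

/-- The integral of the double divergence of `F` over the sphere of radius `s`. -/
noncomputable def doubleDivergencePart (F : 𝔼 → Matrix (Fin d) (Fin d) ℝ) (s : ℝ) : ℝ :=
  s ^ (d - 1) * ∑ i, ∑ j,
    sphereIntegral (fun _ => 1) (partialDeriv i (partialDeriv j fun x => F x i j)) s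

/-- The derivative of `s^{d-1} ∫ n_i n_j G(s n) dn`, obtained from the divergence theorem for
`x_i G`. -/
theorem hasDerivAt_radial_entry (hd : 2 ≤ d) {G : 𝔼 → ℝ} (hG : ContDiff ℝ ∞ G) (i j : Fin d)
    {s : ℝ} (hs : 0 < s) :
    HasDerivAt (fun s => s ^ (d - 1) * sphereIntegral (fun n => n i * n j) G s)
      (s ^ (d - 1) * sphereIntegral (fun n => n i) (partialDeriv j G) s
        + s ^ (d - 2) * sphereIntegral (fun n => (if i = j then 1 else 0) - n i * n j) G s) s := by
  have hxi : ContDiff ℝ ∞ fun x : 𝔼 => x i := by fun_prop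
  have h1 := hasDerivAt_flux (by omega) (hxi.mul hG) j hs
  have hpd : partialDeriv j (fun x : 𝔼 => x i * G x) =
      fun x => (if i = j then 1 else 0) * G x + x i * partialDeriv j G x := by
    funext x
    have hx : HasFDerivAt (fun x : 𝔼 => x i) (EuclideanSpace.proj i : 𝔼 →L[ℝ] ℝ) x :=
      (EuclideanSpace.proj i : 𝔼 →L[ℝ] ℝ).hasFDerivAt
    rw [partialDeriv, (hx.fun_mul (hG.differentiable (by simp) x).hasFDerivAt).fderiv]
    simp [partialDeriv, PiLp.single_apply]
    ring
  have hcG := hG.continuous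
  have hcd := (hG.partialDeriv j).continuous
  have hval : sphereIntegral (fun _ => 1) (partialDeriv j fun x : 𝔼 => x i * G x) s =
      s * sphereIntegral (fun n => n i) (partialDeriv j G) s
        + sphereIntegral (fun n => (if i = j then 1 else 0) - n i * n j) G s
        + sphereIntegral (fun n => n i * n j) G s := by
    rw [hpd]
    simp only [sphereIntegral]
    rw [← integral_const_mul, ← integral_add, ← integral_add]
    · congr 1
      funext n
      simp only [PiLp.smul_apply, smul_eq_mul]
      ring
    all_goals exact integrable_sphere (by fun_prop)
  rw [hval] at h1
  have h2 := (hasDerivAt_inv hs.ne').mul h1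
  have heq : (fun t => t ^ (d - 1) * sphereIntegral (fun n => n i * n j) G t) =ᶠ[nhds s]
      (fun t => t⁻¹ * (t ^ (d - 1) * sphereIntegral (fun n : 𝔼 => n j) (fun x => x i * G x) t)) := by
    filter_upwards [lt_mem_nhds hs] with t ht
    have : sphereIntegral (fun n : 𝔼 => n j) (fun x => x i * G x) t =
        t * sphereIntegral (fun n => n i * n j) G t := by
      simp only [sphereIntegral]
      rw [← integral_const_mul]
      congr 1
      funext n
      simp only [PiLp.smul_apply, smul_eq_mul]
      ring
    rw [this]
    field_simp
  refine (h2.congr_of_eventuallyEq heq).congr_deriv ?_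
  have hs' : sphereIntegral (fun n : 𝔼 => n j) (fun x => x i * G x) s =
      s * sphereIntegral (fun n => n i * n j) G s := by
    simp only [sphereIntegral]
    rw [← integral_const_mul]
    congr 1
    funext n
    simp only [PiLp.smul_apply, smul_eq_mul]
    ring
  obtain ⟨k, rfl⟩ : ∃ k, d = k + 2 := ⟨d - 2, by omega⟩
  simp only [hs', show k + 2 - 1 = k + 1 by omega, show k + 2 - 2 = k by omega]
  field_simp
  ring

variable {F : EuclideanSpace ℝ (Fin d) → Matrix (Fin d) (Fin d) ℝ}

theorem hasDerivAt_divergenceFlux (hd : 2 ≤ d) (hF : ∀ i j, ContDiff ℝ ∞ fun x => F x i j) {s : ℝ}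
    (hs : 0 < s) : HasDerivAt (divergenceFlux F) (doubleDivergencePart F s) s := by
  have h := HasDerivAt.fun_sum (u := Finset.univ) fun (i : Fin d) _ =>
    HasDerivAt.fun_sum (u := Finset.univ) fun (j : Fin d) _ => hasDerivAt_flux (by omega : 1 ≤ d) ((hF i j).partialDeriv j) i hs
  simp only [← Finset.mul_sum] at h
  exact h

/-- Summing `hasDerivAt_radial_entry` over the entries: one radial integration by parts produces the
tangential part of the field. -/
theorem hasDerivAt_radialPart (hd : 2 ≤ d) (hF : ∀ i j, ContDiff ℝ ∞ fun x => F x i j) {s : ℝ}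
    (hs : 0 < s) :
    HasDerivAt (radialPart F) (divergenceFlux F s + tangentialPart F s) s := by
  have h := HasDerivAt.fun_sum (u := Finset.univ) fun (i : Fin d) _ =>
    HasDerivAt.fun_sum (u := Finset.univ) fun (j : Fin d) _ => hasDerivAt_radial_entry hd (hF i j) i j hs
  simp only [← Finset.mul_sum, Finset.sum_add_distrib] at h
  exact h

theorem contDiff_radialPart (hF : ∀ i j, ContDiff ℝ ∞ fun x => F x i j) :
    ContDiff ℝ ∞ (radialPart F) :=
  (contDiff_id.pow _).mul (ContDiff.sum fun i _ => ContDiff.sum fun j _ =>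
    contDiff_sphereIntegral (by fun_prop) (hF i j))

theorem contDiff_tangentialPart (hF : ∀ i j, ContDiff ℝ ∞ fun x => F x i j) :
    ContDiff ℝ ∞ (tangentialPart F) :=
  (contDiff_id.pow _).mul (ContDiff.sum fun i _ => ContDiff.sum fun j _ =>
    contDiff_sphereIntegral (by fun_prop) (hF i j))

theorem contDiff_divergenceFlux (hF : ∀ i j, ContDiff ℝ ∞ fun x => F x i j) :
    ContDiff ℝ ∞ (divergenceFlux F) :=
  (contDiff_id.pow _).mul (ContDiff.sum fun i _ => ContDiff.sum fun j _ =>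
    contDiff_sphereIntegral (by fun_prop) ((hF i j).partialDeriv j))

theorem contDiff_doubleDivergencePart (hF : ∀ i j, ContDiff ℝ ∞ fun x => F x i j) :
    ContDiff ℝ ∞ (doubleDivergencePart F) :=
  (contDiff_id.pow _).mul (ContDiff.sum fun i _ => ContDiff.sum fun j _ =>
    contDiff_sphereIntegral (by fun_prop) (((hF i j).partialDeriv j).partialDeriv i))

/-! ### Supports and growth at the origin -/

theorem tsupport_entry_subset (F : 𝔼 → Matrix (Fin d) (Fin d) ℝ) (i j : Fin d) :
    tsupport (fun x => F x i j) ⊆ tsupport F := by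
  refine closure_mono fun x hx h0 => hx ?_
  simp [h0]

/-- A compactly supported field in the open ball of radius `r` vanishes beyond some smaller
radius. -/
theorem exists_radius_of_tsupport_subset {r : ℝ} (hr : 0 < r) (hc : HasCompactSupport F)
    (hs : tsupport F ⊆ ball 0 r) : ∃ r', 0 < r' ∧ r' < r ∧ tsupport F ⊆ closedBall 0 r' := by
  obtain ⟨r', hr', h⟩ := exists_lt_subset_ball hc.isCompact.isClosed hs
  exact ⟨max r' (r / 2), lt_max_of_lt_right (by linarith), max_lt hr' (by linarith),
    h.trans (ball_subset_closedBall.trans (closedBall_subset_closedBall (le_max_left _ _)))⟩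

theorem spherical_parts_eq_zero {r' s : ℝ} (hr' : 0 < r') (hs : tsupport F ⊆ closedBall 0 r')
    (hrs : r' < s) : radialPart F s = 0 ∧ tangentialPart F s = 0 ∧ divergenceFlux F s = 0 ∧
      doubleDivergencePart F s = 0 := by
  have hn : ∀ n : 𝕊, s • (n : 𝔼) ∉ tsupport F := fun n hn => by
    have := hs hn
    rw [mem_closedBall_zero_iff, norm_smul, norm_eq_of_mem_sphere, mul_one,
      Real.norm_of_nonneg (by linarith)] at this
    linarith
  have h0 : ∀ (n : 𝕊) i j, F (s • (n : 𝔼)) i j = 0 := fun n i j => by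
    simp [image_eq_zero_of_notMem_tsupport (hn n)]
  have h1 : ∀ (n : 𝕊) i j, partialDeriv j (fun x => F x i j) (s • (n : 𝔼)) = 0 := fun n i j =>
    image_eq_zero_of_notMem_tsupport fun h =>
      hn n (tsupport_entry_subset F i j (tsupport_partialDeriv_subset _ _ h))
  have h2 : ∀ (n : 𝕊) i j, partialDeriv i (partialDeriv j (fun x => F x i j)) (s • (n : 𝔼)) = 0 :=
    fun n i j => image_eq_zero_of_notMem_tsupport fun h => hn n (tsupport_entry_subset F i j
      (tsupport_partialDeriv_subset _ _ (tsupport_partialDeriv_subset _ _ h)))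
  refine ⟨?_, ?_, ?_, ?_⟩
  · simp [radialPart, sphereIntegral, h0]
  · simp [tangentialPart, sphereIntegral, h0]
  · simp [divergenceFlux, sphereIntegral, h1]
  · simp [doubleDivergencePart, sphereIntegral, h2]

theorem exists_bound_pow_mul {w : ℝ → ℝ} (hw : Continuous w) (k : ℕ) (R : ℝ) :
    ∃ C, 0 ≤ C ∧ ∀ s ∈ Icc 0 R, |s ^ k * w s| ≤ C * s ^ k := by
  obtain ⟨C, hC⟩ := (isCompact_Icc (a := (0 : ℝ)) (b := R)).exists_bound_of_continuousOn
    hw.continuousOn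
  refine ⟨max C 0, le_max_right _ _, fun s hs => ?_⟩
  have hp := pow_nonneg hs.1 k
  rw [abs_mul, abs_of_nonneg hp, mul_comm]
  exact mul_le_mul_of_nonneg_right ((hC s hs).trans (le_max_left _ _)) hp

theorem exists_bound_radialPart (hF : ∀ i j, ContDiff ℝ ∞ fun x => F x i j) (R : ℝ) :
    ∃ C, 0 ≤ C ∧ ∀ s ∈ Icc 0 R, |radialPart F s| ≤ C * s ^ (d - 1) :=
  exists_bound_pow_mul (ContDiff.sum (n := ∞) fun i _ => ContDiff.sum fun j _ =>
    contDiff_sphereIntegral (by fun_prop) (hF i j)).continuous _ _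

theorem exists_bound_doubleDivergencePart (hF : ∀ i j, ContDiff ℝ ∞ fun x => F x i j) (R : ℝ) :
    ∃ C, 0 ≤ C ∧ ∀ s ∈ Icc 0 R, |doubleDivergencePart F s| ≤ C * s ^ (d - 1) :=
  exists_bound_pow_mul (ContDiff.sum (n := ∞) fun i _ => ContDiff.sum fun j _ =>
    contDiff_sphereIntegral (by fun_prop) (((hF i j).partialDeriv j).partialDeriv i)).continuous _ _

/-- The flux of the divergence is of the order of the volume of the ball, not only of the area of
the sphere. This makes the contribution of the origin vanish. -/
theorem exists_bound_divergenceFlux (hd : 2 ≤ d) (hF : ∀ i j, ContDiff ℝ ∞ fun x => F x i j)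
    (R : ℝ) : ∃ C, 0 ≤ C ∧ ∀ s ∈ Icc 0 R, |divergenceFlux F s| ≤ C * s ^ d := by
  obtain ⟨C, hC0, hC⟩ := exists_bound_doubleDivergencePart hF R
  refine ⟨C, hC0, fun s hs => ?_⟩
  have h0 : divergenceFlux F 0 = 0 := by
    rw [divergenceFlux, zero_pow (by omega), zero_mul]
  rcases hs.1.eq_or_lt with rfl | hpos
  · rw [h0, zero_pow (by omega)]
    simp
  obtain ⟨t, ht, hslope⟩ := exists_hasDerivAt_eq_slope (divergenceFlux F) (doubleDivergencePart F)
    hpos (contDiff_divergenceFlux hF).continuous.continuousOn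
    fun t ht => hasDerivAt_divergenceFlux hd hF ht.1
  rw [h0, sub_zero, sub_zero, eq_div_iff hpos.ne'] at hslope
  rw [← hslope, abs_mul, abs_of_pos hpos]
  have h1 := hC t ⟨ht.1.le, ht.2.le.trans hs.2⟩
  have h2 : t ^ (d - 1) ≤ s ^ (d - 1) := pow_le_pow_left₀ ht.1.le ht.2.le _
  calc |doubleDivergencePart F t| * s ≤ C * s ^ (d - 1) * s :=
        mul_le_mul_of_nonneg_right (h1.trans (mul_le_mul_of_nonneg_left h2 hC0)) hpos.le
    _ = C * s ^ d := by
        rw [mul_assoc, ← pow_succ]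
        congr 2
        omega

/-! ### Reduction of the pairing to one dimension -/

/-- The pairing of a radial function with a double divergence is a one-dimensional integral. -/
theorem setIntegral_radial_doubleDivergence (hd : 2 ≤ d) {R r : ℝ} (hr : 0 < r) (hrR : r ≤ R)
    {g : ℝ → ℝ} (hg : LocallyIntegrableOn (fun x : 𝔼 => g ‖x‖) (ball 0 R))
    (hF : ∀ i j, ContDiff ℝ ∞ fun x => F x i j) (hc : HasCompactSupport F)
    (hs : tsupport F ⊆ ball 0 r) :
    ∫ x in ball (0 : 𝔼) r, ∑ i, ∑ j, g ‖x‖ * partialDeriv i (partialDeriv j (fun y => F y i j)) x =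
      ∫ s in Ioo 0 R, g s * doubleDivergencePart F s := by
  set K : 𝔼 → ℝ := fun x => ∑ i, ∑ j, partialDeriv i (partialDeriv j (fun y => F y i j)) x with hK
  have hKc : Continuous K := (ContDiff.sum (n := ∞) fun i _ => ContDiff.sum fun j _ =>
    ((hF i j).partialDeriv j).partialDeriv i).continuous
  have hK0 : ∀ x, x ∉ tsupport F → K x = 0 := fun x hx =>
    Finset.sum_eq_zero fun i _ => Finset.sum_eq_zero fun j _ =>
      image_eq_zero_of_notMem_tsupport fun h => hx (tsupport_entry_subset F i j
        (tsupport_partialDeriv_subset _ _ (tsupport_partialDeriv_subset _ _ h)))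
  have hint : Integrable fun x : 𝔼 => g ‖x‖ * K x := by
    have h1 : IntegrableOn (fun x : 𝔼 => g ‖x‖) (tsupport F) :=
      hg.integrableOn_compact_subset (hs.trans (ball_subset_ball hrR)) hc
    have h2 : IntegrableOn (fun x : 𝔼 => g ‖x‖ * K x) (tsupport F) :=
      h1.mul_continuousOn hKc.continuousOn hc
    refine (integrableOn_iff_integrable_of_support_subset fun x hx => ?_).1 h2
    by_contra h
    exact hx (by simp [hK0 x h])
  obtain ⟨r', hr'0, hr', hsub⟩ := exists_radius_of_tsupport_subset hr hc hs
  calc _ = ∫ x in ball (0 : 𝔼) r, g ‖x‖ * K x := by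
        simp only [hK, Finset.mul_sum]
    _ = ∫ x, g ‖x‖ * K x := setIntegral_eq_integral_of_forall_compl_eq_zero fun x hx => by
        rw [hK0 x fun h => hx (hs h), mul_zero]
    _ = ∫ s in Ioi (0 : ℝ), g s * doubleDivergencePart F s := by
        rw [integral_comp_norm_mul (by omega) hint]
        congr 1
        funext s
        rw [doubleDivergencePart]
        congr 2
        simp only [sphereIntegral, one_mul, hK]
        have hcc : ∀ i j, Continuous fun n : 𝕊 =>
            partialDeriv i (partialDeriv j fun y => F y i j) (s • (n : 𝔼)) := fun i j =>
          (((hF i j).partialDeriv j).partialDeriv i).continuous.comp (by fun_prop)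
        rw [integral_finsetSum _ fun i _ =>
          integrable_sphere (continuous_finsetSum _ fun j _ => hcc i j)]
        exact Finset.sum_congr rfl fun i _ =>
          integral_finsetSum _ fun j _ => integrable_sphere (hcc i j)
    _ = _ := by
        refine setIntegral_eq_of_subset_of_forall_sdiff_eq_zero measurableSet_Ioi
          (fun s hs => hs.1) fun s hs => ?_
        have : R ≤ s := by
          by_contra h
          exact hs.2 ⟨hs.1, not_le.1 h⟩
        rw [(spherical_parts_eq_zero hr'0 hsub (by linarith)).2.2.2, mul_zero]

/-- The pointwise duality bound, averaged over a sphere. -/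
theorem spherical_pairing_le (hd : 2 ≤ d) {p : ℝ≥0∞} (hp : 1 ≤ p)
    (hF : ∀ i j, ContDiff ℝ ∞ fun x => F x i j)
    (hF1 : ∀ x, schattenNorm (ENNReal.conjExponent p) (F x) ≤ 1) (s x y : ℝ) :
    x * ∑ i, ∑ j, sphereIntegral (fun n => n i * n j) (fun x => F x i j) s
      + y * ∑ i, ∑ j,
        sphereIntegral (fun n => (if i = j then 1 else 0) - n i * n j) (fun x => F x i j) s
      ≤ sphereArea d * radialNorm (d - 1) p x y := by
  have hFc : ∀ i j, Continuous fun n : 𝕊 => F (s • (n : 𝔼)) i j := fun i j =>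
    (hF i j).continuous.comp (by fun_prop)
  have hsum : ∀ c : Fin d → Fin d → 𝔼 → ℝ, (∀ i j, Continuous (c i j)) →
      ∑ i, ∑ j, sphereIntegral (c i j) (fun x => F x i j) s =
      ∫ n : 𝕊, ∑ i, ∑ j, c i j n * F (s • (n : 𝔼)) i j ∂σ := fun c hc => by
    have hcc : ∀ i j, Continuous fun n : 𝕊 => c i j n * F (s • (n : 𝔼)) i j := fun i j =>
      ((hc i j).comp continuous_subtype_val).mul (hFc i j)
    rw [integral_finsetSum _ fun i _ => integrable_sphere (continuous_finsetSum _ fun j _ => hcc i j)]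
    refine Finset.sum_congr rfl fun i _ => ?_
    rw [integral_finsetSum _ fun j _ => integrable_sphere (hcc i j)]
    rfl
  rw [hsum _ fun i j => by fun_prop, hsum _ fun i j => by fun_prop, ← integral_const_mul,
    ← integral_const_mul, ← integral_add]
  · calc _ ≤ ∫ n : 𝕊, radialNorm (d - 1) p x y ∂σ := by
          refine integral_mono (integrable_sphere (by fun_prop)) (integrable_const _) fun n => ?_
          have h1 := radial_pairing_le (by omega : 1 ≤ d) hp (F (s • (n : 𝔼)))
            (norm_eq_of_mem_sphere n) x y
          exact h1.trans (mul_le_of_le_one_right (radialNorm_nonneg hp x y) (hF1 _))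
      _ = _ := by
          rw [integral_const, smul_eq_mul, sphereArea]
  all_goals exact integrable_sphere (by fun_prop)

/-! ### Test functions on the half-line -/

theorem IsTestFunction.mono {I J : Set ℝ} {φ : ℝ → ℝ} (h : IsTestFunction I φ) (hIJ : I ⊆ J) :
    IsTestFunction J φ := ⟨h.smooth, h.hasCompactSupport, h.tsupport_subset.trans hIJ⟩

theorem IsTestFunction.deriv {I : Set ℝ} {φ : ℝ → ℝ} (h : IsTestFunction I φ) :
    IsTestFunction I (deriv φ) :=
  ⟨(contDiff_infty_iff_deriv.1 h.smooth).2, h.hasCompactSupport.deriv,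
    (tsupport_deriv_subset (𝕜 := ℝ)).trans h.tsupport_subset⟩

theorem IsTestFunction.mul_contDiffAt {I : Set ℝ} {φ w : ℝ → ℝ} (h : IsTestFunction I φ)
    (hw : ∀ s ∈ I, ContDiffAt ℝ ∞ w s) : IsTestFunction I (fun s => φ s * w s) := by
  refine ⟨contDiff_iff_contDiffAt.2 fun s => ?_, h.hasCompactSupport.mul_right,
    (tsupport_mul_subset_left (f := φ) (g := w)).trans h.tsupport_subset⟩
  by_cases hs : s ∈ tsupport φ
  · exact h.smooth.contDiffAt.mul (hw s (h.tsupport_subset hs))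
  · refine contDiffAt_const (c := (0 : ℝ)).congr_of_eventuallyEq ?_
    filter_upwards [notMem_tsupport_iff_eventuallyEq.1 hs] with t ht
    simp [ht]

theorem isTestFunction_zero (I : Set ℝ) : IsTestFunction I (fun _ => 0) :=
  ⟨contDiff_const, HasCompactSupport.zero, by simp [tsupport]⟩

theorem IsTestFunction.eq_zero {I : Set ℝ} {φ : ℝ → ℝ} (h : IsTestFunction I φ) {s : ℝ}
    (hs : s ∉ I) : φ s = 0 :=
  image_eq_zero_of_notMem_tsupport fun h' => hs (h.tsupport_subset h')

/-! ### Radial test fields -/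

/-- The field `a(|x|) n⊗n + b(|x|) (I - n⊗n)` with `n = x/|x|`. It is only used for profiles `a`, `b`
which vanish near `0`, so that the value of `n` at the origin does not matter. -/
noncomputable def radialField (a b : ℝ → ℝ) (x : 𝔼) : Matrix (Fin d) (Fin d) ℝ :=
  Matrix.of fun i j => a ‖x‖ * ((‖x‖⁻¹ • x) i * (‖x‖⁻¹ • x) j)
    + b ‖x‖ * ((if i = j then 1 else 0) - (‖x‖⁻¹ • x) i * (‖x‖⁻¹ • x) j)

variable {a b : ℝ → ℝ} {r : ℝ}

theorem contDiff_radialField (ha : IsTestFunction (Ioo 0 r) a) (hb : IsTestFunction (Ioo 0 r) b)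
    (i j : Fin d) : ContDiff ℝ ∞ fun x : 𝔼 => radialField a b x i j := by
  have hinv : ∀ s ∈ Ioo 0 r, ContDiffAt ℝ ∞ (fun s : ℝ => s⁻¹ * s⁻¹) s := fun s hs =>
    (contDiffAt_inv ℝ hs.1.ne').mul (contDiffAt_inv ℝ hs.1.ne')
  have hpos : ∀ {φ}, IsTestFunction (Ioo 0 r) φ → ContDiff ℝ ∞ fun x : 𝔼 => φ ‖x‖ := fun hφ =>
    contDiff_comp_norm hφ.smooth (hφ.tsupport_subset.trans fun s hs => hs.1)
  have h1 := hpos (ha.mul_contDiffAt hinv)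
  have h2 := hpos (hb.mul_contDiffAt hinv)
  have h3 := hpos hb
  have heq : (fun x : 𝔼 => radialField a b x i j) = fun x => a ‖x‖ * (‖x‖⁻¹ * ‖x‖⁻¹) * (x i * x j)
      + (b ‖x‖ * (if i = j then 1 else 0) - b ‖x‖ * (‖x‖⁻¹ * ‖x‖⁻¹) * (x i * x j)) := by
    funext x
    simp only [radialField, Matrix.of_apply, PiLp.smul_apply, smul_eq_mul]
    ring
  rw [heq]
  have h4 : ContDiff ℝ ∞ fun x : 𝔼 => x i * x j := by fun_prop
  exact (h1.mul h4).add ((h3.mul contDiff_const).sub (h2.mul h4))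

theorem radialField_eq_zero {x : 𝔼} (ha : a ‖x‖ = 0) (hb : b ‖x‖ = 0) : radialField a b x = 0 := by
  ext i j
  simp [radialField, ha, hb]

theorem isHessianTestField_radialField (hd : 2 ≤ d) {q : ℝ≥0∞}
    (ha : IsTestFunction (Ioo 0 r) a) (hb : IsTestFunction (Ioo 0 r) b)
    (hab : ∀ s, radialNorm (d - 1) (ENNReal.conjExponent q) (a s) (b s) ≤ 1) :
    IsHessianTestField q (ball 0 r) (radialField a b : 𝔼 → Matrix (Fin d) (Fin d) ℝ) := by
  have hts : tsupport (radialField a b : 𝔼 → Matrix (Fin d) (Fin d) ℝ) ⊆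
      (fun x => ‖x‖) ⁻¹' (tsupport a ∪ tsupport b) := by
    refine closure_minimal (fun x hx => ?_)
      (((isClosed_tsupport a).union (isClosed_tsupport b)).preimage continuous_norm)
    by_contra h
    rw [mem_preimage, mem_union, not_or] at h
    exact hx (radialField_eq_zero (image_eq_zero_of_notMem_tsupport h.1)
      (image_eq_zero_of_notMem_tsupport h.2))
  have hsub : tsupport (radialField a b : 𝔼 → Matrix (Fin d) (Fin d) ℝ) ⊆ ball 0 r := fun x hx => by
    rw [mem_ball_zero_iff]
    rcases hts hx with h | h
    · exact (ha.tsupport_subset h).2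
    · exact (hb.tsupport_subset h).2
  refine ⟨contDiff_radialField ha hb, ?_, hsub, fun x => ?_⟩
  · exact HasCompactSupport.of_support_subset_isCompact (isCompact_closedBall (0 : 𝔼) r)
      ((subset_tsupport _).trans (hsub.trans ball_subset_closedBall))
  · have hq := one_le_conjExponent q
    by_cases hx : x = 0
    · subst hx
      have h0 : ∀ {φ}, IsTestFunction (Ioo 0 r) φ → φ ‖(0 : 𝔼)‖ = 0 := fun hφ =>
        hφ.eq_zero (by simp)
      have h1 := schattenNorm_radial_le (by omega) hq (d := d)
        (n := EuclideanSpace.single ⟨0, by omega⟩ 1) (by simp) 0 0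
      rw [radialNorm_zero_right hq, abs_zero] at h1
      rw [radialField_eq_zero (h0 ha) (h0 hb)]
      refine le_trans (le_of_eq ?_) (h1.trans zero_le_one)
      congr 1
      ext i j
      simp
    · refine (schattenNorm_radial_le (by omega) hq ?_ _ _).trans (hab ‖x‖)
      rw [norm_smul, norm_inv, norm_norm, inv_mul_cancel₀ (norm_ne_zero_iff.2 hx)]

theorem sum_sq_eq_one (n : 𝕊) : ∑ i, (n : 𝔼) i ^ 2 = 1 := by
  have h := EuclideanSpace.norm_sq_eq (n : 𝔼)
  rw [norm_eq_of_mem_sphere] at h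
  simpa using h.symm

theorem radialField_smul_sphere {s : ℝ} (hs : 0 < s) (n : 𝕊) (i j : Fin d) :
    radialField a b (s • (n : 𝔼)) i j = a s * ((n : 𝔼) i * (n : 𝔼) j)
      + b s * ((if i = j then 1 else 0) - (n : 𝔼) i * (n : 𝔼) j) := by
  have h1 : ‖s • (n : 𝔼)‖ = s := by
    rw [norm_smul, norm_eq_of_mem_sphere, mul_one, Real.norm_of_nonneg hs.le]
  rw [radialField, h1, smul_smul, inv_mul_cancel₀ hs.ne', one_smul, Matrix.of_apply]

theorem sum_sphereIntegral_radialField (ha : IsTestFunction (Ioo 0 r) a)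
    (hb : IsTestFunction (Ioo 0 r) b) {c : Fin d → Fin d → 𝔼 → ℝ} (hc : ∀ i j, Continuous (c i j))
    {s : ℝ} {k : ℝ} (h : ∀ n : 𝕊, ∑ i, ∑ j, c i j n * radialField a b (s • (n : 𝔼)) i j = k) :
    ∑ i, ∑ j, sphereIntegral (c i j) (fun x => radialField a b x i j) s = sphereArea d * k := by
  have hcc : ∀ i j, Continuous fun n : 𝕊 => c i j n * radialField a b (s • (n : 𝔼)) i j :=
    fun i j => ((hc i j).comp continuous_subtype_val).mul
      ((contDiff_radialField ha hb i j).continuous.comp (by fun_prop))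
  calc _ = ∫ n : 𝕊, ∑ i, ∑ j, c i j n * radialField a b (s • (n : 𝔼)) i j ∂σ := by
        rw [integral_finsetSum _ fun i _ =>
          integrable_sphere (continuous_finsetSum _ fun j _ => hcc i j)]
        refine Finset.sum_congr rfl fun i _ => ?_
        rw [integral_finsetSum _ fun j _ => integrable_sphere (hcc i j)]
        rfl
    _ = _ := by
        simp only [h, integral_const, smul_eq_mul, sphereArea]

theorem radialPart_radialField (ha : IsTestFunction (Ioo 0 r) a) (hb : IsTestFunction (Ioo 0 r) b)
    {s : ℝ} (hs : 0 < s) :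
    radialPart (radialField a b : 𝔼 → Matrix (Fin d) (Fin d) ℝ) s =
      sphereArea d * (s ^ (d - 1) * a s) := by
  rw [radialPart, sum_sphereIntegral_radialField ha hb (fun i j => by fun_prop) (k := a s)]
  · ring
  · intro n
    have h1 := sum_sq_eq_one n
    have h2 : ∀ i, ∑ j, (n : 𝔼) i * (n : 𝔼) j * radialField a b (s • (n : 𝔼)) i j =
        (n : 𝔼) i ^ 2 * a s := fun i => by
      simp only [radialField_smul_sphere hs]
      calc _ = (n : 𝔼) i ^ 2 * (a s - b s) * ∑ j, (n : 𝔼) j ^ 2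
            + ∑ j, if i = j then b s * (n : 𝔼) i * (n : 𝔼) j else 0 := by
            rw [Finset.mul_sum, ← Finset.sum_add_distrib]
            refine Finset.sum_congr rfl fun j _ => ?_
            split_ifs <;> ring
        _ = _ := by
            rw [h1, Finset.sum_ite_eq]
            simp
            ring
    simp only [h2]
    rw [← Finset.sum_mul, h1, one_mul]

theorem tangentialPart_radialField (hd : 2 ≤ d) (ha : IsTestFunction (Ioo 0 r) a)
    (hb : IsTestFunction (Ioo 0 r) b) {s : ℝ} (hs : 0 < s) :
    tangentialPart (radialField a b : 𝔼 → Matrix (Fin d) (Fin d) ℝ) s =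
      sphereArea d * (s ^ (d - 2) * (((d - 1 : ℕ) : ℝ) * b s)) := by
  rw [tangentialPart, sum_sphereIntegral_radialField ha hb (fun i j => by fun_prop)
    (k := ((d - 1 : ℕ) : ℝ) * b s)]
  · ring
  · intro n
    have h1 := sum_sq_eq_one n
    have h2 : ∀ i, ∑ j, ((if i = j then 1 else 0) - (n : 𝔼) i * (n : 𝔼) j) *
        radialField a b (s • (n : 𝔼)) i j = b s - (n : 𝔼) i ^ 2 * b s := fun i => by
      simp only [radialField_smul_sphere hs]
      calc _ = (n : 𝔼) i ^ 2 * (b s - a s) * ∑ j, (n : 𝔼) j ^ 2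
            + ∑ j, if i = j then (a s - 2 * b s) * (n : 𝔼) i * (n : 𝔼) j + b s else 0 := by
            rw [Finset.mul_sum, ← Finset.sum_add_distrib]
            refine Finset.sum_congr rfl fun j _ => ?_
            split_ifs <;> ring
        _ = _ := by
            rw [h1, Finset.sum_ite_eq]
            simp
            ring
    simp only [h2]
    rw [Finset.sum_sub_distrib, ← Finset.sum_mul, h1, Nat.cast_sub (by omega)]
    simp
    ring

end Fields

/-! ### Duality between integrals of norms and constrained test functions -/

section Duality

open Set

theorem Ioo_eq_iUnion_Icc (a b : ℝ) :
    Ioo a b = ⋃ n : ℕ, Icc (a + 1 / ((n : ℝ) + 1)) (b - 1 / ((n : ℝ) + 1)) := by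
  ext s
  rw [mem_iUnion]
  constructor
  · intro hs
    obtain ⟨n, hn⟩ := exists_nat_one_div_lt (lt_min (sub_pos.2 hs.1) (sub_pos.2 hs.2))
    refine ⟨n, ?_, ?_⟩
    · linarith [min_le_left (s - a) (b - s)]
    · linarith [min_le_right (s - a) (b - s)]
  · rintro ⟨n, h1, h2⟩
    have : 0 < 1 / ((n : ℝ) + 1) := by positivity
    exact ⟨by linarith, by linarith⟩

theorem monotone_Icc_exhaustion (a b : ℝ) :
    Monotone fun n : ℕ => Icc (a + 1 / ((n : ℝ) + 1)) (b - 1 / ((n : ℝ) + 1)) := by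
  intro n n' hn
  have : 1 / ((n' : ℝ) + 1) ≤ 1 / ((n : ℝ) + 1) := by
    apply one_div_le_one_div_of_le (by positivity)
    have : (n : ℝ) ≤ n' := by exact_mod_cast hn
    linarith
  exact Icc_subset_Icc (by linarith) (by linarith)

/-- A smooth Urysohn lemma. -/
theorem exists_isTestFunction_one_on {K U : Set ℝ} (hK : IsCompact K) (hU : IsOpen U)
    (hKU : K ⊆ U) :
    ∃ θ, IsTestFunction U θ ∧ (∀ s ∈ K, θ s = 1) ∧ ∀ s, θ s ∈ Icc (0 : ℝ) 1 := by
  obtain ⟨L, hL, hKL, hLU⟩ := exists_compact_between hK hU hKU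
  obtain ⟨f, hf0, hf1, hf⟩ := exists_contMDiffMap_zero_one_of_isClosed (n := ⊤)
    (modelWithCornersSelf ℝ ℝ) (s := (interior L)ᶜ) (t := K) isOpen_interior.isClosed_compl
    hK.isClosed (disjoint_left.2 fun x hx hxK => hx (hKL hxK))
  have hsub : tsupport f ⊆ L := by
    refine closure_minimal (fun x hx => ?_) hL.isClosed
    by_contra h
    exact hx (hf0 fun h' => h (interior_subset h'))
  exact ⟨f, ⟨f.contMDiff.contDiff, hL.of_isClosed_subset (isClosed_tsupport _) hsub,
    hsub.trans hLU⟩, fun s hs => hf1 hs, hf⟩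

/-- Indicators of measurable sets are limits in `L^1` of smooth cutoffs. -/
theorem exists_isTestFunction_lintegral_indicator_lt {J K A : Set ℝ} (hJ : IsOpen J)
    (hKJ : K ⊆ J) (hA : MeasurableSet A) (hAK : A ⊆ K) (lam : Measure ℝ) [IsFiniteMeasure lam]
    {ε : ℝ≥0∞} (hε : ε ≠ 0) :
    ∃ θ, IsTestFunction J θ ∧ (∀ s, θ s ∈ Icc (0 : ℝ) 1) ∧
      ∫⁻ s, ‖θ s - A.indicator 1 s‖ₑ ∂lam < ε := by
  have hε2 : ε / 2 ≠ 0 := (ENNReal.half_pos hε).ne'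
  obtain ⟨C, hCA, hC, hC1⟩ := hA.exists_isCompact_sdiff_lt (measure_ne_top lam A) hε2
  obtain ⟨U, hCU, hU, hU1⟩ := hC.exists_isOpen_lt_add (μ := lam) hε2
  obtain ⟨θ, hθ, hθ1, hθI⟩ := exists_isTestFunction_one_on hC (hU.inter hJ)
    (subset_inter hCU (hCA.trans (hAK.trans hKJ)))
  refine ⟨θ, hθ.mono inter_subset_right, hθI, ?_⟩
  have hUC : lam (U \ C) < ε / 2 := by
    rw [measure_sdiff hCU hC.measurableSet.nullMeasurableSet (measure_ne_top _ _)]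
    exact ENNReal.sub_lt_of_lt_add (measure_mono hCU) (by rwa [add_comm])
  calc ∫⁻ s, ‖θ s - A.indicator 1 s‖ₑ ∂lam
      ≤ ∫⁻ s, ((A \ C) ∪ (U \ C)).indicator 1 s ∂lam := by
        refine lintegral_mono fun s => ?_
        have hle : ‖θ s - A.indicator 1 s‖ₑ ≤ 1 := by
          rw [← ofReal_norm, ← ENNReal.ofReal_one]
          refine ENNReal.ofReal_le_ofReal ?_
          have := hθI s
          rw [Real.norm_eq_abs, abs_le]
          by_cases hs : s ∈ A
          · simp only [hs, indicator_of_mem, Pi.one_apply]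
            constructor <;> linarith [this.1, this.2]
          · simp only [hs, not_false_eq_true, indicator_of_notMem]
            constructor <;> linarith [this.1, this.2]
        by_cases hsC : s ∈ C
        · simp [hθ1 s hsC, hCA hsC]
        · by_cases hs : s ∈ A ∪ U
          · have hmem : s ∈ (A \ C) ∪ (U \ C) := by
              rcases hs with h | h
              · exact Or.inl ⟨h, hsC⟩
              · exact Or.inr ⟨h, hsC⟩
            rw [indicator_of_mem hmem]
            exact hle
          · rw [mem_union, not_or] at hs
            rw [hθ.eq_zero fun h => hs.2 h.1]
            simp [hs.1]
    _ = lam ((A \ C) ∪ (U \ C)) := by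
        rw [lintegral_indicator_one]
        exact (hA.diff hC.measurableSet).union (hU.measurableSet.diff hC.measurableSet)
    _ ≤ lam (A \ C) + lam (U \ C) := measure_union_le _ _
    _ < ε / 2 + ε / 2 := ENNReal.add_lt_add hC1 hUC
    _ = ε := ENNReal.add_halves ε

/-- The standard bilinear pairing on `ℝ × ℝ`. -/
def pairing (v w : ℝ × ℝ) : ℝ := v.1 * w.1 + v.2 * w.2

theorem abs_pairing_le (v w : ℝ × ℝ) : |pairing v w| ≤ 2 * (‖v‖ * ‖w‖) := by
  have h1 : |v.1 * w.1| ≤ ‖v‖ * ‖w‖ := by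
    rw [abs_mul]
    exact mul_le_mul (norm_fst_le v) (norm_fst_le w) (abs_nonneg _) (norm_nonneg _)
  have h2 : |v.2 * w.2| ≤ ‖v‖ * ‖w‖ := by
    rw [abs_mul]
    exact mul_le_mul (norm_snd_le v) (norm_snd_le w) (abs_nonneg _) (norm_nonneg _)
  calc _ ≤ |v.1 * w.1| + |v.2 * w.2| := abs_add_le _ _
    _ ≤ _ := by linarith

theorem pairing_sub_left (v v' w : ℝ × ℝ) :
    pairing (v - v') w = pairing v w - pairing v' w := by
  simp only [pairing, Prod.fst_sub, Prod.snd_sub]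
  ring

theorem continuous_pairing : Continuous fun z : (ℝ × ℝ) × (ℝ × ℝ) => pairing z.1 z.2 := by
  unfold pairing
  fun_prop

section Greedy

open scoped Classical

/-- Greedy choice: starting from `0`, the value at `s ∈ K` is replaced by `w_k` whenever this
increases the pairing with `h(s)`. After `k` steps the pairing is the maximum of `0` and its values at
`w_0, …, w_{k-1}`, attained by a measurable selection with finitely many values. -/
noncomputable def greedy (K : Set ℝ) (h : ℝ → ℝ × ℝ) (w : ℕ → ℝ × ℝ) : ℕ → ℝ → ℝ × ℝ
  | 0 => 0
  | k + 1 => (K ∩ {s | pairing (greedy K h w k s) (h s) < pairing (w k) (h s)}).piecewise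
      (fun _ => w k) (greedy K h w k)

variable {K : Set ℝ} {h : ℝ → ℝ × ℝ} {w : ℕ → ℝ × ℝ}

theorem greedy_zero_off (k : ℕ) {s : ℝ} (hs : s ∉ K) : greedy K h w k s = 0 := by
  induction k with
  | zero => rfl
  | succ k ih => rw [greedy, piecewise_eq_of_notMem _ _ _ fun h' => hs h'.1, ih]

theorem pairing_greedy_succ (k : ℕ) {s : ℝ} (hs : s ∈ K) :
    pairing (greedy K h w (k + 1) s) (h s) =
      max (pairing (greedy K h w k s) (h s)) (pairing (w k) (h s)) := by
  by_cases hlt : pairing (greedy K h w k s) (h s) < pairing (w k) (h s)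
  · have hmem : s ∈ K ∩ {s | pairing (greedy K h w k s) (h s) < pairing (w k) (h s)} := ⟨hs, hlt⟩
    rw [greedy, piecewise_eq_of_mem _ _ _ hmem, max_eq_right hlt.le]
  · rw [greedy, piecewise_eq_of_notMem _ _ _ fun h' => hlt h'.2, max_eq_left (not_lt.1 hlt)]

theorem pairing_greedy_nonneg (k : ℕ) (s : ℝ) : 0 ≤ pairing (greedy K h w k s) (h s) := by
  by_cases hs : s ∈ K
  · induction k with
    | zero => simp [greedy, pairing]
    | succ k ih =>
      rw [pairing_greedy_succ k hs]
      exact le_max_of_le_left ih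
  · simp [greedy_zero_off k hs, pairing]

theorem measurable_greedy (hK : MeasurableSet K) (hh : Measurable h) (k : ℕ) :
    Measurable (greedy K h w k) ∧
    MeasurableSet (K ∩ {s | pairing (greedy K h w k s) (h s) < pairing (w k) (h s)}) := by
  have key : ∀ k, Measurable (greedy K h w k) →
      MeasurableSet (K ∩ {s | pairing (greedy K h w k s) (h s) < pairing (w k) (h s)}) := fun k hm =>
    hK.inter (measurableSet_lt (continuous_pairing.measurable.comp (hm.prodMk hh))
      (continuous_pairing.measurable.comp (measurable_const.prodMk hh)))
  induction k with
  | zero => exact ⟨measurable_const, key 0 measurable_const⟩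
  | succ k ih =>
    have hm : Measurable (greedy K h w (k + 1)) := Measurable.piecewise ih.2 measurable_const ih.1
    exact ⟨hm, key _ hm⟩

theorem norm_greedy_le (k : ℕ) (s : ℝ) :
    ‖greedy K h w k s‖ ≤ ∑ i ∈ Finset.range k, ‖w i‖ := by
  induction k with
  | zero => simp [greedy]
  | succ k ih =>
    rw [Finset.sum_range_succ, greedy]
    by_cases hs : s ∈ K ∩ {s | pairing (greedy K h w k s) (h s) < pairing (w k) (h s)}
    · rw [piecewise_eq_of_mem _ _ _ hs]
      exact le_add_of_nonneg_left (Finset.sum_nonneg fun i _ => norm_nonneg _)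
    · rw [piecewise_eq_of_notMem _ _ _ hs]
      exact ih.trans (le_add_of_nonneg_right (norm_nonneg _))

/-- The greedy choices are limits in `L^1` of test functions respecting the convex constraint: each
replacement is carried out by the convex combination `(1 - θ) φ + θ w_k` with a smooth cutoff `θ`. -/
theorem exists_isTestFunction_near_greedy {J : Set ℝ} {C : Set (ℝ × ℝ)} (hJ : IsOpen J)
    (hK : MeasurableSet K) (hKJ : K ⊆ J) (hh : Measurable h) (hC : Convex ℝ C)
    (h0 : (0 : ℝ × ℝ) ∈ C) (hw : ∀ k, w k ∈ C) (lam : Measure ℝ) [IsFiniteMeasure lam] (k : ℕ)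
    {ε : ℝ≥0∞} (hε : ε ≠ 0) :
    ∃ φ₁ φ₂, IsTestFunction J φ₁ ∧ IsTestFunction J φ₂ ∧ (∀ s, (φ₁ s, φ₂ s) ∈ C) ∧
      ∫⁻ s, ‖(φ₁ s, φ₂ s) - greedy K h w k s‖ₑ ∂lam < ε := by
  induction k generalizing ε with
  | zero =>
    refine ⟨_, _, isTestFunction_zero J, isTestFunction_zero J, fun _ => h0, ?_⟩
    have : ∀ s : ℝ, ((0 : ℝ), (0 : ℝ)) - greedy K h w 0 s = 0 := fun s => by simp [greedy]
    simp only [this, enorm_zero, lintegral_zero]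
    exact pos_iff_ne_zero.2 hε
  | succ k ih =>
    have hε2 : ε / 2 ≠ 0 := (ENNReal.half_pos hε).ne'
    obtain ⟨φ₁, φ₂, hφ₁, hφ₂, hφC, hφ⟩ := ih hε2
    set φ : ℝ → ℝ × ℝ := fun s => (φ₁ s, φ₂ s) with hφdef
    obtain ⟨M₁, hM₁⟩ := hφ₁.hasCompactSupport.exists_bound_of_continuous hφ₁.smooth.continuous
    obtain ⟨M₂, hM₂⟩ := hφ₂.hasCompactSupport.exists_bound_of_continuous hφ₂.smooth.continuous
    set M : ℝ := ‖w k‖ + (|M₁| + |M₂|) + 1 with hM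
    have hMpos : 0 < M := by positivity
    have hMb : ∀ s, ‖w k - φ s‖ ≤ M := fun s => by
      refine (norm_sub_le _ _).trans ?_
      have : ‖φ s‖ ≤ |M₁| + |M₂| := by
        refine max_le ?_ ?_
        · exact ((hM₁ s).trans (le_abs_self _)).trans (le_add_of_nonneg_right (abs_nonneg _))
        · exact ((hM₂ s).trans (le_abs_self _)).trans (le_add_of_nonneg_left (abs_nonneg _))
      linarith
    set A := K ∩ {s | pairing (greedy K h w k s) (h s) < pairing (w k) (h s)} with hA
    have hAm : MeasurableSet A := (measurable_greedy hK hh k).2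
    have hMe : ENNReal.ofReal M ≠ 0 := (ENNReal.ofReal_pos.2 hMpos).ne'
    obtain ⟨θ, hθ, hθI, hθA⟩ := exists_isTestFunction_lintegral_indicator_lt hJ hKJ hAm
      inter_subset_left lam (ε := ε / 2 / ENNReal.ofReal M)
      (ENNReal.div_pos hε2 ENNReal.ofReal_ne_top).ne'
    have hcomb : ∀ {ψ : ℝ → ℝ} (c : ℝ), IsTestFunction J ψ →
        IsTestFunction J fun s => (1 - θ s) * ψ s + θ s * c := fun {ψ} c hψ => by
      refine ⟨((contDiff_const.sub hθ.smooth).mul hψ.smooth).add (hθ.smooth.mul contDiff_const),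
        (hψ.hasCompactSupport.mul_left).add (hθ.hasCompactSupport.mul_right), ?_⟩
      refine (tsupport_add _ _).trans (union_subset ?_ ?_)
      · exact (tsupport_mul_subset_right (f := fun s => 1 - θ s) (g := ψ)).trans hψ.tsupport_subset
      · exact (tsupport_mul_subset_left (f := θ) (g := fun _ => c)).trans hθ.tsupport_subset
    refine ⟨_, _, hcomb (w k).1 hφ₁, hcomb (w k).2 hφ₂, fun s => ?_, ?_⟩
    · have := hC (hφC s) (hw k) (sub_nonneg.2 (hθI s).2) (hθI s).1 (by ring)
      simpa only [Prod.smul_def, Prod.mk_add_mk, smul_eq_mul] using this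
    · have hpt : ∀ s, ‖((1 - θ s) * φ₁ s + θ s * (w k).1, (1 - θ s) * φ₂ s + θ s * (w k).2)
          - greedy K h w (k + 1) s‖ₑ ≤ ‖φ s - greedy K h w k s‖ₑ
            + ‖θ s - A.indicator 1 s‖ₑ * ENNReal.ofReal M := fun s => by
        have e1 : ((1 - θ s) * φ₁ s + θ s * (w k).1, (1 - θ s) * φ₂ s + θ s * (w k).2) =
            φ s + θ s • (w k - φ s) := by
          ext
          · simp [hφdef]; ring
          · simp [hφdef]; ring
        have hbound : ‖w k - φ s‖ₑ ≤ ENNReal.ofReal M := by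
          rw [← ofReal_norm]
          exact ENNReal.ofReal_le_ofReal (hMb s)
        rw [e1, greedy]
        by_cases hs : s ∈ A
        · rw [piecewise_eq_of_mem _ _ _ hs, indicator_of_mem hs]
          have e2 : φ s + θ s • (w k - φ s) - w k = (θ s - 1) • (w k - φ s) := by
            rw [sub_smul, one_smul]
            abel
          rw [e2, enorm_smul]
          exact le_add_left (mul_le_mul_right hbound _)
        · rw [piecewise_eq_of_notMem _ _ _ hs, indicator_of_notMem hs, sub_zero]
          have e2 : φ s + θ s • (w k - φ s) - greedy K h w k s =
            (φ s - greedy K h w k s) + θ s • (w k - φ s) := by abel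
          rw [e2]
          refine (enorm_add_le _ _).trans (add_le_add le_rfl ?_)
          rw [enorm_smul]
          exact mul_le_mul_right hbound _
      have hmeas : Measurable fun s => ‖φ s - greedy K h w k s‖ₑ :=
        (((hφ₁.smooth.continuous.prodMk hφ₂.smooth.continuous).measurable).sub
          (measurable_greedy hK hh k).1).enorm
      calc _ ≤ ∫⁻ s, (‖φ s - greedy K h w k s‖ₑ
            + ‖θ s - A.indicator 1 s‖ₑ * ENNReal.ofReal M) ∂lam := lintegral_mono hpt
        _ = ∫⁻ s, ‖φ s - greedy K h w k s‖ₑ ∂lam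
            + (∫⁻ s, ‖θ s - A.indicator 1 s‖ₑ ∂lam) * ENNReal.ofReal M := by
            rw [lintegral_add_left hmeas, lintegral_mul_const' _ _ ENNReal.ofReal_ne_top]
        _ < ε / 2 + ε / 2 := by
            refine ENNReal.add_lt_add hφ ?_
            rwa [← ENNReal.lt_div_iff_mul_lt (Or.inl hMe) (Or.inl ENNReal.ofReal_ne_top)]
        _ = ε := ENNReal.add_halves ε

/-- If the pairings of `h` with all test functions in the convex set `C` are bounded by `B`, so are
the pairings with the greedy choices. -/
theorem integral_pairing_greedy_le {ν : Measure ℝ} {J : Set ℝ} {C : Set (ℝ × ℝ)} {B : ℝ}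
    (hJ : IsOpen J) (hK : IsCompact K) (hKJ : K ⊆ J) (hh : Measurable h)
    (hhi : LocallyIntegrableOn h J ν) (hC : Convex ℝ C) (h0 : (0 : ℝ × ℝ) ∈ C)
    (hw : ∀ k, w k ∈ C)
    (hB : ∀ φ₁ φ₂, IsTestFunction J φ₁ → IsTestFunction J φ₂ → (∀ s, (φ₁ s, φ₂ s) ∈ C) →
      ∫ s, pairing (φ₁ s, φ₂ s) (h s) ∂ν ≤ B) (k : ℕ) :
    Integrable (fun s => pairing (greedy K h w k s) (h s)) ν ∧
      ∫ s, pairing (greedy K h w k s) (h s) ∂ν ≤ B := by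
  obtain ⟨L, hL, hKL, hLJ⟩ := exists_compact_between hK hJ hKJ
  have hhL : IntegrableOn h L ν := hhi.integrableOn_compact_subset hLJ hL
  -- convergence in `L^1(|h| ν)` is what passes to the limit in the pairings with `h`
  set lam : Measure ℝ := (ν.restrict L).withDensity fun s => ‖h s‖ₑ with hlam
  have : IsFiniteMeasure lam := isFiniteMeasure_withDensity hhL.2.ne
  have hgm := (measurable_greedy (w := w) hK.measurableSet hh k).1
  have hint : ∀ {u : ℝ → ℝ × ℝ} (M : ℝ), Measurable u → (∀ s, ‖u s‖ ≤ M) → (∀ s ∉ L, u s = 0) →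
      Integrable (fun s => pairing (u s) (h s)) ν := fun {u} M hu hM hu0 => by
    have h1 : IntegrableOn (fun s => pairing (u s) (h s)) L ν := by
      refine Integrable.mono' ((hhL.norm.const_mul (2 * M)))
        (continuous_pairing.measurable.comp (hu.prodMk hh)).aestronglyMeasurable
        (Filter.Eventually.of_forall fun s => ?_)
      refine (abs_pairing_le _ _).trans ?_
      have := mul_le_mul_of_nonneg_right (hM s) (norm_nonneg (h s))
      linarith
    refine (integrableOn_iff_integrable_of_support_subset fun s hs => ?_).1 h1
    by_contra hsL
    exact hs (by simp [hu0 s hsL, pairing])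
  have hgL : ∀ s ∉ L, greedy K h w k s = 0 := fun s hs =>
    greedy_zero_off k fun h' => hs (interior_subset (hKL h'))
  have hig := hint _ hgm (norm_greedy_le (w := w) k) hgL
  refine ⟨hig, le_of_forall_pos_le_add fun ε hε => ?_⟩
  obtain ⟨φ₁, φ₂, hφ₁, hφ₂, hφC, hφ⟩ := exists_isTestFunction_near_greedy isOpen_interior
    hK.measurableSet hKL hh hC h0 hw lam k (ε := ENNReal.ofReal (ε / 2))
    (ENNReal.ofReal_pos.2 (half_pos hε)).ne'
  set φ : ℝ → ℝ × ℝ := fun s => (φ₁ s, φ₂ s) with hφdef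
  have hφm : Measurable φ := (hφ₁.smooth.continuous.prodMk hφ₂.smooth.continuous).measurable
  obtain ⟨M₁, hM₁⟩ := hφ₁.hasCompactSupport.exists_bound_of_continuous hφ₁.smooth.continuous
  obtain ⟨M₂, hM₂⟩ := hφ₂.hasCompactSupport.exists_bound_of_continuous hφ₂.smooth.continuous
  have hφ0 : ∀ s ∉ L, φ s = 0 := fun s hs => by
    have hs' : s ∉ interior L := fun h' => hs (interior_subset h')
    simp [hφdef, hφ₁.eq_zero hs', hφ₂.eq_zero hs']
  have hiφ := hint (max M₁ M₂) hφm (fun s => max_le_max (hM₁ s) (hM₂ s)) hφ0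
  have h1 := hB φ₁ φ₂ (hφ₁.mono (interior_subset.trans hLJ)) (hφ₂.mono (interior_subset.trans hLJ))
    hφC
  have hle : ‖∫ s, pairing (φ s - greedy K h w k s) (h s) ∂ν‖ₑ ≤ ENNReal.ofReal ε := by
    calc _ ≤ ∫⁻ s, ‖pairing (φ s - greedy K h w k s) (h s)‖ₑ ∂ν := enorm_integral_le_lintegral_enorm _
      _ = ∫⁻ s in L, ‖pairing (φ s - greedy K h w k s) (h s)‖ₑ ∂ν := by
          refine (setLIntegral_eq_of_support_subset fun s hs => ?_).symm
          by_contra hsL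
          exact hs (by simp [hφ0 s hsL, hgL s hsL, pairing])
      _ ≤ ∫⁻ s in L, 2 * (‖h s‖ₑ * ‖φ s - greedy K h w k s‖ₑ) ∂ν := by
          refine lintegral_mono fun s => ?_
          rw [← ofReal_norm, ← ofReal_norm, ← ofReal_norm, ← ENNReal.ofReal_mul (norm_nonneg _),
            show (2 : ℝ≥0∞) = ENNReal.ofReal 2 by simp, ← ENNReal.ofReal_mul (by norm_num)]
          refine ENNReal.ofReal_le_ofReal ?_
          rw [mul_comm ‖h s‖]
          exact abs_pairing_le _ _
      _ = 2 * ∫⁻ s, ‖φ s - greedy K h w k s‖ₑ ∂lam := by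
          rw [lintegral_const_mul' _ _ (by simp), hlam, lintegral_withDensity_eq_lintegral_mul _
            hh.enorm (g := fun s => ‖φ s - greedy K h w k s‖ₑ) (hφm.sub hgm).enorm]
          rfl
      _ ≤ 2 * ENNReal.ofReal (ε / 2) := mul_le_mul_right hφ.le _
      _ = ENNReal.ofReal ε := by
          rw [show (2 : ℝ≥0∞) = ENNReal.ofReal 2 by simp, ← ENNReal.ofReal_mul (by norm_num)]
          congr 1
          ring
  rw [← ofReal_norm, ENNReal.ofReal_le_ofReal_iff hε.le, Real.norm_eq_abs] at hle
  simp only [pairing_sub_left] at hle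
  rw [integral_sub hiφ hig] at hle
  have := (abs_le.1 hle).1
  linarith

end Greedy

/-- The integral of a norm `N(h)` is at most any bound for the pairings of `h` with test functions
taking values in the dual unit ball `C`; the dual ball enters through a sequence `w_k ∈ C` that is
norming for `N`. -/
theorem lintegral_le_of_forall_pairing_le {ν : Measure ℝ} {a b : ℝ} {h : ℝ → ℝ × ℝ}
    {C : Set (ℝ × ℝ)} {w : ℕ → ℝ × ℝ} {N : ℝ × ℝ → ℝ} {B : ℝ} (hh : Measurable h)
    (hhi : LocallyIntegrableOn h (Ioo a b) ν) (hC : Convex ℝ C) (h0 : (0 : ℝ × ℝ) ∈ C)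
    (hw : ∀ k, w k ∈ C) (hN : ∀ v, ∀ ε > 0, ∃ k, N v - ε < pairing (w k) v)
    (hB : ∀ φ₁ φ₂, IsTestFunction (Ioo a b) φ₁ → IsTestFunction (Ioo a b) φ₂ →
      (∀ s, (φ₁ s, φ₂ s) ∈ C) → ∫ s, pairing (φ₁ s, φ₂ s) (h s) ∂ν ≤ B) :
    ∫⁻ s in Ioo a b, ENNReal.ofReal (N (h s)) ∂ν ≤ ENNReal.ofReal B := by
  have hcpt : ∀ K ⊆ Ioo a b, IsCompact K →
      ∫⁻ s in K, ENNReal.ofReal (N (h s)) ∂ν ≤ ENNReal.ofReal B := fun K hKJ hK => by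
    set m : ℕ → ℝ → ℝ≥0∞ := fun k s => ENNReal.ofReal (pairing (greedy K h w k s) (h s)) with hm
    have hmm : ∀ k, Measurable (m k) := fun k => (continuous_pairing.measurable.comp
      ((measurable_greedy (w := w) hK.measurableSet hh k).1.prodMk hh)).ennreal_ofReal
    have hmono : Monotone m := by
      refine monotone_nat_of_le_succ fun k s => ENNReal.ofReal_le_ofReal ?_
      by_cases hs : s ∈ K
      · rw [pairing_greedy_succ k hs]
        exact le_max_left _ _
      · simp [greedy_zero_off _ hs]
    have hle : ∀ k, ∫⁻ s, m k s ∂ν ≤ ENNReal.ofReal B := fun k => by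
      obtain ⟨hi, hb⟩ := integral_pairing_greedy_le isOpen_Ioo hK hKJ hh hhi hC h0 hw hB k
      rw [hm, ← ofReal_integral_eq_lintegral_ofReal hi
        (Filter.Eventually.of_forall fun s => pairing_greedy_nonneg k s)]
      exact ENNReal.ofReal_le_ofReal hb
    calc ∫⁻ s in K, ENNReal.ofReal (N (h s)) ∂ν ≤ ∫⁻ s in K, ⨆ k, m k s ∂ν := by
          refine setLIntegral_mono' hK.measurableSet fun s hs => ?_
          refine ENNReal.le_of_forall_pos_le_add fun ε hε _ => ?_
          obtain ⟨k, hk⟩ := hN (h s) ε hε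
          have h1 : N (h s) ≤ pairing (greedy K h w (k + 1) s) (h s) + ε := by
            rw [pairing_greedy_succ k hs]
            linarith [le_max_right (pairing (greedy K h w k s) (h s)) (pairing (w k) (h s))]
          calc ENNReal.ofReal (N (h s))
              ≤ ENNReal.ofReal (pairing (greedy K h w (k + 1) s) (h s) + ε) :=
                ENNReal.ofReal_le_ofReal h1
            _ ≤ m (k + 1) s + ε := by
                refine ENNReal.ofReal_add_le.trans (le_of_eq ?_)
                rw [ENNReal.ofReal_coe_nnreal]
            _ ≤ (⨆ k, m k s) + ε := add_le_add (le_iSup (fun k => m k s) (k + 1)) le_rfl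
      _ ≤ ∫⁻ s, ⨆ k, m k s ∂ν := setLIntegral_le_lintegral _ _
      _ = ⨆ k, ∫⁻ s, m k s ∂ν := lintegral_iSup hmm hmono
      _ ≤ ENNReal.ofReal B := iSup_le hle
  nth_rewrite 1 [Ioo_eq_iUnion_Icc a b]
  rw [setLIntegral_iUnion_of_directed _ (monotone_Icc_exhaustion a b).directed_le]
  refine iSup_le fun n => hcpt _ ?_ isCompact_Icc
  rw [Ioo_eq_iUnion_Icc a b]
  exact subset_iUnion (fun n : ℕ => Icc (a + 1 / ((n : ℝ) + 1)) (b - 1 / ((n : ℝ) + 1))) n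

end Duality

/-! ### Local integrability of radial functions -/

section LocalIntegrability

open Set Metric

variable {d : ℕ}

theorem integrableOn_pow_mul {R : ℝ} {g : ℝ → ℝ} (hg : LocallyIntegrableOn g (Ioo 0 R))
    (hg_int : ∀ r ∈ Ioo 0 R, ∫⁻ s in Ioo 0 r, ENNReal.ofReal (s ^ (d - 1) * |g s|) < ⊤)
    {r : ℝ} (hr : r ∈ Ioo 0 R) : IntegrableOn (fun s => s ^ (d - 1) * g s) (Ioo 0 r) := by
  have hm : AEStronglyMeasurable g (volume.restrict (Ioo 0 r)) :=
    hg.aestronglyMeasurable.mono_measure (Measure.restrict_mono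
      (Ioo_subset_Ioo_right hr.2.le) le_rfl)
  refine ⟨(by fun_prop : Continuous fun s : ℝ => s ^ (d - 1)).aestronglyMeasurable.mul hm, ?_⟩
  refine lt_of_le_of_lt (le_of_eq ?_) (hg_int r hr)
  refine setLIntegral_congr_fun measurableSet_Ioo fun s hs => ?_
  simp only
  rw [← ofReal_norm, norm_mul, Real.norm_of_nonneg (pow_nonneg hs.1.le _), Real.norm_eq_abs]

theorem locallyIntegrableOn_radial (hd : 2 ≤ d) {R : ℝ} {g : ℝ → ℝ}
    (hg : LocallyIntegrableOn g (Ioo 0 R))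
    (hg_int : ∀ r ∈ Ioo 0 R, ∫⁻ s in Ioo 0 r, ENNReal.ofReal (s ^ (d - 1) * |g s|) < ⊤) :
    LocallyIntegrableOn (fun x : EuclideanSpace ℝ (Fin d) => g ‖x‖) (ball 0 R) := by
  have : Nonempty (Fin d) := ⟨⟨0, by omega⟩⟩
  intro x hx
  rw [mem_ball_zero_iff] at hx
  obtain ⟨r, hxr, hrR⟩ := exists_between hx
  have hr : 0 < r := (norm_nonneg x).trans_lt hxr
  refine ⟨ball 0 r, mem_nhdsWithin_of_mem_nhds (isOpen_ball.mem_nhds (by simpa using hxr)), ?_⟩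
  rw [integrableOn_fun_norm_addHaar]
  simpa using integrableOn_pow_mul hg hg_int ⟨hr, hrR⟩

end LocalIntegrability

/-! ### Measures which are finite on the compact subsets of an interval -/

section FiniteOnCompacts

open Set

variable {a b : ℝ} {ν : Measure ℝ}

theorem sigmaFinite_of_finite_on_compacts (h0 : ν (Ioo a b)ᶜ = 0)
    (hν : ∀ K ⊆ Ioo a b, IsCompact K → ν K < ⊤) : SigmaFinite ν := by
  refine ⟨⟨⟨fun n : ℕ => (Ioo a b)ᶜ ∪ Icc (a + 1 / ((n : ℝ) + 1)) (b - 1 / ((n : ℝ) + 1)),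
    fun _ => mem_univ _, fun n => ?_, ?_⟩⟩⟩
  · refine (measure_union_le _ _).trans_lt ?_
    rw [h0, zero_add]
    refine hν _ ?_ isCompact_Icc
    rw [Ioo_eq_iUnion_Icc a b]
    exact subset_iUnion (fun n : ℕ => Icc (a + 1 / ((n : ℝ) + 1)) (b - 1 / ((n : ℝ) + 1))) n
  · rw [← union_iUnion, ← Ioo_eq_iUnion_Icc, compl_union_self]

theorem IsTestFunction.integrable {I : Set ℝ} {φ : ℝ → ℝ} (hφ : IsTestFunction I φ)
    (hν : ∀ K ⊆ I, IsCompact K → ν K < ⊤) : Integrable φ ν := by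
  have h1 : IntegrableOn φ (tsupport φ) ν := by
    refine hφ.smooth.continuous.continuousOn.integrableOn_of_subset_isCompact
      hφ.hasCompactSupport (isClosed_tsupport φ).measurableSet subset_rfl ?_
    exact (hν _ hφ.tsupport_subset hφ.hasCompactSupport).ne
  exact (integrableOn_iff_integrable_of_support_subset (subset_tsupport φ)).1 h1

theorem IsTestFunction.integrableOn_mul {I : Set ℝ} {φ u : ℝ → ℝ} (hφ : IsTestFunction I φ)
    (hu : LocallyIntegrableOn u I) : IntegrableOn (fun s => u s * φ s) I := by
  have h1 : IntegrableOn (fun s => u s * φ s) (tsupport φ) :=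
    (hu.integrableOn_compact_subset hφ.tsupport_subset hφ.hasCompactSupport).mul_continuousOn
      hφ.smooth.continuous.continuousOn hφ.hasCompactSupport
  refine ((integrableOn_iff_integrable_of_support_subset fun s hs => ?_).1 h1).integrableOn
  exact subset_tsupport φ fun h => hs (by simp [h])

theorem IsTestFunction.setIntegral_eq {I : Set ℝ} {φ w : ℝ → ℝ} (hφ : IsTestFunction I φ) :
    ∫ s in I, w s * φ s = ∫ s, w s * φ s :=
  setIntegral_eq_integral_of_forall_compl_eq_zero fun s hs => by rw [hφ.eq_zero hs, mul_zero]

/-- Integration against the Lebesgue decomposition. -/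
theorem IsTestFunction.integral_eq_singularPart_add {I : Set ℝ} {φ : ℝ → ℝ}
    (hφ : IsTestFunction I φ) (hν : ∀ K ⊆ I, IsCompact K → ν K < ⊤) [SigmaFinite ν] :
    Integrable (fun s => (ν.rnDeriv volume s).toReal * φ s) ∧
    ∫ s, φ s ∂ν = ∫ s, φ s ∂ν.singularPart volume + ∫ s, (ν.rnDeriv volume s).toReal * φ s := by
  have hi := hφ.integrable hν
  have hi1 : Integrable φ (ν.singularPart volume) :=
    hi.mono_measure (Measure.singularPart_le _ _)
  have hi2 : Integrable φ (volume.withDensity (ν.rnDeriv volume)) :=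
    hi.mono_measure (Measure.withDensity_rnDeriv_le _ _)
  constructor
  · rwa [integrable_withDensity_iff_integrable_smul' (Measure.measurable_rnDeriv _ _)
      (Measure.rnDeriv_lt_top _ _)] at hi2
  · conv_lhs => rw [Measure.haveLebesgueDecomposition_add ν volume]
    rw [integral_add_measure hi1 hi2, integral_withDensity_eq_integral_toReal_smul
      (Measure.measurable_rnDeriv _ _) (Measure.rnDeriv_lt_top _ _)]
    rfl

theorem locallyIntegrableOn_rnDeriv_toReal {I : Set ℝ} (hI : IsOpen I)
    (hν : ∀ K ⊆ I, IsCompact K → ν K < ⊤) :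
    LocallyIntegrableOn (fun s => (ν.rnDeriv volume s).toReal) I := by
  rw [locallyIntegrableOn_iff hI.isLocallyClosed]
  intro K hK hKc
  refine integrable_toReal_of_lintegral_ne_top
    (Measure.measurable_rnDeriv _ _).aemeasurable (ne_of_lt ?_)
  exact (Measure.setLIntegral_rnDeriv_le K).trans_lt (hν K hK hKc)

end FiniteOnCompacts

section Radon

open Set

variable {a b : ℝ} (μ : RealRadonMeasure (Ioo a b))

theorem RealRadonMeasure.sigmaFinite_pos : SigmaFinite μ.pos :=
  sigmaFinite_of_finite_on_compacts μ.pos_compl μ.pos_lt_top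

theorem RealRadonMeasure.sigmaFinite_neg : SigmaFinite μ.neg :=
  sigmaFinite_of_finite_on_compacts μ.neg_compl μ.neg_lt_top

/-- The action of a signed Radon measure on a test function, split into the singular parts and the
density. -/
theorem RealRadonMeasure.integral_eq {φ : ℝ → ℝ} (hφ : IsTestFunction (Ioo a b) φ) :
    ∫ s, φ s ∂μ.pos - ∫ s, φ s ∂μ.neg =
      ∫ s, φ s ∂μ.pos.singularPart volume - ∫ s, φ s ∂μ.neg.singularPart volume
        + ∫ s in Ioo a b, μ.density s * φ s := by
  have := μ.sigmaFinite_pos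
  have := μ.sigmaFinite_neg
  obtain ⟨i1, e1⟩ := hφ.integral_eq_singularPart_add μ.pos_lt_top
  obtain ⟨i2, e2⟩ := hφ.integral_eq_singularPart_add μ.neg_lt_top
  have h3 : ∫ s in Ioo a b, μ.density s * φ s =
      (∫ s, (μ.pos.rnDeriv volume s).toReal * φ s)
        - ∫ s, (μ.neg.rnDeriv volume s).toReal * φ s := by
    rw [hφ.setIntegral_eq, ← integral_sub i1 i2]
    simp only [RealRadonMeasure.density, sub_mul]
  rw [e1, e2, h3]
  ring

theorem RealRadonMeasure.locallyIntegrableOn_density : LocallyIntegrableOn μ.density (Ioo a b) :=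
  (locallyIntegrableOn_rnDeriv_toReal isOpen_Ioo μ.pos_lt_top).sub
    (locallyIntegrableOn_rnDeriv_toReal isOpen_Ioo μ.neg_lt_top)

end Radon

/-! ### Cutoffs at the origin -/

section Cutoff

open Set

/-- A smooth cutoff which vanishes for `s ≤ 1/(n+1)` and equals `1` for `s ≥ 2/(n+1)`. -/
noncomputable def originCutoff (n : ℕ) (s : ℝ) : ℝ :=
  Real.smoothTransition (((n : ℝ) + 1) * s - 1)

theorem contDiff_originCutoff (n : ℕ) : ContDiff ℝ ∞ (originCutoff n) :=
  Real.smoothTransition.contDiff.comp ((contDiff_const.mul contDiff_id).sub contDiff_const)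

theorem originCutoff_mem_Icc (n : ℕ) (s : ℝ) : originCutoff n s ∈ Icc (0 : ℝ) 1 :=
  ⟨Real.smoothTransition.nonneg _, Real.smoothTransition.le_one _⟩

theorem originCutoff_eq_zero {n : ℕ} {s : ℝ} (hs : s ≤ 1 / ((n : ℝ) + 1)) :
    originCutoff n s = 0 := by
  refine Real.smoothTransition.zero_of_nonpos ?_
  rw [le_div_iff₀ (by positivity)] at hs
  linarith

theorem deriv_originCutoff_eq_zero {n : ℕ} {s : ℝ} (hs : s < 1 / ((n : ℝ) + 1)) :
    deriv (originCutoff n) s = 0 := by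
  have h : originCutoff n =ᶠ[nhds s] fun _ => 0 := by
    filter_upwards [gt_mem_nhds hs] with t ht using originCutoff_eq_zero (le_of_lt ht)
  rw [h.deriv_eq, deriv_const]

theorem originCutoff_eq_one {n : ℕ} {s : ℝ} (hs : 2 ≤ ((n : ℝ) + 1) * s) :
    originCutoff n s = 1 :=
  Real.smoothTransition.one_of_one_le (by linarith)

theorem deriv_originCutoff_eq_zero' {n : ℕ} {s : ℝ} (hs : 2 < ((n : ℝ) + 1) * s) :
    deriv (originCutoff n) s = 0 := by
  have hc : Continuous fun t : ℝ => ((n : ℝ) + 1) * t := by fun_prop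
  have h : originCutoff n =ᶠ[nhds s] fun _ => 1 := by
    filter_upwards [hc.continuousAt.eventually (lt_mem_nhds hs)] with t ht using
      originCutoff_eq_one (le_of_lt ht)
  rw [h.deriv_eq, deriv_const]

/-- The derivative of the cutoff is of size `1/s`, uniformly in `n`. -/
theorem exists_bound_deriv_originCutoff :
    ∃ M, 0 ≤ M ∧ ∀ n s, 0 < s → |deriv (originCutoff n) s| * s ≤ M := by
  have hst : ContDiff ℝ ∞ Real.smoothTransition := Real.smoothTransition.contDiff
  obtain ⟨C, hC⟩ := (isCompact_Icc (a := (0 : ℝ)) (b := 1)).exists_bound_of_continuousOn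
    (hst.continuous_deriv (by simp)).continuousOn
  have hC0 : 0 ≤ C := (norm_nonneg _).trans (hC 0 (by simp))
  refine ⟨2 * C, by positivity, fun n s hs => ?_⟩
  rcases lt_or_ge s (1 / ((n : ℝ) + 1)) with h1 | h1
  · rw [deriv_originCutoff_eq_zero h1]
    simp [hC0]
  rcases lt_or_ge 2 (((n : ℝ) + 1) * s) with h2 | h2
  · rw [deriv_originCutoff_eq_zero' h2]
    simp [hC0]
  have hder : HasDerivAt (originCutoff n)
      (deriv Real.smoothTransition (((n : ℝ) + 1) * s - 1) * (((n : ℝ) + 1) * 1)) s :=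
    ((hst.differentiable (by simp) _).hasDerivAt).comp s
      (((hasDerivAt_id s).const_mul ((n : ℝ) + 1)).sub_const 1)
  rw [div_le_iff₀ (by positivity)] at h1
  have h3 := hC (((n : ℝ) + 1) * s - 1) ⟨by linarith, by linarith⟩
  rw [Real.norm_eq_abs] at h3
  rw [hder.deriv, mul_one, abs_mul, abs_of_pos (by positivity : (0 : ℝ) < (n : ℝ) + 1), mul_assoc]
  calc _ ≤ C * 2 := mul_le_mul h3 h2 (by positivity) hC0
    _ = 2 * C := mul_comm _ _

theorem eventually_two_lt_mul {s : ℝ} (hs : 0 < s) :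
    ∀ᶠ n : ℕ in Filter.atTop, 2 < ((n : ℝ) + 1) * s := by
  obtain ⟨N, hN⟩ := exists_nat_gt (2 / s)
  filter_upwards [Filter.eventually_ge_atTop N] with n hn
  have h1 : (N : ℝ) ≤ n := by exact_mod_cast hn
  rw [div_lt_iff₀ hs] at hN
  nlinarith

theorem isTestFunction_mul_of_vanishing {χ w : ℝ → ℝ} {ε r' R : ℝ} (hχ : ContDiff ℝ ∞ χ)
    (hw : ContDiff ℝ ∞ w) (hε : 0 < ε) (hr' : r' < R) (hχ0 : ∀ s < ε, χ s = 0)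
    (hw0 : ∀ s, r' < s → w s = 0) : IsTestFunction (Ioo 0 R) fun s => χ s * w s := by
  have hsub : tsupport (fun s => χ s * w s) ⊆ Icc ε r' := by
    refine closure_minimal (fun s hs => ?_) isClosed_Icc
    refine ⟨not_lt.1 fun h => hs ?_, not_lt.1 fun h => hs ?_⟩
    · simp [hχ0 s h]
    · simp [hw0 s h]
  exact ⟨hχ.mul hw, isCompact_Icc.of_isClosed_subset (isClosed_tsupport _) hsub,
    fun s hs => ⟨hε.trans_le (hsub hs).1, (hsub hs).2.trans_lt hr'⟩⟩

end Cutoff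

/-! ### Pairings are bounded by the radial energy -/

section Upper

open Set Metric

variable {d : ℕ} {R : ℝ} {g g' : ℝ → ℝ} {μ : RealRadonMeasure (Ioo 0 R)}
  {F : EuclideanSpace ℝ (Fin d) → Matrix (Fin d) (Fin d) ℝ}

/-- Two integrations by parts, made legitimate by a cutoff `χ_n` at the origin. The terms with
`χ_n'` are the error terms. -/
theorem integral_cutoff_mul_doubleDivergence (hd : 2 ≤ d)
    (hF : ∀ i j, ContDiff ℝ ∞ fun x => F x i j) (hw : IsWeakDeriv (Ioo 0 R) g g')
    (hμ : IsDerivMeasure (Ioo 0 R) g' μ) {r' : ℝ} (hr'0 : 0 < r') (hr' : r' < R)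
    (hs : tsupport F ⊆ closedBall 0 r') (n : ℕ) :
    IsTestFunction (Ioo 0 R) (fun s => originCutoff n s * radialPart F s) ∧
    IsTestFunction (Ioo 0 R) (fun s => originCutoff n s * tangentialPart F s) ∧
    ∫ s in Ioo 0 R, g s * (originCutoff n s * doubleDivergencePart F s) =
      -(∫ s in Ioo 0 R, g s * (deriv (originCutoff n) s * divergenceFlux F s))
      + (∫ s in Ioo 0 R, g' s * (deriv (originCutoff n) s * radialPart F s))
      + ((∫ s, originCutoff n s * radialPart F s ∂μ.pos)
          - (∫ s, originCutoff n s * radialPart F s ∂μ.neg)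
        + ∫ s in Ioo 0 R, g' s * (originCutoff n s * tangentialPart F s)) := by
  have hχ := contDiff_originCutoff n
  have hχ' : ContDiff ℝ ∞ (deriv (originCutoff n)) := (contDiff_infty_iff_deriv.1 hχ).2
  have hε : (0 : ℝ) < 1 / ((n : ℝ) + 1) := by positivity
  have hv := fun s (h : r' < s) => spherical_parts_eq_zero hr'0 hs h
  have tχ : ∀ {w : ℝ → ℝ}, ContDiff ℝ ∞ w → (∀ s, r' < s → w s = 0) →
      IsTestFunction (Ioo 0 R) fun s => originCutoff n s * w s := fun hw h0 =>
    isTestFunction_mul_of_vanishing hχ hw hε hr' (fun s hs => originCutoff_eq_zero hs.le) h0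
  have tχ' : ∀ {w : ℝ → ℝ}, ContDiff ℝ ∞ w → (∀ s, r' < s → w s = 0) →
      IsTestFunction (Ioo 0 R) fun s => deriv (originCutoff n) s * w s := fun hw h0 =>
    isTestFunction_mul_of_vanishing hχ' hw hε hr' (fun s hs => deriv_originCutoff_eq_zero hs) h0
  have hA := contDiff_radialPart hF
  have hB := contDiff_tangentialPart hF
  have hE := contDiff_divergenceFlux hF
  have hD := contDiff_doubleDivergencePart hF
  have tA := tχ hA fun s h => (hv s h).1
  have tB := tχ hB fun s h => (hv s h).2.1
  have tE := tχ hE fun s h => (hv s h).2.2.1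
  have tD := tχ hD fun s h => (hv s h).2.2.2
  have tA' := tχ' hA fun s h => (hv s h).1
  have tE' := tχ' hE fun s h => (hv s h).2.2.1
  refine ⟨tA, tB, ?_⟩
  have ig := hw.locallyIntegrableOn
  have ig' := hw.locallyIntegrableOn_deriv
  have hdχ : ∀ s, HasDerivAt (originCutoff n) (deriv (originCutoff n) s) s := fun s =>
    (hχ.differentiable (by simp) s).hasDerivAt
  have e1 : ∫ s in Ioo 0 R, g s * deriv (fun s => originCutoff n s * divergenceFlux F s) s =
      (∫ s in Ioo 0 R, g s * (deriv (originCutoff n) s * divergenceFlux F s))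
        + ∫ s in Ioo 0 R, g s * (originCutoff n s * doubleDivergencePart F s) := by
    rw [← integral_add (tE'.integrableOn_mul ig) (tD.integrableOn_mul ig)]
    refine setIntegral_congr_fun measurableSet_Ioo fun s hs => ?_
    rw [((hdχ s).fun_mul (hasDerivAt_divergenceFlux hd hF hs.1)).deriv]
    ring
  have e2 : ∫ s in Ioo 0 R, g' s * deriv (fun s => originCutoff n s * radialPart F s) s =
      (∫ s in Ioo 0 R, g' s * (deriv (originCutoff n) s * radialPart F s))
        + (∫ s in Ioo 0 R, g' s * (originCutoff n s * divergenceFlux F s))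
        + ∫ s in Ioo 0 R, g' s * (originCutoff n s * tangentialPart F s) := by
    have i3 : IntegrableOn (fun s => g' s * (deriv (originCutoff n) s * radialPart F s)
        + g' s * (originCutoff n s * divergenceFlux F s)) (Ioo 0 R) :=
      (tA'.integrableOn_mul ig').add (tE.integrableOn_mul ig')
    rw [← integral_add (tA'.integrableOn_mul ig') (tE.integrableOn_mul ig'),
      ← integral_add i3 (tB.integrableOn_mul ig')]
    refine setIntegral_congr_fun measurableSet_Ioo fun s hs => ?_
    rw [((hdχ s).fun_mul (hasDerivAt_radialPart hd hF hs.1)).deriv]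
    ring
  have h1 := hw.integral_eq _ tE
  have h2 := hμ.integral_eq _ tA
  rw [e1] at h1
  rw [e2] at h2
  linarith

theorem integral_le_toReal_lintegral {α : Type*} [MeasurableSpace α] {ν : Measure α} {f : α → ℝ}
    {G : α → ℝ≥0∞} (hf : Integrable f ν) (hfG : ∀ᵐ x ∂ν, ENNReal.ofReal (f x) ≤ G x)
    (hG : ∫⁻ x, G x ∂ν ≠ ⊤) : ∫ x, f x ∂ν ≤ (∫⁻ x, G x ∂ν).toReal := by
  rw [integral_eq_lintegral_pos_part_sub_lintegral_neg_part hf]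
  have h1 := ENNReal.toReal_mono hG (lintegral_mono_ae hfG)
  linarith [ENNReal.toReal_nonneg (a := ∫⁻ x, ENNReal.ofReal (-f x) ∂ν)]

theorem sphereArea_nonneg : 0 ≤ sphereArea d := measureReal_nonneg

/-- The case `(x, y) = (±1, 0)` of the pairing bound. -/
theorem radialPart_bound (hd : 2 ≤ d) {p : ℝ≥0∞} (hp : 1 ≤ p) {r : ℝ}
    (hF : IsHessianTestField p (ball 0 r) F) {s : ℝ} (hs : 0 < s) :
    |radialPart F s| ≤ sphereArea d * s ^ (d - 1) := by
  have hpow := pow_nonneg hs.le (d - 1)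
  have h1 := spherical_pairing_le hd hp hF.smooth hF.schattenNorm_le_one s 1 0
  have h2 := spherical_pairing_le hd hp hF.smooth hF.schattenNorm_le_one s (-1) 0
  rw [radialNorm_zero_right hp, abs_neg, abs_one, mul_one, zero_mul, add_zero] at h2
  rw [radialNorm_zero_right hp, abs_one, mul_one, zero_mul, add_zero] at h1
  rw [radialPart, abs_mul, abs_of_nonneg hpow, mul_comm]
  refine mul_le_mul_of_nonneg_right (abs_le.2 ⟨by linarith, by linarith⟩) hpow

/-- Away from the origin, the Hessian measure of a radial function pairs with an admissible field to
at most the radial energy. -/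
theorem cutoff_pairing_le (hd : 2 ≤ d) {p : ℝ≥0∞} (hp : 1 ≤ p) {r : ℝ} (hr : r ∈ Ioc 0 R)
    (hF : IsHessianTestField p (ball 0 r) F) (ig' : LocallyIntegrableOn g' (Ioo 0 R))
    (hE : radialEnergy d p g' μ r ≠ ⊤) (n : ℕ)
    (tA : IsTestFunction (Ioo 0 R) (fun s => originCutoff n s * radialPart F s))
    (tB : IsTestFunction (Ioo 0 R) (fun s => originCutoff n s * tangentialPart F s)) :
    (∫ s, originCutoff n s * radialPart F s ∂μ.pos)
          - (∫ s, originCutoff n s * radialPart F s ∂μ.neg)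
        + ∫ s in Ioo 0 R, g' s * (originCutoff n s * tangentialPart F s)
      ≤ sphereArea d * (radialEnergy d p g' μ r).toReal := by
  obtain ⟨r', hr'0, hr'r, hsub⟩ :=
    exists_radius_of_tsupport_subset hr.1 hF.hasCompactSupport hF.tsupport_subset
  have hv := fun s (h : r' < s) => spherical_parts_eq_zero hr'0 hsub h
  rw [radialEnergy] at hE ⊢
  set S : ℝ≥0∞ := ∫⁻ s in Ioo 0 r, ENNReal.ofReal (s ^ (d - 1)) ∂μ.singularVariation with hS
  set T : ℝ≥0∞ := ∫⁻ s in Ioo 0 r, ENNReal.ofReal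
    (ellpNorm p (Fin.cons (s * μ.density s) (fun _ : Fin (d - 1) => g' s) : Fin (d - 1 + 1) → ℝ)
      * s ^ (d - 2)) with hT
  obtain ⟨hS', hT'⟩ := ENNReal.add_ne_top.1 hE
  rw [μ.integral_eq tA, ENNReal.toReal_add hS' hT', mul_add, add_assoc]
  have hσ := sphereArea_nonneg (d := d)
  refine add_le_add ?_ ?_
  · -- the singular part
    have hbound : ∀ s, ‖originCutoff n s * radialPart F s‖ₑ ≤
        (Ioo 0 r).indicator (fun s => ENNReal.ofReal (sphereArea d) *
          ENNReal.ofReal (s ^ (d - 1))) s := by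
      intro s
      by_cases hsI : s ∈ Ioo 0 r
      · rw [indicator_of_mem hsI, ← ENNReal.ofReal_mul hσ, ← ofReal_norm]
        refine ENNReal.ofReal_le_ofReal ?_
        rw [norm_mul]
        have h1 := originCutoff_mem_Icc n s
        rw [Real.norm_of_nonneg h1.1, Real.norm_eq_abs]
        exact (mul_le_of_le_one_left (abs_nonneg _) h1.2).trans (radialPart_bound hd hp hF hsI.1)
      · have h0 : originCutoff n s * radialPart F s = 0 := by
          by_cases h : s ≤ 0
          · rw [originCutoff_eq_zero (h.trans (by positivity)), zero_mul]
          · have : r' < s := by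
              by_contra h'
              exact hsI ⟨not_le.1 h, (not_lt.1 h').trans_lt hr'r⟩
            rw [(hv s this).1, mul_zero]
        rw [h0, enorm_zero]
        exact zero_le
    have hi := tA.integrable μ.pos_lt_top
    have hi' := tA.integrable μ.neg_lt_top
    have hsum : ∫⁻ s, ‖originCutoff n s * radialPart F s‖ₑ ∂μ.singularVariation ≤
        ENNReal.ofReal (sphereArea d) * S := by
      refine (lintegral_mono hbound).trans (le_of_eq ?_)
      rw [lintegral_indicator measurableSet_Ioo, lintegral_const_mul' _ _ ENNReal.ofReal_ne_top]
    have hfin : ENNReal.ofReal (sphereArea d) * S ≠ ⊤ := ENNReal.mul_ne_top ENNReal.ofReal_ne_top hS'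
    have habs : ∀ ν : Measure ℝ, |∫ s, originCutoff n s * radialPart F s ∂ν| ≤
        (∫⁻ s, ‖originCutoff n s * radialPart F s‖ₑ ∂ν).toReal := fun ν => by
      rw [← Real.norm_eq_abs]
      refine (norm_integral_le_lintegral_norm _).trans (le_of_eq ?_)
      simp only [ofReal_norm]
    have h1 := habs (μ.pos.singularPart volume)
    have h2 := habs (μ.neg.singularPart volume)
    rw [RealRadonMeasure.singularVariation, lintegral_add_measure] at hsum
    have hne := ne_top_of_le_ne_top hfin hsum
    obtain ⟨hne1, hne2⟩ := ENNReal.add_ne_top.1 hne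
    have h3 := ENNReal.toReal_mono hfin hsum
    rw [ENNReal.toReal_add hne1 hne2, ENNReal.toReal_mul, ENNReal.toReal_ofReal hσ] at h3
    linarith [(abs_le.1 h1).2, (abs_le.1 h2).1]
  · -- the absolutely continuous part
    have i1 := tA.integrableOn_mul μ.locallyIntegrableOn_density
    have i2 := tB.integrableOn_mul ig'
    rw [← integral_add i1 i2]
    have hlin : ∫⁻ s in Ioo 0 R, (Ioo 0 r).indicator (fun s => ENNReal.ofReal (sphereArea d) *
        ENNReal.ofReal (ellpNorm p (Fin.cons (s * μ.density s) (fun _ : Fin (d - 1) => g' s) :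
          Fin (d - 1 + 1) → ℝ) * s ^ (d - 2))) s = ENNReal.ofReal (sphereArea d) * T := by
      rw [lintegral_indicator measurableSet_Ioo, Measure.restrict_restrict measurableSet_Ioo,
        inter_eq_left.2 (Ioo_subset_Ioo_right hr.2), lintegral_const_mul' _ _ ENNReal.ofReal_ne_top]
    have key := integral_le_toReal_lintegral (i1.add i2) (G := (Ioo 0 r).indicator (fun s =>
      ENNReal.ofReal (sphereArea d) * ENNReal.ofReal (ellpNorm p (Fin.cons (s * μ.density s)
        (fun _ : Fin (d - 1) => g' s) : Fin (d - 1 + 1) → ℝ) * s ^ (d - 2)))) ?_ ?_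
    · rw [hlin, ENNReal.toReal_mul, ENNReal.toReal_ofReal hσ] at key
      exact key
    · refine (ae_restrict_iff' measurableSet_Ioo).2 (Filter.Eventually.of_forall fun s hs => ?_)
      simp only [Pi.add_apply]
      by_cases hsI : s ∈ Ioo 0 r
      · rw [indicator_of_mem hsI, ← ENNReal.ofReal_mul hσ]
        refine ENNReal.ofReal_le_ofReal ?_
        have h1 := originCutoff_mem_Icc n s
        have h2 := spherical_pairing_le hd hp hF.smooth hF.schattenNorm_le_one s (s * μ.density s)
          (g' s)
        have hpow : (0 : ℝ) ≤ s ^ (d - 2) := pow_nonneg hs.1.le _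
        have h3 : s ^ (d - 1) = s ^ (d - 2) * s := by
          rw [← pow_succ]
          congr 1
          omega
        have hN := radialNorm_nonneg (m := d - 1) hp (s * μ.density s) (g' s)
        calc μ.density s * (originCutoff n s * radialPart F s)
              + g' s * (originCutoff n s * tangentialPart F s)
            = originCutoff n s * (s ^ (d - 2) * (s * μ.density s * ∑ i, ∑ j,
                sphereIntegral (fun n => n i * n j) (fun x => F x i j) s + g' s * ∑ i, ∑ j,
                sphereIntegral (fun n => (if i = j then 1 else 0) - n i * n j)
                  (fun x => F x i j) s)) := by
              rw [radialPart, tangentialPart, h3]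
              ring
          _ ≤ originCutoff n s * (s ^ (d - 2) *
              (sphereArea d * radialNorm (d - 1) p (s * μ.density s) (g' s))) :=
              mul_le_mul_of_nonneg_left (mul_le_mul_of_nonneg_left h2 hpow) h1.1
          _ ≤ s ^ (d - 2) * (sphereArea d * radialNorm (d - 1) p (s * μ.density s) (g' s)) :=
              mul_le_of_le_one_left (by positivity) h1.2
          _ = _ := by
              rw [radialNorm]
              ring
      · have : r' < s := by
          by_contra h'
          exact hsI ⟨hs.1, (not_lt.1 h').trans_lt hr'r⟩
        rw [(hv s this).1, (hv s this).2.1]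
        simp
    · rw [hlin]
      exact ENNReal.mul_ne_top ENNReal.ofReal_ne_top hT'

/-- Finiteness of the radial energy controls `g'` at the origin. -/
theorem integrableOn_pow_mul_of_radialEnergy (hd : 2 ≤ d) {p : ℝ≥0∞} (hp : 1 ≤ p) {r : ℝ}
    (hr : r ∈ Ioc 0 R) (ig' : LocallyIntegrableOn g' (Ioo 0 R))
    (hE : radialEnergy d p g' μ r ≠ ⊤) :
    IntegrableOn (fun s => s ^ (d - 2) * g' s) (Ioo 0 r) := by
  have hm : AEStronglyMeasurable g' (volume.restrict (Ioo 0 r)) :=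
    ig'.aestronglyMeasurable.mono_measure (Measure.restrict_mono (Ioo_subset_Ioo_right hr.2) le_rfl)
  refine ⟨(by fun_prop : Continuous fun s : ℝ => s ^ (d - 2)).aestronglyMeasurable.mul hm, ?_⟩
  refine lt_of_le_of_lt ?_ (lt_top_iff_ne_top.2 (ENNReal.add_ne_top.1 hE).2)
  refine setLIntegral_mono' measurableSet_Ioo fun s hs => ?_
  rw [← ofReal_norm, norm_mul, Real.norm_of_nonneg (pow_nonneg hs.1.le _), mul_comm]
  exact ENNReal.ofReal_le_ofReal (mul_le_mul_of_nonneg_right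
    (abs_snd_le_radialNorm (m := d - 1) (by omega) hp (s * μ.density s) (g' s))
    (pow_nonneg hs.1.le _))

/-- The upper bound: the pairing with an admissible field is at most the radial energy. The terms
produced by the cutoff at the origin vanish in the limit by dominated convergence. -/
theorem integral_mul_doubleDivergence_le (hd : 2 ≤ d) {p : ℝ≥0∞} (hp : 1 ≤ p) {r : ℝ}
    (hr : r ∈ Ioc 0 R)
    (hg_int : ∀ r ∈ Ioo 0 R, ∫⁻ s in Ioo 0 r, ENNReal.ofReal (s ^ (d - 1) * |g s|) < ⊤)
    (hw : IsWeakDeriv (Ioo 0 R) g g') (hμ : IsDerivMeasure (Ioo 0 R) g' μ)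
    (hE : radialEnergy d p g' μ r ≠ ⊤) (hF : IsHessianTestField p (ball 0 r) F) :
    ∫ s in Ioo 0 R, g s * doubleDivergencePart F s
      ≤ sphereArea d * (radialEnergy d p g' μ r).toReal := by
  obtain ⟨r', hr'0, hr'r, hsub⟩ :=
    exists_radius_of_tsupport_subset hr.1 hF.hasCompactSupport hF.tsupport_subset
  have hr'R : r' < R := hr'r.trans_le hr.2
  obtain ⟨r'', hr''1, hr''2⟩ := exists_between hr'r
  have hr''R : r'' < R := hr''2.trans_le hr.2
  have hv := fun s (h : r' < s) => spherical_parts_eq_zero hr'0 hsub h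
  have ig := hw.locallyIntegrableOn
  have ig' := hw.locallyIntegrableOn_deriv
  have mg := ig.aestronglyMeasurable
  have mg' := ig'.aestronglyMeasurable
  obtain ⟨M, hM0, hM⟩ := exists_bound_deriv_originCutoff
  obtain ⟨CD, hCD0, hCD⟩ := exists_bound_doubleDivergencePart hF.smooth R
  obtain ⟨CE, hCE0, hCE⟩ := exists_bound_divergenceFlux hd hF.smooth R
  obtain ⟨CA, hCA0, hCA⟩ := exists_bound_radialPart hF.smooth R
  have cD := (contDiff_doubleDivergencePart hF.smooth).continuous
  have cE := (contDiff_divergenceFlux hF.smooth).continuous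
  have cA := (contDiff_radialPart hF.smooth).continuous
  have cχ := fun n => (contDiff_originCutoff n).continuous
  have cχ' := fun n => (contDiff_originCutoff n).continuous_deriv (by simp)
  have b1 : IntegrableOn ((Ioo 0 r'').indicator fun s => |s ^ (d - 1) * g s|) (Ioo 0 R) := by
    have := (integrableOn_pow_mul hw.locallyIntegrableOn hg_int ⟨hr'0.trans hr''1, hr''R⟩).norm
    exact ((integrable_indicator_iff measurableSet_Ioo).2 this).integrableOn
  have b2 : IntegrableOn ((Ioo 0 r).indicator fun s => |s ^ (d - 2) * g' s|) (Ioo 0 R) := by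
    have := (integrableOn_pow_mul_of_radialEnergy hd hp hr ig' hE).norm
    exact ((integrable_indicator_iff measurableSet_Ioo).2 this).integrableOn
  -- the main term; `D = O(s^{d-1})` gives the dominating function
  have lim1 : Filter.Tendsto
      (fun n => ∫ s in Ioo 0 R, g s * (originCutoff n s * doubleDivergencePart F s)) Filter.atTop
      (nhds (∫ s in Ioo 0 R, g s * doubleDivergencePart F s)) := by
    refine tendsto_integral_of_dominated_convergence
      (fun s => CD * (Ioo 0 r'').indicator (fun s => |s ^ (d - 1) * g s|) s)
      (fun n => mg.mul ((cχ n).mul cD).aestronglyMeasurable) (b1.const_mul CD) (fun n => ?_) ?_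
    · refine (ae_restrict_iff' measurableSet_Ioo).2 (Filter.Eventually.of_forall fun s hs => ?_)
      by_cases h : r' < s
      · rw [(hv s h).2.2.2]
        simp only [mul_zero, norm_zero]
        exact mul_nonneg hCD0 (indicator_nonneg (fun _ _ => abs_nonneg _) _)
      · have hmem : s ∈ Ioo 0 r'' := ⟨hs.1, (not_lt.1 h).trans_lt hr''1⟩
        rw [indicator_of_mem hmem, norm_mul, norm_mul,
          Real.norm_of_nonneg (originCutoff_mem_Icc n s).1, abs_mul,
          abs_of_nonneg (pow_nonneg hs.1.le _), Real.norm_eq_abs, Real.norm_eq_abs]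
        calc |g s| * (originCutoff n s * |doubleDivergencePart F s|)
            ≤ |g s| * (1 * (CD * s ^ (d - 1))) := by
              refine mul_le_mul_of_nonneg_left ?_ (abs_nonneg _)
              exact mul_le_mul (originCutoff_mem_Icc n s).2 (hCD s ⟨hs.1.le, hs.2.le⟩)
                (abs_nonneg _) zero_le_one
          _ = _ := by ring
    · refine (ae_restrict_iff' measurableSet_Ioo).2 (Filter.Eventually.of_forall fun s hs => ?_)
      refine tendsto_const_nhds.congr' ?_
      filter_upwards [eventually_two_lt_mul hs.1] with n hn
      rw [originCutoff_eq_one hn.le, one_mul]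
  -- the error terms are dominated since `|χ_n'| ≤ M/s` and `E = O(s^d)`, `A = O(s^{d-1})`
  have lim2 : Filter.Tendsto
      (fun n => ∫ s in Ioo 0 R, g s * (deriv (originCutoff n) s * divergenceFlux F s)) Filter.atTop
      (nhds (∫ s in Ioo 0 R, 0)) := by
    refine tendsto_integral_of_dominated_convergence
      (fun s => (M * CE) * (Ioo 0 r'').indicator (fun s => |s ^ (d - 1) * g s|) s)
      (fun n => mg.mul ((cχ' n).mul cE).aestronglyMeasurable) (b1.const_mul _) (fun n => ?_) ?_
    · refine (ae_restrict_iff' measurableSet_Ioo).2 (Filter.Eventually.of_forall fun s hs => ?_)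
      by_cases h : r' < s
      · rw [(hv s h).2.2.1]
        simp only [mul_zero, norm_zero]
        exact mul_nonneg (mul_nonneg hM0 hCE0) (indicator_nonneg (fun _ _ => abs_nonneg _) _)
      · have hmem : s ∈ Ioo 0 r'' := ⟨hs.1, (not_lt.1 h).trans_lt hr''1⟩
        rw [indicator_of_mem hmem, norm_mul, norm_mul, abs_mul,
          abs_of_nonneg (pow_nonneg hs.1.le _), Real.norm_eq_abs, Real.norm_eq_abs,
          Real.norm_eq_abs]
        have hpow : s ^ d = s * s ^ (d - 1) := by
          rw [← pow_succ']
          congr 1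
          omega
        have h1 := hCE s ⟨hs.1.le, hs.2.le⟩
        have h2 := hM n s hs.1
        have hp0 : 0 ≤ s ^ (d - 1) := pow_nonneg hs.1.le _
        calc |g s| * (|deriv (originCutoff n) s| * |divergenceFlux F s|)
            ≤ |g s| * (|deriv (originCutoff n) s| * (CE * s ^ d)) := by gcongr
          _ = |g s| * (CE * s ^ (d - 1)) * (|deriv (originCutoff n) s| * s) := by
              rw [hpow]
              ring
          _ ≤ |g s| * (CE * s ^ (d - 1)) * M := by gcongr
          _ = _ := by ring
    · refine (ae_restrict_iff' measurableSet_Ioo).2 (Filter.Eventually.of_forall fun s hs => ?_)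
      refine tendsto_const_nhds.congr' ?_
      filter_upwards [eventually_two_lt_mul hs.1] with n hn
      rw [deriv_originCutoff_eq_zero' hn]
      ring
  have lim3 : Filter.Tendsto
      (fun n => ∫ s in Ioo 0 R, g' s * (deriv (originCutoff n) s * radialPart F s)) Filter.atTop
      (nhds (∫ s in Ioo 0 R, 0)) := by
    refine tendsto_integral_of_dominated_convergence
      (fun s => (M * CA) * (Ioo 0 r).indicator (fun s => |s ^ (d - 2) * g' s|) s)
      (fun n => mg'.mul ((cχ' n).mul cA).aestronglyMeasurable) (b2.const_mul _) (fun n => ?_) ?_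
    · refine (ae_restrict_iff' measurableSet_Ioo).2 (Filter.Eventually.of_forall fun s hs => ?_)
      by_cases h : r' < s
      · rw [(hv s h).1]
        simp only [mul_zero, norm_zero]
        exact mul_nonneg (mul_nonneg hM0 hCA0) (indicator_nonneg (fun _ _ => abs_nonneg _) _)
      · have hmem : s ∈ Ioo 0 r := ⟨hs.1, (not_lt.1 h).trans_lt hr'r⟩
        rw [indicator_of_mem hmem, norm_mul, norm_mul, abs_mul,
          abs_of_nonneg (pow_nonneg hs.1.le _), Real.norm_eq_abs, Real.norm_eq_abs,
          Real.norm_eq_abs]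
        have hpow : s ^ (d - 1) = s * s ^ (d - 2) := by
          rw [← pow_succ']
          congr 1
          omega
        have h1 := hCA s ⟨hs.1.le, hs.2.le⟩
        have h2 := hM n s hs.1
        have hp0 : 0 ≤ s ^ (d - 2) := pow_nonneg hs.1.le _
        calc |g' s| * (|deriv (originCutoff n) s| * |radialPart F s|)
            ≤ |g' s| * (|deriv (originCutoff n) s| * (CA * s ^ (d - 1))) := by gcongr
          _ = |g' s| * (CA * s ^ (d - 2)) * (|deriv (originCutoff n) s| * s) := by
              rw [hpow]
              ring
          _ ≤ |g' s| * (CA * s ^ (d - 2)) * M := by gcongr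
          _ = _ := by ring
    · refine (ae_restrict_iff' measurableSet_Ioo).2 (Filter.Eventually.of_forall fun s hs => ?_)
      refine tendsto_const_nhds.congr' ?_
      filter_upwards [eventually_two_lt_mul hs.1] with n hn
      rw [deriv_originCutoff_eq_zero' hn]
      ring
  have lim4 := (lim2.neg.add lim3).add_const (sphereArea d * (radialEnergy d p g' μ r).toReal)
  simp only [integral_zero, neg_zero, zero_add] at lim4
  refine le_of_tendsto_of_tendsto' lim1 lim4 fun n => ?_
  obtain ⟨tA, tB, h⟩ := integral_cutoff_mul_doubleDivergence hd hF.smooth hw hμ hr'0 hr'R hsub n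
  rw [h]
  exact add_le_add le_rfl (cutoff_pairing_le hd hp hr hF ig' hE n tA tB)

end Upper

/-! ### The unit ball of the radial norm -/

section DualBall

variable {m : ℕ} {p : ℝ≥0∞}

theorem radialNorm_add_le (hp : 1 ≤ p) (x y x' y' : ℝ) :
    radialNorm m p (x + x') (y + y') ≤ radialNorm m p x y + radialNorm m p x' y' := by
  have : Fact (1 ≤ p) := ⟨hp⟩
  have h : (Fin.cons (x + x') (fun _ : Fin m => y + y') : Fin (m + 1) → ℝ) =
      Fin.cons x (fun _ : Fin m => y) + Fin.cons x' (fun _ : Fin m => y') := by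
    ext i
    refine Fin.cases ?_ (fun j => ?_) i <;> simp
  rw [radialNorm, h, ellpNorm, WithLp.toLp_add]
  exact norm_add_le _ _

theorem convex_radialNorm_le_one (hp : 1 ≤ p) :
    Convex ℝ {v : ℝ × ℝ | radialNorm m p v.1 v.2 ≤ 1} := by
  intro v hv w hw a b ha hb hab
  simp only [Set.mem_ofPred_eq, Prod.fst_add, Prod.snd_add, Prod.smul_fst, Prod.smul_snd,
    smul_eq_mul] at hv hw ⊢
  refine (radialNorm_add_le hp _ _ _ _).trans ?_
  rw [radialNorm_mul hp ha, radialNorm_mul hp hb]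
  nlinarith

theorem radialNorm_zero (hp : 1 ≤ p) : radialNorm m p 0 0 = 0 := by
  rw [radialNorm_zero_right hp, abs_zero]

/-- A sequence in the dual unit ball which computes the norm. The second coordinate is divided by `m`
because `pairing` counts the repeated entry only once. -/
theorem exists_norming_sequence (hm : 1 ≤ m) (hp : 1 ≤ p) :
    ∃ w : ℕ → ℝ × ℝ, (∀ k, radialNorm m (ENNReal.conjExponent p) (w k).1 (w k).2 ≤ 1) ∧
      ∀ v : ℝ × ℝ, ∀ ε > 0, ∃ k, radialNorm m p v.1 (v.2 / m) - ε < pairing (w k) v := by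
  have hq := one_le_conjExponent p
  set C : Set (ℝ × ℝ) := {v | radialNorm m (ENNReal.conjExponent p) v.1 v.2 ≤ 1} with hC
  have : Nonempty C := ⟨⟨0, by simp [hC, radialNorm_zero hq]⟩⟩
  refine ⟨fun k => TopologicalSpace.denseSeq C k, fun k => (TopologicalSpace.denseSeq C k).2,
    fun v ε hε => ?_⟩
  obtain ⟨a, b, hab, h⟩ := exists_radialNorm_dual hm hp v.1 (v.2 / m)
  have hm0 : (m : ℝ) ≠ 0 := by
    have : 0 < m := hm
    positivity
  have h2 : radialNorm m p v.1 (v.2 / m) = pairing (a, b) v := by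
    rw [h, pairing]
    field_simp
  have hc : Continuous fun u : C => pairing (u : ℝ × ℝ) v :=
    continuous_pairing.comp (continuous_subtype_val.prodMk continuous_const)
  have hopen : IsOpen {u : C | pairing (a, b) v - ε < pairing (u : ℝ × ℝ) v} :=
    isOpen_lt continuous_const hc
  obtain ⟨k, hk⟩ := (TopologicalSpace.denseRange_denseSeq C).exists_mem_open hopen
    ⟨⟨(a, b), hab⟩, by simpa using hε⟩
  exact ⟨k, by rw [h2]; exact hk⟩

end DualBall

/-! ### Radial fields detect the radial energy -/

section Lower

open Set Metric

variable {d : ℕ} {R r : ℝ} {g g' a b : ℝ → ℝ} {μ : RealRadonMeasure (Ioo 0 R)}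

theorem IsTestFunction.mul_smooth {I : Set ℝ} {φ w : ℝ → ℝ} (h : IsTestFunction I φ)
    (hw : ContDiff ℝ ∞ w) : IsTestFunction I (fun s => w s * φ s) := by
  have := h.mul_contDiffAt (w := w) fun s _ => hw.contDiffAt
  simpa only [mul_comm] using this

theorem IsTestFunction.sub {I : Set ℝ} {φ ψ : ℝ → ℝ} (h : IsTestFunction I φ)
    (h' : IsTestFunction I ψ) : IsTestFunction I (fun s => φ s - ψ s) :=
  ⟨h.smooth.sub h'.smooth, h.hasCompactSupport.sub h'.hasCompactSupport,
    (tsupport_sub φ ψ).trans (union_subset h.tsupport_subset h'.tsupport_subset)⟩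

/-- On radial fields the relations between the spherical parts determine the double divergence from
the profiles. -/
theorem doubleDivergencePart_radialField (hd : 2 ≤ d) (ha : IsTestFunction (Ioo 0 r) a)
    (hb : IsTestFunction (Ioo 0 r) b) {s : ℝ} (hs : 0 < s) :
    doubleDivergencePart (radialField a b : EuclideanSpace ℝ (Fin d) → Matrix (Fin d) (Fin d) ℝ) s =
      deriv (fun t => deriv (fun t => sphereArea d * (t ^ (d - 1) * a t)) t
        - sphereArea d * (t ^ (d - 2) * (((d - 1 : ℕ) : ℝ) * b t))) s := by
  have hF := fun i j => contDiff_radialField (d := d) ha hb i j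
  have h1 : (fun t => deriv (fun t => sphereArea d * (t ^ (d - 1) * a t)) t
        - sphereArea d * (t ^ (d - 2) * (((d - 1 : ℕ) : ℝ) * b t))) =ᶠ[nhds s]
      divergenceFlux (radialField a b : EuclideanSpace ℝ (Fin d) → Matrix (Fin d) (Fin d) ℝ) := by
    filter_upwards [lt_mem_nhds hs] with t ht
    have h2 : (fun t => sphereArea d * (t ^ (d - 1) * a t)) =ᶠ[nhds t]
        radialPart (radialField a b : EuclideanSpace ℝ (Fin d) → Matrix (Fin d) (Fin d) ℝ) := by
      filter_upwards [lt_mem_nhds ht] with τ hτ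
      rw [radialPart_radialField ha hb hτ]
    rw [h2.deriv_eq, (hasDerivAt_radialPart hd hF ht).deriv, tangentialPart_radialField hd ha hb ht]
    ring
  rw [h1.deriv_eq, (hasDerivAt_divergenceFlux hd hF hs).deriv]

/-- The distributional Hessian of a radial function tested against a radial field. -/
theorem integral_mul_doubleDivergence_radialField (hd : 2 ≤ d) (hrR : r ≤ R)
    (hw : IsWeakDeriv (Ioo 0 R) g g') (hμ : IsDerivMeasure (Ioo 0 R) g' μ)
    (ha : IsTestFunction (Ioo 0 r) a) (hb : IsTestFunction (Ioo 0 r) b) :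
    ∫ s in Ioo 0 R, g s * doubleDivergencePart
        (radialField a b : EuclideanSpace ℝ (Fin d) → Matrix (Fin d) (Fin d) ℝ) s =
      sphereArea d * ((∫ s, s ^ (d - 1) * a s ∂μ.pos) - (∫ s, s ^ (d - 1) * a s ∂μ.neg)
        + ∫ s in Ioo 0 R, g' s * (s ^ (d - 2) * (((d - 1 : ℕ) : ℝ) * b s))) := by
  set A : ℝ → ℝ := fun t => sphereArea d * (t ^ (d - 1) * a t) with hA
  set B : ℝ → ℝ := fun t => sphereArea d * (t ^ (d - 2) * (((d - 1 : ℕ) : ℝ) * b t)) with hB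
  have hrR' : Ioo 0 r ⊆ Ioo 0 R := Ioo_subset_Ioo_right hrR
  have tA : IsTestFunction (Ioo 0 R) A :=
    ((ha.mono hrR').mul_smooth (contDiff_id.pow (d - 1))).mul_smooth contDiff_const
  have tB : IsTestFunction (Ioo 0 R) B :=
    (((hb.mono hrR').mul_smooth contDiff_const).mul_smooth
      (contDiff_id.pow (d - 2))).mul_smooth contDiff_const
  have e1 := hw.integral_eq _ (tA.deriv.sub tB)
  have e2 := hμ.integral_eq _ tA
  have e3 : ∫ s in Ioo 0 R, g' s * (deriv A s - B s) =
      (∫ s in Ioo 0 R, g' s * deriv A s) - ∫ s in Ioo 0 R, g' s * B s := by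
    rw [← integral_sub (tA.deriv.integrableOn_mul hw.locallyIntegrableOn_deriv)
      (tB.integrableOn_mul hw.locallyIntegrableOn_deriv)]
    simp only [mul_sub]
  have e4 : ∫ s in Ioo 0 R, g s * doubleDivergencePart
        (radialField a b : EuclideanSpace ℝ (Fin d) → Matrix (Fin d) (Fin d) ℝ) s =
      ∫ s in Ioo 0 R, g s * deriv (fun s => deriv A s - B s) s :=
    setIntegral_congr_fun measurableSet_Ioo fun s hs => by
      rw [doubleDivergencePart_radialField hd ha hb hs.1]
  have e5 : ∫ s in Ioo 0 R, g' s * B s =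
      sphereArea d * ∫ s in Ioo 0 R, g' s * (s ^ (d - 2) * (((d - 1 : ℕ) : ℝ) * b s)) := by
    rw [← integral_const_mul]
    congr 1
    ext s
    rw [hB]
    ring
  rw [e4, e1, e3, e2, e5, hA, integral_const_mul, integral_const_mul]
  ring

/-- The polar decomposition of the pair `(D g', g')` with respect to
`|D^s g'| + ℒ^1`: the singular part carries the signs `±1`. -/
theorem exists_polar_density (μ : RealRadonMeasure (Ioo 0 R))
    (hg' : LocallyIntegrableOn g' (Ioo 0 R)) :
    ∃ ξ η : ℝ → ℝ, Measurable ξ ∧ Measurable η ∧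
      (ξ =ᵐ[μ.pos.singularPart volume] fun _ => 1) ∧
      (η =ᵐ[μ.pos.singularPart volume] fun _ => 0) ∧
      (ξ =ᵐ[μ.neg.singularPart volume] fun _ => -1) ∧
      (η =ᵐ[μ.neg.singularPart volume] fun _ => 0) ∧
      (ξ =ᵐ[volume.restrict (Ioo 0 R)] μ.density) ∧ (η =ᵐ[volume.restrict (Ioo 0 R)] g') := by
  classical
  obtain ⟨Zp, mp, hp1, hp2⟩ := Measure.mutuallySingular_singularPart μ.pos volume
  obtain ⟨Zn, mn, hn1, hn2⟩ := Measure.mutuallySingular_singularPart μ.neg volume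
  obtain ⟨S, mS, hS1, hS2⟩ := μ.mutuallySingular.mono (Measure.singularPart_le μ.pos volume)
    (Measure.singularPart_le μ.neg volume)
  have hm := hg'.aestronglyMeasurable
  have hdens : Measurable μ.density :=
    (Measure.measurable_rnDeriv _ _).ennreal_toReal.sub
      (Measure.measurable_rnDeriv _ _).ennreal_toReal
  have ap : ∀ᵐ s ∂μ.pos.singularPart volume, s ∉ Zp ∧ s ∉ S :=
    (measure_eq_zero_iff_ae_notMem.1 hp1).and (measure_eq_zero_iff_ae_notMem.1 hS1)
  have an : ∀ᵐ s ∂μ.neg.singularPart volume, s ∉ Zn ∧ s ∈ S := by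
    filter_upwards [measure_eq_zero_iff_ae_notMem.1 hn1, measure_eq_zero_iff_ae_notMem.1 hS2]
      with s h1 h2 using ⟨h1, not_not.1 h2⟩
  have av : ∀ᵐ s ∂volume.restrict (Ioo 0 R), s ∈ Zp ∩ Zn := by
    filter_upwards [ae_restrict_of_ae (measure_eq_zero_iff_ae_notMem.1 hp2),
      ae_restrict_of_ae (measure_eq_zero_iff_ae_notMem.1 hn2)] with s h1 h2
      using ⟨not_not.1 h1, not_not.1 h2⟩
  refine ⟨fun s => if s ∈ Zp ∩ Zn then μ.density s else if s ∈ S then -1 else 1,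
    fun s => if s ∈ Zp ∩ Zn then hm.mk g' s else 0,
    hdens.ite (mp.inter mn) (measurable_const.ite mS measurable_const),
    hm.stronglyMeasurable_mk.measurable.ite (mp.inter mn) measurable_const, ?_, ?_, ?_, ?_, ?_, ?_⟩
  · filter_upwards [ap] with s hs
    simp [hs.1, hs.2]
  · filter_upwards [ap] with s hs
    simp [hs.1]
  · filter_upwards [an] with s hs
    simp [hs.1, hs.2]
  · filter_upwards [an] with s hs
    simp [hs.1]
  · filter_upwards [av] with s hs
    rw [if_pos hs]
  · filter_upwards [av, hm.ae_eq_mk] with s hs h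
    rw [if_pos hs, h]

/-- The lower bound: any bound for the pairings with radial fields bounds the radial energy. The
duality statement is applied to the measure `|D^s g'| + ℒ^1` and to the density of
`(s^{d-1} Dg', (d-1) s^{d-2} g' ℒ^1)` with respect to it. -/
theorem radialEnergy_le_of_radialField (hd : 2 ≤ d) {p : ℝ≥0∞} (hp : 1 ≤ p) (hrR : r ≤ R)
    (hg' : LocallyIntegrableOn g' (Ioo 0 R)) {B : ℝ}
    (hB : ∀ a b, IsTestFunction (Ioo 0 r) a → IsTestFunction (Ioo 0 r) b →
      (∀ s, radialNorm (d - 1) (ENNReal.conjExponent p) (a s) (b s) ≤ 1) →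
      (∫ s, s ^ (d - 1) * a s ∂μ.pos) - (∫ s, s ^ (d - 1) * a s ∂μ.neg)
        + ∫ s in Ioo 0 R, g' s * (s ^ (d - 2) * (((d - 1 : ℕ) : ℝ) * b s)) ≤ B) :
    radialEnergy d p g' μ r ≤ ENNReal.ofReal B := by
  have hq := one_le_conjExponent p
  have hm : 1 ≤ d - 1 := by omega
  have hm0 : ((d - 1 : ℕ) : ℝ) ≠ 0 := by
    have : 0 < d - 1 := hm
    positivity
  have hsub : Ioo 0 r ⊆ Ioo 0 R := Ioo_subset_Ioo_right hrR
  obtain ⟨ξ, η, mξ, mη, ξp, ηp, ξn, ηn, ξv, ηv⟩ := exists_polar_density μ hg'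
  obtain ⟨w, hw, hN⟩ := exists_norming_sequence (m := d - 1) hm hp
  set σp := μ.pos.singularPart volume with hσp
  set σn := μ.neg.singularPart volume with hσn
  set ν := σp + σn + volume.restrict (Ioo 0 R) with hν
  set h : ℝ → ℝ × ℝ := fun s => (s ^ (d - 1) * ξ s, ((d - 1 : ℕ) : ℝ) * s ^ (d - 2) * η s) with hh
  have c1 : Continuous fun s : ℝ => s ^ (d - 1) := by fun_prop
  have c2 : Continuous fun s : ℝ => ((d - 1 : ℕ) : ℝ) * s ^ (d - 2) := by fun_prop
  have mh : Measurable h := (c1.measurable.mul mξ).prodMk (c2.measurable.mul mη)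
  have fp : ∀ K ⊆ Ioo 0 R, IsCompact K → σp K < ⊤ := fun K hK hKc =>
    (Measure.singularPart_le μ.pos volume K).trans_lt (μ.pos_lt_top K hK hKc)
  have fn : ∀ K ⊆ Ioo 0 R, IsCompact K → σn K < ⊤ := fun K hK hKc =>
    (Measure.singularPart_le μ.neg volume K).trans_lt (μ.neg_lt_top K hK hKc)
  have hint : ∀ K ⊆ Ioo 0 R, IsCompact K → IntegrableOn ξ K ν ∧ IntegrableOn η K ν := by
    intro K hK hKc
    have h1 : IntegrableOn μ.density K :=
      μ.locallyIntegrableOn_density.integrableOn_compact_subset hK hKc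
    have h2 : IntegrableOn g' K := hg'.integrableOn_compact_subset hK hKc
    have hr : (volume.restrict (Ioo 0 R)).restrict K = volume.restrict K := by
      rw [Measure.restrict_restrict hKc.measurableSet, inter_eq_left.2 hK]
    have haev : ∀ {u v : ℝ → ℝ}, u =ᵐ[volume.restrict (Ioo 0 R)] v → IntegrableOn v K →
        IntegrableOn u K (volume.restrict (Ioo 0 R)) := fun {u v} huv hv => by
      have hv' : IntegrableOn v K (volume.restrict (Ioo 0 R)) := by
        rw [IntegrableOn, hr]
        exact hv
      exact hv'.congr (Filter.EventuallyEq.symm (ae_restrict_of_ae huv))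
    have hcst : ∀ {u : ℝ → ℝ} {c : ℝ} {τ : Measure ℝ}, τ K < ⊤ → u =ᵐ[τ] (fun _ => c) →
        IntegrableOn u K τ := fun {u c τ} hτ hu =>
      (integrableOn_const (C := c) hτ.ne).congr (Filter.EventuallyEq.symm (ae_restrict_of_ae hu))
    exact ⟨((hcst (fp K hK hKc) ξp).add_measure (hcst (fn K hK hKc) ξn)).add_measure (haev ξv h1),
      ((hcst (fp K hK hKc) ηp).add_measure (hcst (fn K hK hKc) ηn)).add_measure (haev ηv h2)⟩
  have hhi : LocallyIntegrableOn h (Ioo 0 r) ν := by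
    rw [locallyIntegrableOn_iff isOpen_Ioo.isLocallyClosed]
    intro K hK hKc
    obtain ⟨i1, i2⟩ := hint K (hK.trans hsub) hKc
    exact (i1.continuousOn_mul c1.continuousOn hKc).prodMk (i2.continuousOn_mul c2.continuousOn hKc)
  have key := lintegral_le_of_forall_pairing_le (ν := ν) (a := 0) (b := r) (h := h)
    (C := {v | radialNorm (d - 1) (ENNReal.conjExponent p) v.1 v.2 ≤ 1}) (w := w)
    (N := fun v => radialNorm (d - 1) p v.1 (v.2 / ((d - 1 : ℕ) : ℝ))) (B := B) mh hhi
    (convex_radialNorm_le_one hq) (by simp [radialNorm_zero hq]) hw hN ?_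
  · refine le_trans (le_of_eq ?_) key
    have hz : ∀ s ∈ Ioo 0 r, radialNorm (d - 1) p (h s).1 ((h s).2 / ((d - 1 : ℕ) : ℝ)) =
        s ^ (d - 2) * radialNorm (d - 1) p (s * ξ s) (η s) := fun s hs => by
      rw [← radialNorm_mul hp (pow_nonneg hs.1.le _)]
      have h3 : s ^ (d - 1) = s ^ (d - 2) * s := by
        rw [← pow_succ]
        congr 1
        omega
      congr 1
      · simp only [hh, h3]
        ring
      · simp only [hh]
        field_simp
    have hsing : ∀ (τ : Measure ℝ) (c : ℝ), |c| = 1 → (ξ =ᵐ[τ] fun _ => c) → (η =ᵐ[τ] fun _ => 0) →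
        ∫⁻ s in Ioo 0 r, ENNReal.ofReal (radialNorm (d - 1) p (h s).1
          ((h s).2 / ((d - 1 : ℕ) : ℝ))) ∂τ = ∫⁻ s in Ioo 0 r, ENNReal.ofReal (s ^ (d - 1)) ∂τ := by
      intro τ c hc h1 h2
      refine setLIntegral_congr_fun_ae measurableSet_Ioo ?_
      filter_upwards [h1, h2] with s h1 h2 hs
      rw [hz s hs, h1, h2, radialNorm_zero_right hp, abs_mul, hc, mul_one, abs_of_pos hs.1,
        ← pow_succ]
      congr 2
      omega
    rw [radialEnergy, RealRadonMeasure.singularVariation, hν, Measure.restrict_add,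
      Measure.restrict_add, lintegral_add_measure, lintegral_add_measure, Measure.restrict_add,
      lintegral_add_measure, hsing σp 1 (by simp) ξp ηp, hsing σn (-1) (by simp) ξn ηn,
      Measure.restrict_restrict measurableSet_Ioo, inter_eq_left.2 hsub]
    congr 1
    refine setLIntegral_congr_fun_ae measurableSet_Ioo ?_
    rw [Filter.EventuallyEq, ae_restrict_iff' measurableSet_Ioo] at ξv ηv
    filter_upwards [ξv, ηv] with s h1 h2 hs
    rw [hz s hs, h1 (hsub hs), h2 (hsub hs), radialNorm, mul_comm]
  · intro φ₁ φ₂ t₁ t₂ hφ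
    have T₁ : IsTestFunction (Ioo 0 R) fun s => s ^ (d - 1) * φ₁ s :=
      (t₁.mono hsub).mul_smooth (contDiff_id.pow (d - 1))
    have T₂ : IsTestFunction (Ioo 0 R) fun s => s ^ (d - 2) * (((d - 1 : ℕ) : ℝ) * φ₂ s) :=
      ((t₂.mono hsub).mul_smooth contDiff_const).mul_smooth (contDiff_id.pow (d - 2))
    refine le_trans (le_of_eq ?_) (hB φ₁ φ₂ t₁ t₂ hφ)
    have i1 := T₁.integrableOn_mul μ.locallyIntegrableOn_density
    have i2 := T₂.integrableOn_mul hg'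
    have ep : (fun s => pairing (φ₁ s, φ₂ s) (h s)) =ᵐ[σp] fun s => s ^ (d - 1) * φ₁ s := by
      filter_upwards [ξp, ηp] with s h1 h2
      simp only [pairing, hh, h1, h2]
      ring
    have en : (fun s => pairing (φ₁ s, φ₂ s) (h s)) =ᵐ[σn] fun s => -(s ^ (d - 1) * φ₁ s) := by
      filter_upwards [ξn, ηn] with s h1 h2
      simp only [pairing, hh, h1, h2]
      ring
    have ev : (fun s => pairing (φ₁ s, φ₂ s) (h s)) =ᵐ[volume.restrict (Ioo 0 R)]
        fun s => μ.density s * (s ^ (d - 1) * φ₁ s)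
          + g' s * (s ^ (d - 2) * (((d - 1 : ℕ) : ℝ) * φ₂ s)) := by
      filter_upwards [ξv, ηv] with s h1 h2
      simp only [pairing, hh, h1, h2]
      ring
    have jp := (integrable_congr ep).2 (T₁.integrable fp)
    have jn := (integrable_congr en).2 (T₁.integrable fn).neg
    have jv := (integrable_congr ev).2 (i1.add i2)
    rw [hν, integral_add_measure (jp.add_measure jn) jv, integral_add_measure jp jn,
      integral_congr_ae ep, integral_congr_ae en, integral_congr_ae ev, integral_neg,
      integral_add i1 i2, μ.integral_eq T₁]
    ring

end Lower

/-! ### Approximate identities and smooth steps -/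

section Mollifier

open Set Filter Topology

/-- A shrinking sequence of bump functions centred at the origin of the line. -/
noncomputable def bumpSeq (n : ℕ) : ContDiffBump (0 : ℝ) where
  rIn := 1 / (2 * ((n : ℝ) + 1))
  rOut := 1 / ((n : ℝ) + 1)
  rIn_pos := by positivity
  rIn_lt_rOut := by
    rw [div_lt_div_iff_of_pos_left one_pos (by positivity) (by positivity)]
    linarith [(by positivity : (0 : ℝ) < (n : ℝ) + 1)]

/-- The normalised bump functions, an approximate identity. -/
noncomputable def bumpKernel (n : ℕ) : ℝ → ℝ := (bumpSeq n).normed volume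

/-- The primitive of `bumpKernel n`, a smooth increasing step from `0` to `1`. -/
noncomputable def smoothStep (n : ℕ) (s : ℝ) : ℝ := ∫ t in (-1 : ℝ)..s, bumpKernel n t

theorem contDiff_bumpKernel (n : ℕ) : ContDiff ℝ ∞ (bumpKernel n) := (bumpSeq n).contDiff_normed

theorem bumpKernel_nonneg (n : ℕ) (s : ℝ) : 0 ≤ bumpKernel n s := (bumpSeq n).nonneg_normed s

theorem support_bumpKernel (n : ℕ) :
    Function.support (bumpKernel n) = Ioo (-(1 / ((n : ℝ) + 1))) (1 / ((n : ℝ) + 1)) := by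
  rw [bumpKernel, ContDiffBump.support_normed_eq, Real.ball_eq_Ioo]
  simp [bumpSeq]

theorem one_div_nat_succ_le_one (n : ℕ) : 1 / ((n : ℝ) + 1) ≤ 1 := by
  rw [div_le_one (by positivity)]
  linarith [(Nat.cast_nonneg n : (0 : ℝ) ≤ n)]

theorem hasDerivAt_smoothStep (n : ℕ) (s : ℝ) : HasDerivAt (smoothStep n) (bumpKernel n s) s :=
  (contDiff_bumpKernel n).continuous.integral_hasStrictDerivAt (-1) s |>.hasDerivAt

theorem contDiff_smoothStep (n : ℕ) : ContDiff ℝ ∞ (smoothStep n) := by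
  rw [contDiff_infty_iff_deriv]
  refine ⟨fun s => (hasDerivAt_smoothStep n s).differentiableAt, ?_⟩
  rw [show deriv (smoothStep n) = bumpKernel n from
    funext fun s => (hasDerivAt_smoothStep n s).deriv]
  exact contDiff_bumpKernel n

theorem monotone_smoothStep (n : ℕ) : Monotone (smoothStep n) :=
  monotone_of_deriv_nonneg (fun s => (hasDerivAt_smoothStep n s).differentiableAt) fun s => by
    rw [(hasDerivAt_smoothStep n s).deriv]
    exact bumpKernel_nonneg n s

theorem smoothStep_eq_one {n : ℕ} {s : ℝ} (hs : 1 / ((n : ℝ) + 1) ≤ s) : smoothStep n s = 1 := by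
  rw [smoothStep, intervalIntegral.integral_eq_integral_of_support_subset]
  · exact (bumpSeq n).integral_normed
  · rw [support_bumpKernel]
    intro t ht
    have := one_div_nat_succ_le_one n
    exact ⟨by linarith [ht.1], by linarith [ht.2]⟩

theorem smoothStep_eq_zero {n : ℕ} {s : ℝ} (hs : s ≤ -(1 / ((n : ℝ) + 1))) :
    smoothStep n s = 0 := by
  have h1 : smoothStep n (-1) = 0 := intervalIntegral.integral_same
  rcases le_total s (-1) with h | h
  · rw [smoothStep, intervalIntegral.integral_symm, intervalIntegral.integral_of_le h,
      setIntegral_eq_zero_of_forall_eq_zero, neg_zero]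
    intro t ht
    rw [← Function.notMem_support, support_bumpKernel]
    exact fun h' => by linarith [h'.1, ht.2, one_div_nat_succ_le_one n]
  · rw [smoothStep, intervalIntegral.integral_of_le h, setIntegral_eq_zero_of_forall_eq_zero]
    intro t ht
    rw [← Function.notMem_support, support_bumpKernel]
    exact fun h' => by linarith [h'.1, ht.2]

theorem smoothStep_mem_Icc (n : ℕ) (s : ℝ) : smoothStep n s ∈ Icc (0 : ℝ) 1 := by
  constructor
  · rw [← smoothStep_eq_zero (n := n) (min_le_right s (-(1 / ((n : ℝ) + 1))))]
    exact monotone_smoothStep n (min_le_left _ _)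
  · rw [← smoothStep_eq_one (n := n) (le_max_right s (1 / ((n : ℝ) + 1)))]
    exact monotone_smoothStep n (le_max_left _ _)

/-- A smooth approximation of the indicator of `[x, y]`. -/
noncomputable def smoothIndicator (n : ℕ) (x y s : ℝ) : ℝ :=
  smoothStep n (s - x) - smoothStep n (s - y)

theorem hasDerivAt_smoothIndicator (n : ℕ) (x y s : ℝ) :
    HasDerivAt (smoothIndicator n x y) (bumpKernel n (s - x) - bumpKernel n (s - y)) s :=
  ((hasDerivAt_smoothStep n (s - x)).comp_sub_const s x).sub
    ((hasDerivAt_smoothStep n (s - y)).comp_sub_const s y)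

theorem smoothIndicator_eq_zero {n : ℕ} {x y s : ℝ} (hxy : x ≤ y)
    (hs : s ∉ Ioo (x - 1 / ((n : ℝ) + 1)) (y + 1 / ((n : ℝ) + 1))) :
    smoothIndicator n x y s = 0 := by
  rw [mem_Ioo, not_and_or, not_lt, not_lt] at hs
  rw [smoothIndicator]
  rcases hs with h | h
  · rw [smoothStep_eq_zero (by linarith), smoothStep_eq_zero (by linarith), sub_zero]
  · rw [smoothStep_eq_one (by linarith), smoothStep_eq_one (by linarith), sub_self]

theorem smoothIndicator_nonneg {n : ℕ} {x y : ℝ} (hxy : x ≤ y) (s : ℝ) :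
    0 ≤ smoothIndicator n x y s :=
  sub_nonneg.2 (monotone_smoothStep n (by linarith))

theorem smoothIndicator_le_one (n : ℕ) (x y s : ℝ) : smoothIndicator n x y s ≤ 1 := by
  rw [smoothIndicator]
  linarith [(smoothStep_mem_Icc n (s - x)).2, (smoothStep_mem_Icc n (s - y)).1]

theorem isTestFunction_of_vanishing {φ : ℝ → ℝ} {a b α β : ℝ} (hφ : ContDiff ℝ ∞ φ) (ha : a < α)
    (hb : β < b) (h0 : ∀ s, s ∉ Ioo α β → φ s = 0) : IsTestFunction (Ioo a b) φ := by
  have hsub : tsupport φ ⊆ Icc α β := closure_minimal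
    (fun s hs => Ioo_subset_Icc_self (not_not.1 fun h => hs (h0 s h))) isClosed_Icc
  exact ⟨hφ, isCompact_Icc.of_isClosed_subset (isClosed_tsupport _) hsub,
    fun s hs => ⟨ha.trans_le (hsub hs).1, (hsub hs).2.trans_lt hb⟩⟩

theorem isTestFunction_smoothIndicator {n : ℕ} {a b x y : ℝ} (hxy : x ≤ y)
    (ha : a + 1 / ((n : ℝ) + 1) < x) (hb : y < b - 1 / ((n : ℝ) + 1)) :
    IsTestFunction (Ioo a b) (smoothIndicator n x y) := by
  refine isTestFunction_of_vanishing ?_ (by linarith) (by linarith) fun s hs =>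
    smoothIndicator_eq_zero hxy hs
  exact ((contDiff_smoothStep n).comp (contDiff_id.sub contDiff_const)).sub
    ((contDiff_smoothStep n).comp (contDiff_id.sub contDiff_const))

theorem isTestFunction_bumpKernel_sub {n : ℕ} {a b x : ℝ}
    (ha : a + 1 / ((n : ℝ) + 1) < x) (hb : x < b - 1 / ((n : ℝ) + 1)) :
    IsTestFunction (Ioo a b) fun s => bumpKernel n (s - x) := by
  refine isTestFunction_of_vanishing (α := x - 1 / ((n : ℝ) + 1)) (β := x + 1 / ((n : ℝ) + 1))
    ((contDiff_bumpKernel n).comp (contDiff_id.sub contDiff_const)) (by linarith) (by linarith)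
    fun s hs => ?_
  rw [← Function.notMem_support, support_bumpKernel]
  exact fun h => hs ⟨by linarith [h.1], by linarith [h.2]⟩

theorem eventually_add_one_div_lt {a x : ℝ} (h : a < x) :
    ∀ᶠ n : ℕ in atTop, a + 1 / ((n : ℝ) + 1) < x := by
  have h1 : Tendsto (fun n : ℕ => a + 1 / ((n : ℝ) + 1)) atTop (𝓝 (a + 0)) :=
    tendsto_one_div_add_atTop_nhds_zero_nat.const_add a
  rw [add_zero] at h1
  exact h1.eventually (gt_mem_nhds h)

theorem eventually_lt_sub_one_div {b x : ℝ} (h : x < b) :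
    ∀ᶠ n : ℕ in atTop, x < b - 1 / ((n : ℝ) + 1) := by
  have h1 : Tendsto (fun n : ℕ => b - 1 / ((n : ℝ) + 1)) atTop (𝓝 (b - 0)) :=
    tendsto_one_div_add_atTop_nhds_zero_nat.const_sub b
  rw [sub_zero] at h1
  exact h1.eventually (lt_mem_nhds h)

/-- The points of `I` at which the mollifications of `v` converge to `v`. -/
def mollificationPoints (I : Set ℝ) (v : ℝ → ℝ) : Set ℝ :=
  {x ∈ I | Tendsto (fun n : ℕ => ∫ s in I, v s * bumpKernel n (s - x)) atTop (𝓝 (v x))}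

/-- The mollification points have full measure, since the mollifications of a locally integrable
function on the line converge almost everywhere; `v` is truncated to compact subintervals. -/
theorem ae_mem_mollificationPoints {a b : ℝ} {v : ℝ → ℝ} (hv : LocallyIntegrableOn v (Ioo a b)) :
    ∀ᵐ x, x ∈ Ioo a b → x ∈ mollificationPoints (Ioo a b) v := by
  set J : ℕ → Set ℝ := fun k => Icc (a + 1 / ((k : ℝ) + 1)) (b - 1 / ((k : ℝ) + 1)) with hJ
  have hJI : ∀ k, J k ⊆ Ioo a b := fun k => by
    rw [Ioo_eq_iUnion_Icc a b]
    exact subset_iUnion J k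
  have hi : ∀ k, LocallyIntegrable ((J k).indicator v) := fun k =>
    ((integrable_indicator_iff measurableSet_Icc).2
      (hv.integrableOn_compact_subset (hJI k) isCompact_Icc)).locallyIntegrable
  have hr : Tendsto (fun n => (bumpSeq n).rOut) atTop (𝓝 0) := tendsto_one_div_add_atTop_nhds_zero_nat
  have hr' : ∀ᶠ n in atTop, (bumpSeq n).rOut ≤ 2 * (bumpSeq n).rIn := by
    refine Eventually.of_forall fun n => le_of_eq ?_
    simp only [bumpSeq]
    field_simp
  have hae : ∀ᵐ x, ∀ k, _ := ae_all_iff.2 fun k =>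
    ContDiffBump.ae_convolution_tendsto_right_of_locallyIntegrable hr hr' (hi k)
  filter_upwards [hae] with x hx hxI
  refine ⟨hxI, ?_⟩
  obtain ⟨k, hk1, hk2⟩ := ((eventually_add_one_div_lt hxI.1).and
    (eventually_lt_sub_one_div hxI.2)).exists
  have hk := hx k
  have hxJ : x ∈ J k := ⟨hk1.le, hk2.le⟩
  rw [indicator_of_mem hxJ] at hk
  refine hk.congr' ?_
  filter_upwards [eventually_add_one_div_lt hk1, eventually_lt_sub_one_div hk2] with n h1 h2
  have hker : ∀ s, s ∉ J k → bumpKernel n (s - x) = 0 := fun s hs => by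
    rw [← Function.notMem_support, support_bumpKernel]
    exact fun h => hs ⟨by linarith [h.1], by linarith [h.2]⟩
  rw [setIntegral_eq_integral_of_forall_compl_eq_zero fun s hs => by
    rw [hker s fun h => hs (hJI k h), mul_zero], convolution_lsmul,
    ← integral_sub_left_eq_self _ volume x]
  refine integral_congr_ae (Eventually.of_forall fun s => ?_)
  simp only [sub_sub_cancel, smul_eq_mul]
  have h3 : (bumpSeq n).normed volume (x - s) = bumpKernel n (s - x) := by
    rw [← neg_sub, ContDiffBump.normed_neg, bumpKernel]
  rw [h3]
  by_cases hs : s ∈ J k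
  · rw [indicator_of_mem hs, mul_comm]
  · rw [hker s hs, zero_mul, mul_zero]

/-- Testing with the derivative of a smooth indicator computes an increment in the limit. -/
theorem tendsto_integral_deriv_smoothIndicator {a b : ℝ} {v : ℝ → ℝ}
    (hv : LocallyIntegrableOn v (Ioo a b)) {x y : ℝ} (hx : x ∈ mollificationPoints (Ioo a b) v)
    (hy : y ∈ mollificationPoints (Ioo a b) v) :
    Tendsto (fun n => ∫ s in Ioo a b, v s * deriv (smoothIndicator n x y) s) atTop (𝓝 (v x - v y)) := by
  refine (hx.2.sub hy.2).congr' ?_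
  filter_upwards [eventually_add_one_div_lt hx.1.1, eventually_lt_sub_one_div hx.1.2,
    eventually_add_one_div_lt hy.1.1, eventually_lt_sub_one_div hy.1.2] with n h1 h2 h3 h4
  rw [← integral_sub ((isTestFunction_bumpKernel_sub h1 h2).integrableOn_mul hv)
    ((isTestFunction_bumpKernel_sub h3 h4).integrableOn_mul hv)]
  refine integral_congr_ae (Eventually.of_forall fun s => ?_)
  simp only [(hasDerivAt_smoothIndicator n x y s).deriv, mul_sub]

end Mollifier

/-! ### Functions whose derivative is a measure have locally bounded variation -/

section Variation

open Set Filter Topology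

variable {a b : ℝ} {v : ℝ → ℝ}

/-- If `|∫ v φ'| ≤ C sup |φ|` for test functions with support in a compact subinterval, then `v`
has locally bounded variation on a set of full measure. The increments along a partition are computed,
in the limit, by testing with a signed sum of smooth indicators. -/
theorem locallyBoundedVariationOn_of_bound (hv : LocallyIntegrableOn v (Ioo a b))
    (hb : ∀ α β, a < α → β < b → ∃ C : ℝ, ∀ φ, IsTestFunction (Ioo α β) φ → (∀ s, |φ s| ≤ 1) →
      |∫ s in Ioo a b, v s * deriv φ s| ≤ C) :
    LocallyBoundedVariationOn v (mollificationPoints (Ioo a b) v) := by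
  intro c d hc hd
  obtain ⟨α, hα1, hα2⟩ := exists_between hc.1.1
  obtain ⟨β, hβ1, hβ2⟩ := exists_between hd.1.2
  obtain ⟨C, hC⟩ := hb α β hα1 hβ2
  have hsub : Ioo α β ⊆ Ioo a b := Ioo_subset_Ioo hα1.le hβ2.le
  refine ne_top_of_le_ne_top (ENNReal.ofReal_ne_top (r := C)) (iSup_le ?_)
  rintro ⟨N, u, hu, hmem⟩
  simp only [edist_dist, Real.dist_eq]
  rw [← ENNReal.ofReal_sum_of_nonneg fun _ _ => abs_nonneg _]
  refine ENNReal.ofReal_le_ofReal ?_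
  -- the signs of the increments
  set ε : ℕ → ℝ := fun i => SignType.sign (v (u (i + 1)) - v (u i)) with hε
  have hεabs : ∀ i, |ε i| ≤ 1 := fun i => by
    simp only [hε]
    rcases lt_trichotomy (v (u (i + 1)) - v (u i)) 0 with h | h | h
    · simp [sign_neg h]
    · simp [h]
    · simp [sign_pos h]
  have hεmul : ∀ i, ε i * (v (u (i + 1)) - v (u i)) = |v (u (i + 1)) - v (u i)| := fun i =>
    sign_mul_self _
  have lim : Tendsto (fun n => ∑ i ∈ Finset.range N,
      ε i * -∫ s in Ioo a b, v s * deriv (smoothIndicator n (u i) (u (i + 1))) s) atTop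
      (𝓝 (∑ i ∈ Finset.range N, |v (u (i + 1)) - v (u i)|)) := by
    refine tendsto_finsetSum _ fun i _ => ?_
    rw [← hεmul i, ← neg_sub (v (u i))]
    exact ((tendsto_integral_deriv_smoothIndicator hv (hmem i).1 (hmem (i + 1)).1).neg).const_mul _
  refine le_of_tendsto lim ?_
  filter_upwards [eventually_add_one_div_lt hα2, eventually_lt_sub_one_div hβ1] with n h1 h2
  have ht : ∀ i, IsTestFunction (Ioo α β) (smoothIndicator n (u i) (u (i + 1))) := fun i =>
    isTestFunction_smoothIndicator (hu i.le_succ) (h1.trans_le (hmem i).2.1)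
      ((hmem (i + 1)).2.2.trans_lt h2)
  -- the supports of the increments barely overlap, so that their signed sum stays bounded by `1`
  set φ : ℝ → ℝ := fun s => ∑ i ∈ Finset.range N, ε i * smoothIndicator n (u i) (u (i + 1)) s with hφ
  have hφt : ∀ M : ℕ, IsTestFunction (Ioo α β)
      (fun s => ∑ i ∈ Finset.range M, ε i * smoothIndicator n (u i) (u (i + 1)) s) := fun M => by
    induction M with
    | zero => simpa using isTestFunction_zero (Ioo α β)
    | succ M ih =>
      simp only [Finset.sum_range_succ]
      have h3 := ih.sub (((ht M).mul_smooth (contDiff_const (c := -ε M))))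
      simpa [sub_neg_eq_add] using h3
  have hφ1 : ∀ s, |φ s| ≤ 1 := fun s => by
    have h3 : ∀ M : ℕ, ∑ i ∈ Finset.range M, smoothIndicator n (u i) (u (i + 1)) s =
        smoothIndicator n (u 0) (u M) s := fun M => by
      simp only [smoothIndicator]
      rw [Finset.sum_range_sub']
    calc |φ s| ≤ ∑ i ∈ Finset.range N, |ε i * smoothIndicator n (u i) (u (i + 1)) s| :=
          Finset.abs_sum_le_sum_abs _ _
      _ ≤ ∑ i ∈ Finset.range N, smoothIndicator n (u i) (u (i + 1)) s := by
          refine Finset.sum_le_sum fun i _ => ?_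
          have h4 := smoothIndicator_nonneg (n := n) (hu i.le_succ) s
          rw [abs_mul, abs_of_nonneg h4]
          exact mul_le_of_le_one_left h4 (hεabs i)
      _ ≤ 1 := by
          rw [h3]
          exact smoothIndicator_le_one _ _ _ _
  have hder : ∀ s, deriv φ s =
      ∑ i ∈ Finset.range N, ε i * deriv (smoothIndicator n (u i) (u (i + 1))) s := fun s => by
    rw [hφ, deriv_fun_sum fun i _ =>
      ((hasDerivAt_smoothIndicator n (u i) (u (i + 1)) s).differentiableAt.const_mul _)]
    refine Finset.sum_congr rfl fun i _ => ?_
    rw [deriv_const_mul _ (hasDerivAt_smoothIndicator n (u i) (u (i + 1)) s).differentiableAt]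
  have hint : ∫ s in Ioo a b, v s * deriv φ s = ∑ i ∈ Finset.range N,
      ε i * ∫ s in Ioo a b, v s * deriv (smoothIndicator n (u i) (u (i + 1))) s := by
    simp only [hder, Finset.mul_sum]
    rw [integral_finsetSum]
    · refine Finset.sum_congr rfl fun i _ => ?_
      rw [← integral_const_mul]
      congr 1
      ext s
      ring
    · intro i _
      have h3 := (((ht i).mono hsub).deriv.integrableOn_mul hv).const_mul (ε i)
      refine h3.congr (Eventually.of_forall fun s => ?_)
      simp only
      ring
  calc ∑ i ∈ Finset.range N,
      ε i * -∫ s in Ioo a b, v s * deriv (smoothIndicator n (u i) (u (i + 1))) s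
      = -∫ s in Ioo a b, v s * deriv φ s := by
        rw [hint, ← Finset.sum_neg_distrib]
        simp only [mul_neg]
    _ ≤ |∫ s in Ioo a b, v s * deriv φ s| := neg_le_abs _
    _ ≤ C := hC φ (hφt N) hφ1

end Variation

/-! ### Weak differentiability from bounds on the distributional derivative -/

section Lipschitz

open Set Filter Topology

variable {a b : ℝ} {v : ℝ → ℝ}

theorem integral_abs_smoothIndicator_le {n : ℕ} {x y : ℝ} (hxy : x ≤ y) :
    ∫ s, |smoothIndicator n x y s| ≤ y - x + 2 * (1 / ((n : ℝ) + 1)) := by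
  have hn : (0 : ℝ) < 1 / ((n : ℝ) + 1) := by positivity
  have hi : Integrable ((Ioo (x - 1 / ((n : ℝ) + 1)) (y + 1 / ((n : ℝ) + 1))).indicator
      fun _ => (1 : ℝ)) :=
    (integrable_indicator_iff measurableSet_Ioo).2 (integrableOn_const (by simp))
  calc ∫ s, |smoothIndicator n x y s|
      ≤ ∫ s, (Ioo (x - 1 / ((n : ℝ) + 1)) (y + 1 / ((n : ℝ) + 1))).indicator (fun _ => (1 : ℝ)) s := by
        refine integral_mono_of_nonneg (Eventually.of_forall fun s => abs_nonneg _) hi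
          (Eventually.of_forall fun s => ?_)
        simp only
        by_cases hs : s ∈ Ioo (x - 1 / ((n : ℝ) + 1)) (y + 1 / ((n : ℝ) + 1))
        · rw [indicator_of_mem hs, abs_of_nonneg (smoothIndicator_nonneg hxy s)]
          exact smoothIndicator_le_one _ _ _ _
        · rw [indicator_of_notMem hs, smoothIndicator_eq_zero hxy hs, abs_zero]
    _ = y - x + 2 * (1 / ((n : ℝ) + 1)) := by
        rw [integral_indicator_const _ measurableSet_Ioo, Real.volume_real_Ioo_of_le (by linarith)]
        simp only [smul_eq_mul]
        ring

/-- A bound of the distributional derivative by the `L^1` norm is a Lipschitz bound at mollification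
points: test with smooth indicators, whose `L^1` norm tends to the length of the interval. -/
theorem abs_sub_le_of_bound (hv : LocallyIntegrableOn v (Ioo a b)) {α β C : ℝ} (hC : 0 ≤ C)
    (hb : ∀ φ, IsTestFunction (Ioo α β) φ →
      |∫ s in Ioo a b, v s * deriv φ s| ≤ C * ∫ s, |φ s|) {x y : ℝ} (hxy : x ≤ y)
    (hx : x ∈ mollificationPoints (Ioo a b) v) (hy : y ∈ mollificationPoints (Ioo a b) v)
    (hα : α < x) (hβ : y < β) : |v x - v y| ≤ C * (y - x) := by
  have lim1 := (tendsto_integral_deriv_smoothIndicator hv hx hy).abs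
  have lim2 : Tendsto (fun n : ℕ => C * (y - x + 2 * (1 / ((n : ℝ) + 1)))) atTop
      (𝓝 (C * (y - x + 2 * 0))) :=
    ((tendsto_one_div_add_atTop_nhds_zero_nat.const_mul 2).const_add (y - x)).const_mul C
  rw [mul_zero, add_zero] at lim2
  refine le_of_tendsto_of_tendsto lim1 lim2 ?_
  filter_upwards [eventually_add_one_div_lt hα, eventually_lt_sub_one_div hβ] with n h1 h2
  exact (hb _ (isTestFunction_smoothIndicator hxy h1 h2)).trans
    (mul_le_mul_of_nonneg_left (integral_abs_smoothIndicator_le hxy) hC)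

theorem lineDeriv_one_eq_deriv (f : ℝ → ℝ) (x : ℝ) : lineDeriv ℝ f x 1 = deriv f x := by
  have h := deriv_comp_const_add f x 0
  rw [add_zero] at h
  rw [lineDeriv, ← h]
  simp

/-- Integration by parts for a Lipschitz function and a test function. -/
theorem integral_deriv_mul_of_lipschitzWith {C : NNReal} {G φ : ℝ → ℝ} (hG : LipschitzWith C G)
    (hφ : ContDiff ℝ ∞ φ) (hc : HasCompactSupport φ) :
    ∫ s, G s * deriv φ s = -∫ s, deriv G s * φ s := by
  obtain ⟨D, hD⟩ := ContDiff.lipschitzWith_of_hasCompactSupport hc hφ (by simp)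
  have h := LipschitzWith.integral_lineDeriv_mul_eq (μ := volume) hG hD hc 1
  simp only [lineDeriv_neg, lineDeriv_one_eq_deriv, neg_mul, integral_neg] at h
  rw [h, neg_neg]
  simp only [mul_comm]

theorem exists_Ioo_subset_of_isCompact {K : Set ℝ} (hK : IsCompact K) (hKI : K ⊆ Ioo a b) :
    ∃ k : ℕ, K ⊆ Ioo (a + 1 / ((k : ℝ) + 1)) (b - 1 / ((k : ℝ) + 1)) := by
  rcases K.eq_empty_or_nonempty with rfl | hne
  · exact ⟨0, empty_subset _⟩
  obtain ⟨m, hm⟩ := hK.exists_isLeast hne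
  obtain ⟨M, hM⟩ := hK.exists_isGreatest hne
  obtain ⟨k, h1, h2⟩ := ((eventually_add_one_div_lt (hKI hm.1).1).and
    (eventually_lt_sub_one_div (hKI hM.1).2)).exists
  exact ⟨k, fun s hs => ⟨h1.trans_le (hm.2 hs), (hM.2 hs).trans_lt h2⟩⟩

/-- If `|∫ v φ'| ≤ C ∫ |φ|` for test functions with support in a compact subinterval, then `v` is
almost everywhere equal to a locally Lipschitz function; in particular it is weakly
differentiable. -/
theorem memW11Loc_of_bound (hv : LocallyIntegrableOn v (Ioo a b))
    (hb : ∀ α β, a < α → β < b → ∃ C : ℝ, 0 ≤ C ∧ ∀ φ, IsTestFunction (Ioo α β) φ →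
      |∫ s in Ioo a b, v s * deriv φ s| ≤ C * ∫ s, |φ s|) : MemW11Loc (Ioo a b) v := by
  set S := mollificationPoints (Ioo a b) v with hS
  set J : ℕ → Set ℝ := fun k => Ioo (a + 1 / ((k : ℝ) + 1)) (b - 1 / ((k : ℝ) + 1)) with hJ
  have hpos : ∀ k : ℕ, (0 : ℝ) < 1 / ((k : ℝ) + 1) := fun k => by positivity
  have hJI : ∀ k, J k ⊆ Ioo a b := fun k =>
    Ioo_subset_Ioo (by linarith [hpos k]) (by linarith [hpos k])
  have hSae := ae_mem_mollificationPoints hv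
  have hext : ∀ k, ∃ (C : NNReal) (G : ℝ → ℝ), LipschitzWith C G ∧ EqOn v G (S ∩ J k) := by
    intro k
    obtain ⟨C, hC, h⟩ := hb (a + 1 / ((k : ℝ) + 1)) (b - 1 / ((k : ℝ) + 1))
      (by linarith [hpos k]) (by linarith [hpos k])
    have hL : LipschitzOnWith C.toNNReal v (S ∩ J k) := by
      refine LipschitzOnWith.of_dist_le_mul fun x hx y hy => ?_
      rw [Real.coe_toNNReal _ hC, Real.dist_eq, Real.dist_eq]
      rcases le_total x y with hxy | hxy
      · rw [abs_sub_comm x, abs_of_nonneg (sub_nonneg.2 hxy)]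
        exact abs_sub_le_of_bound hv hC h hxy hx.1 hy.1 hx.2.1 hy.2.2
      · rw [abs_of_nonneg (sub_nonneg.2 hxy), abs_sub_comm]
        exact abs_sub_le_of_bound hv hC h hxy hy.1 hx.1 hy.2.1 hx.2.2
    obtain ⟨G, hG1, hG2⟩ := hL.extend_real
    exact ⟨_, G, hG1, hG2⟩
  choose C G hG hGeq using hext
  have hdense : ∀ t ∈ Ioo a b, t ∈ closure S := by
    intro t ht
    rw [mem_closure_iff]
    intro o ho hto
    by_contra hne
    have h0 : volume (o ∩ Ioo a b) = 0 := by
      refine measure_mono_null (fun s hs => ?_) (ae_iff.1 hSae)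
      exact fun h => hne ⟨s, hs.1, h hs.2⟩
    exact ((ho.inter isOpen_Ioo).measure_pos volume ⟨t, hto, ht⟩).ne' h0
  have hE : ∀ k, ∀ t ∈ J k, extendFrom S v t = G k t := by
    intro k t ht
    refine extendFrom_eq (hdense t (hJI k ht)) ?_
    have h1 : Tendsto (G k) (𝓝[S] t) (𝓝 (G k t)) := (hG k).continuous.continuousWithinAt
    refine h1.congr' ?_
    filter_upwards [self_mem_nhdsWithin, mem_nhdsWithin_of_mem_nhds (isOpen_Ioo.mem_nhds ht)]
      with s hs1 hs2 using (hGeq k ⟨hs1, hs2⟩).symm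
  have hD : ∀ k, ∀ t ∈ J k, deriv (extendFrom S v) t = deriv (G k) t := by
    intro k t ht
    refine Filter.EventuallyEq.deriv_eq ?_
    filter_upwards [isOpen_Ioo.mem_nhds ht] with s hs using hE k s hs
  -- the weak derivative is the classical derivative of the locally Lipschitz representative
  refine ⟨deriv (extendFrom S v), hv, ?_, fun φ hφ => ?_⟩
  · intro x hx
    obtain ⟨k, hk⟩ := exists_Ioo_subset_of_isCompact isCompact_singleton
      (singleton_subset_iff.2 hx)
    refine ⟨J k, mem_nhdsWithin_of_mem_nhds (isOpen_Ioo.mem_nhds (hk rfl)), ?_⟩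
    have h1 : IntegrableOn (deriv (G k)) (J k) := by
      refine Measure.integrableOn_of_bounded (M := C k) (by simp [hJ])
        (measurable_deriv _).aestronglyMeasurable (Eventually.of_forall fun s => ?_)
      exact norm_deriv_le_of_lipschitz (hG k)
    exact h1.congr_fun (fun t ht => (hD k t ht).symm) measurableSet_Ioo
  · obtain ⟨k, hk⟩ := exists_Ioo_subset_of_isCompact hφ.hasCompactSupport hφ.tsupport_subset
    have hφk : IsTestFunction (J k) φ := ⟨hφ.smooth, hφ.hasCompactSupport, hk⟩
    have e1 : ∫ s in Ioo a b, v s * deriv φ s = ∫ s, G k s * deriv φ s := by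
      rw [hφ.deriv.setIntegral_eq]
      refine integral_congr_ae ?_
      filter_upwards [hSae] with s hs
      by_cases hsJ : s ∈ J k
      · rw [hGeq k ⟨hs (hJI k hsJ), hsJ⟩]
      · rw [hφk.deriv.eq_zero hsJ, mul_zero, mul_zero]
    have e2 : ∫ s in Ioo a b, deriv (extendFrom S v) s * φ s = ∫ s, deriv (G k) s * φ s := by
      rw [hφ.setIntegral_eq]
      refine integral_congr_ae (Eventually.of_forall fun s => ?_)
      simp only
      by_cases hsJ : s ∈ J k
      · rw [hD k s hsJ]
      · rw [hφk.eq_zero hsJ, mul_zero, mul_zero]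
    rw [e1, e2, integral_deriv_mul_of_lipschitzWith (hG k) hφ.smooth hφ.hasCompactSupport]

/-- A test function of vanishing integral is the derivative of a test function. -/
theorem exists_isTestFunction_primitive {α β : ℝ} {φ : ℝ → ℝ} (hφ : IsTestFunction (Ioo α β) φ)
    (h0 : ∫ s, φ s = 0) :
    ∃ Φ, IsTestFunction (Ioo α β) Φ ∧ deriv Φ = φ ∧ ∀ s, |Φ s| ≤ ∫ t, |φ t| := by
  obtain ⟨k, hk⟩ := exists_Ioo_subset_of_isCompact hφ.hasCompactSupport hφ.tsupport_subset
  have hpos : (0 : ℝ) < 1 / ((k : ℝ) + 1) := by positivity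
  set l := α + 1 / ((k : ℝ) + 1) with hl
  set u := β - 1 / ((k : ℝ) + 1) with hu
  have hφk : IsTestFunction (Ioo l u) φ := ⟨hφ.smooth, hφ.hasCompactSupport, hk⟩
  have hc := hφ.smooth.continuous
  have hi : Integrable φ := hc.integrable_of_hasCompactSupport hφ.hasCompactSupport
  have hder : ∀ s, HasDerivAt (fun s => ∫ t in l..s, φ t) (φ s) s := fun s =>
    (hc.integral_hasStrictDerivAt l s).hasDerivAt
  have hd : deriv (fun s => ∫ t in l..s, φ t) = φ := funext fun s => (hder s).deriv
  refine ⟨fun s => ∫ t in l..s, φ t, ?_, hd, fun s => ?_⟩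
  · refine isTestFunction_of_vanishing (α := l) (β := u) ?_ (by linarith) (by linarith)
      fun s hs => ?_
    · rw [contDiff_infty_iff_deriv, hd]
      exact ⟨fun s => (hder s).differentiableAt, hφ.smooth⟩
    · rw [mem_Ioo, not_and_or, not_lt, not_lt] at hs
      rcases le_total s l with h | h
      · rw [intervalIntegral.integral_symm, intervalIntegral.integral_of_le h,
          setIntegral_eq_zero_of_forall_eq_zero, neg_zero]
        exact fun t ht => hφk.eq_zero fun h' => by linarith [h'.1, ht.2]
      · rcases hs with h' | h'
        · rw [le_antisymm h' h, intervalIntegral.integral_same]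
        · rw [intervalIntegral.integral_eq_integral_of_support_subset, h0]
          intro t ht
          have h2 : t ∈ Ioo l u := not_not.1 fun h3 => ht (hφk.eq_zero h3)
          exact ⟨h2.1, h2.2.le.trans h'⟩
  · rw [← Real.norm_eq_abs]
    refine intervalIntegral.norm_integral_le_integral_norm_uIoc.trans ?_
    exact setIntegral_le_integral hi.norm (Eventually.of_forall fun t => norm_nonneg _)

/-- A bound for the second distributional derivative gives one for the first: up to a multiple of a
fixed bump, a test function is the derivative of a test function. -/
theorem exists_bound_of_second_derivative (hv : LocallyIntegrableOn v (Ioo a b)) {α β C : ℝ}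
    (hα : a < α) (hβ : β < b) (hC : ∀ φ, IsTestFunction (Ioo α β) φ → ∀ M, 0 ≤ M →
      (∀ s, |φ s| ≤ M) → |∫ s in Ioo a b, v s * deriv (deriv φ) s| ≤ C * M) (hC0 : 0 ≤ C) :
    ∃ C' : ℝ, 0 ≤ C' ∧ ∀ φ, IsTestFunction (Ioo α β) φ →
      |∫ s in Ioo a b, v s * deriv φ s| ≤ C' * ∫ s, |φ s| := by
  rcases le_or_gt β α with h | hαβ
  · refine ⟨0, le_rfl, fun φ hφ => ?_⟩
    have : ∀ s, deriv φ s = 0 := fun s => hφ.deriv.eq_zero (by simp [h])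
    simp [this]
  have hsub : Ioo α β ⊆ Ioo a b := Ioo_subset_Ioo hα.le hβ.le
  obtain ⟨x, hx1, hx2⟩ := exists_between hαβ
  obtain ⟨n, h1, h2⟩ := ((eventually_add_one_div_lt hx1).and (eventually_lt_sub_one_div hx2)).exists
  set ρ : ℝ → ℝ := fun s => bumpKernel n (s - x) with hρ
  have tρ : IsTestFunction (Ioo α β) ρ := isTestFunction_bumpKernel_sub h1 h2
  have iρ : Integrable ρ :=
    tρ.smooth.continuous.integrable_of_hasCompactSupport tρ.hasCompactSupport
  have hρ1 : ∫ s, ρ s = 1 := by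
    rw [hρ, integral_sub_right_eq_self (bumpKernel n) x]
    exact (bumpSeq n).integral_normed
  refine ⟨2 * C + |∫ s in Ioo a b, v s * deriv ρ s|, by positivity, fun φ hφ => ?_⟩
  have iφ : Integrable φ :=
    hφ.smooth.continuous.integrable_of_hasCompactSupport hφ.hasCompactSupport
  set m := ∫ s, φ s with hm
  set A := ∫ s, |φ s| with hA
  have hmA : |m| ≤ A := abs_integral_le_integral_abs
  have hA0 : 0 ≤ A := (abs_nonneg _).trans hmA
  have tψ : IsTestFunction (Ioo α β) fun s => φ s - m * ρ s := hφ.sub (tρ.mul_smooth contDiff_const)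
  obtain ⟨Φ, tΦ, dΦ, bΦ⟩ := exists_isTestFunction_primitive tψ (by
    rw [integral_sub iφ (iρ.const_mul m), integral_const_mul, hρ1, mul_one, sub_self])
  have hbound : ∀ s, |Φ s| ≤ 2 * A := fun s => by
    refine (bΦ s).trans ?_
    calc ∫ t, |φ t - m * ρ t| ≤ ∫ t, (|φ t| + |m| * ρ t) := by
          refine integral_mono (tψ.smooth.continuous.integrable_of_hasCompactSupport tψ.hasCompactSupport).abs
            (iφ.abs.add (iρ.const_mul |m|)) fun t => ?_
          simp only
          refine (abs_sub _ _).trans ?_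
          rw [abs_mul, abs_of_nonneg (bumpKernel_nonneg n (t - x))]
      _ = A + |m| := by rw [integral_add iφ.abs (iρ.const_mul _), integral_const_mul, hρ1, mul_one]
      _ ≤ 2 * A := by linarith
  have h3 := hC Φ tΦ (2 * A) (by positivity) hbound
  have h4 : ∀ s, deriv (deriv Φ) s = deriv φ s - m * deriv ρ s := fun s => by
    rw [dΦ, deriv_fun_sub (hφ.smooth.differentiable (by simp) s)
      ((tρ.smooth.differentiable (by simp) s).const_mul m),
      deriv_const_mul _ (tρ.smooth.differentiable (by simp) s)]
  have h5 : ∫ s in Ioo a b, v s * deriv φ s = (∫ s in Ioo a b, v s * deriv (deriv Φ) s)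
      + m * ∫ s in Ioo a b, v s * deriv ρ s := by
    rw [← integral_const_mul, ← integral_add ((tΦ.mono hsub).deriv.deriv.integrableOn_mul hv)
      (((tρ.mono hsub).deriv.integrableOn_mul hv).const_mul m)]
    refine integral_congr_ae (Eventually.of_forall fun s => ?_)
    simp only [h4]
    ring
  rw [h5]
  refine (abs_add_le _ _).trans ?_
  rw [abs_mul, add_mul]
  refine add_le_add (h3.trans (le_of_eq (by ring))) ?_
  rw [mul_comm]
  exact mul_le_mul_of_nonneg_left hmA (abs_nonneg _)

end Lipschitz

/-! ### The derivative measure of a monotone function -/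

section MonotoneMeasure

open Set Filter Topology

variable {a b : ℝ}

theorem compactIccSpace_Ioo : CompactIccSpace (Ioo a b) := by
  refine ⟨fun {x y} => ?_⟩
  rw [Subtype.isCompact_iff]
  have : Subtype.val '' Icc x y = Icc (x : ℝ) y := by
    ext s
    constructor
    · rintro ⟨t, ht, rfl⟩
      exact ⟨ht.1, ht.2⟩
    · intro hs
      exact ⟨⟨s, x.2.1.trans_le hs.1, hs.2.trans_lt y.2.2⟩, ⟨hs.1, hs.2⟩, rfl⟩
  rw [this]
  exact isCompact_Icc

/-- The Lebesgue–Stieltjes measure of a monotone function on an open interval. The function may be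
unbounded near the end points, which is why the measure is built on the subtype `Ioo a b`. It may
differ from its right limit `F` at countably many points. -/
theorem MonotoneOn.exists_stieltjes_measure {P : ℝ → ℝ} (hP : MonotoneOn P (Ioo a b)) :
    ∃ (τ : Measure ℝ) (F : ℝ → ℝ), τ (Ioo a b)ᶜ = 0 ∧ MonotoneOn F (Ioo a b) ∧
      (∀ s ∈ Ioo a b, ∀ t ∈ Ioo a b, s ≤ t → τ (Ioc s t) = ENNReal.ofReal (F t - F s)) ∧
      (∀ K ⊆ Ioo a b, IsCompact K → τ K < ⊤) ∧ ∀ᵐ s, s ∈ Ioo a b → F s = P s := by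
  have : CompactIccSpace (Ioo a b) := compactIccSpace_Ioo
  have hm : Monotone fun t : Ioo a b => P t := fun s t hst => hP s.2 t.2 hst
  set f : StieltjesFunction (Ioo a b) := hm.stieltjesFunction with hf
  set τ : Measure ℝ := f.measure.map Subtype.val with hτ
  have hval : MeasurableEmbedding (Subtype.val : Ioo a b → ℝ) :=
    MeasurableEmbedding.subtype_coe measurableSet_Ioo
  classical
  set F : ℝ → ℝ := fun s => if h : s ∈ Ioo a b then f ⟨s, h⟩ else 0 with hF
  have hFs : ∀ s (h : s ∈ Ioo a b), F s = f ⟨s, h⟩ := fun s h => dif_pos h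
  have hpre : ∀ s (hs : s ∈ Ioo a b) t (ht : t ∈ Ioo a b),
      (Subtype.val : Ioo a b → ℝ) ⁻¹' Icc s t = Icc ⟨s, hs⟩ ⟨t, ht⟩ := fun s hs t ht => rfl
  refine ⟨τ, F, ?_, ?_, ?_, ?_, ?_⟩
  · rw [hτ, hval.map_apply, preimage_compl, Subtype.coe_preimage_self, compl_univ, measure_empty]
  · intro s hs t ht hst
    rw [hFs s hs, hFs t ht]
    exact f.mono hst
  · intro s hs t ht _
    rw [hτ, hval.map_apply, hFs s hs, hFs t ht, ← StieltjesFunction.measure_Ioc]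
    rfl
  · intro K hK hKc
    obtain ⟨k, hk⟩ := exists_Ioo_subset_of_isCompact hKc hK
    rcases K.eq_empty_or_nonempty with rfl | ⟨x, hx⟩
    · simp
    have hpos : (0 : ℝ) < 1 / ((k : ℝ) + 1) := by positivity
    have h1 := hk hx
    have hs : a + 1 / ((k : ℝ) + 1) ∈ Ioo a b := ⟨by linarith, by linarith [h1.1, h1.2]⟩
    have ht : b - 1 / ((k : ℝ) + 1) ∈ Ioo a b := ⟨by linarith [h1.1, h1.2], by linarith⟩
    refine (measure_mono (hk.trans Ioo_subset_Icc_self)).trans_lt ?_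
    rw [hτ, hval.map_apply, hpre _ hs _ ht, StieltjesFunction.measure_Icc]
    exact ENNReal.ofReal_lt_top
  · have hc := (hm.countable_not_continuousAt.image Subtype.val).ae_notMem (volume : Measure ℝ)
    filter_upwards [hc] with s hs hsI
    rw [hFs s hsI, hf, Monotone.stieltjesFunction_eq]
    have hca : ContinuousAt (fun t : Ioo a b => P t) ⟨s, hsI⟩ := by
      by_contra h
      exact hs ⟨⟨s, hsI⟩, h, rfl⟩
    exact (hm.continuousWithinAt_Ioi_iff_rightLim_eq).1 hca.continuousWithinAt

/-- Integration by parts against a Lebesgue–Stieltjes measure, by Fubini's theorem. -/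
theorem integral_deriv_mul_eq_of_measure_Ioc {τ : Measure ℝ} {F φ : ℝ → ℝ}
    (hF : MonotoneOn F (Ioo a b))
    (hτ : ∀ s ∈ Ioo a b, ∀ t ∈ Ioo a b, s ≤ t → τ (Ioc s t) = ENNReal.ofReal (F t - F s))
    (hφ : IsTestFunction (Ioo a b) φ) :
    ∫ s in Ioo a b, F s * deriv φ s = -∫ s, φ s ∂τ := by
  obtain ⟨k, hk⟩ := exists_Ioo_subset_of_isCompact hφ.hasCompactSupport hφ.tsupport_subset
  have hpos : (0 : ℝ) < 1 / ((k : ℝ) + 1) := by positivity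
  set l := a + 1 / ((k : ℝ) + 1) with hl
  set u := b - 1 / ((k : ℝ) + 1) with hu
  have hφk : IsTestFunction (Ioo l u) φ := ⟨hφ.smooth, hφ.hasCompactSupport, hk⟩
  rcases le_or_gt u l with hul | hlu
  · have h0 : ∀ s, φ s = 0 := fun s => hφk.eq_zero (by simp [hul])
    have h1 : ∀ s, deriv φ s = 0 := fun s => hφk.deriv.eq_zero (by simp [hul])
    simp [h0, h1]
  have hlI : l ∈ Ioo a b := ⟨by linarith, by linarith⟩
  have huI : u ∈ Ioo a b := ⟨by linarith, by linarith⟩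
  have hJI : Ioc l u ⊆ Ioo a b := fun s hs => ⟨hlI.1.trans hs.1, hs.2.trans_lt huI.2⟩
  set ρ : Measure ℝ := τ.restrict (Ioc l u) with hρ
  set lam : Measure ℝ := volume.restrict (Ioc l u) with hlam
  have : IsFiniteMeasure ρ := ⟨by
    rw [hρ, Measure.restrict_apply_univ, hτ l hlI u huI hlu.le]
    exact ENNReal.ofReal_lt_top⟩
  have hφ' : Continuous (deriv φ) := hφ.deriv.smooth.continuous
  have hiφ' : Integrable (deriv φ) lam :=
    (hφ'.integrable_of_hasCompactSupport hφ.deriv.hasCompactSupport).mono_measure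
      Measure.restrict_le_self
  set W : Set (ℝ × ℝ) := {z | z.2 < z.1} with hW
  have mW : MeasurableSet W := measurableSet_lt measurable_snd measurable_fst
  have hint : Integrable (W.indicator fun z : ℝ × ℝ => deriv φ z.2) (ρ.prod lam) :=
    (hiφ'.comp_snd ρ).indicator mW
  have hprim : ∀ t ∈ Ioc l u, ∫ s, W.indicator (fun z : ℝ × ℝ => deriv φ z.2) (t, s) ∂lam = φ t := by
    intro t ht
    have h1 : ∀ s, W.indicator (fun z : ℝ × ℝ => deriv φ z.2) (t, s) =
        (Iio t).indicator (deriv φ) s := fun s => rfl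
    simp only [h1]
    rw [integral_indicator measurableSet_Iio, hlam, Measure.restrict_restrict measurableSet_Iio]
    have h2 : Iio t ∩ Ioc l u = Ioo l t := by
      ext s
      exact ⟨fun h => ⟨h.2.1, h.1⟩, fun h => ⟨h.2, h.1, h.2.le.trans ht.2⟩⟩
    rw [h2, ← integral_Ioc_eq_integral_Ioo, ← intervalIntegral.integral_of_le ht.1.le,
      intervalIntegral.integral_deriv_eq_sub
        (fun s _ => hφ.smooth.differentiable (by simp) s) (hφ'.intervalIntegrable _ _),
      hφk.eq_zero (by simp : l ∉ Ioo l u), sub_zero]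
  have hmass : ∀ s ∈ Ioc l u, ∫ t, W.indicator (fun z : ℝ × ℝ => deriv φ z.2) (t, s) ∂ρ =
      (F u - F s) * deriv φ s := by
    intro s hs
    have h1 : ∀ t, W.indicator (fun z : ℝ × ℝ => deriv φ z.2) (t, s) =
        (Ioi s).indicator (fun _ => deriv φ s) t := fun t => rfl
    simp only [h1]
    rw [integral_indicator measurableSet_Ioi, hρ, Measure.restrict_restrict measurableSet_Ioi]
    have h2 : Ioi s ∩ Ioc l u = Ioc s u := by
      ext t
      exact ⟨fun h => ⟨h.1, h.2.2⟩, fun h => ⟨h.1, hs.1.trans h.1, h.2⟩⟩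
    rw [h2, setIntegral_const, Measure.real, hτ s (hJI hs) u huI hs.2,
      ENNReal.toReal_ofReal (sub_nonneg.2 (hF (hJI hs) huI hs.2)), smul_eq_mul]
  have hIcc : IntegrableOn F (Icc l u) :=
    (hF.mono fun s hs => ⟨hlI.1.trans_le hs.1, hs.2.trans_lt huI.2⟩).integrableOn_isCompact
      isCompact_Icc
  have hFφ : Integrable (fun s => F s * deriv φ s) lam :=
    (hIcc.mul_continuousOn hφ'.continuousOn isCompact_Icc).mono_set Ioc_subset_Icc_self
  have e1 : ∫ s, φ s ∂τ = ∫ t, φ t ∂ρ :=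
    (setIntegral_eq_integral_of_forall_compl_eq_zero fun s hs =>
      hφk.eq_zero fun h => hs (Ioo_subset_Ioc_self h)).symm
  have e2 : ∫ t, φ t ∂ρ = ∫ t, ∫ s, W.indicator (fun z : ℝ × ℝ => deriv φ z.2) (t, s) ∂lam ∂ρ :=
    setIntegral_congr_fun measurableSet_Ioc fun t ht => (hprim t ht).symm
  have e3 : ∫ s, ∫ t, W.indicator (fun z : ℝ × ℝ => deriv φ z.2) (t, s) ∂ρ ∂lam =
      ∫ s in Ioc l u, (F u - F s) * deriv φ s :=
    setIntegral_congr_fun measurableSet_Ioc fun s hs => hmass s hs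
  have e4 : ∫ s in Ioc l u, deriv φ s = 0 := by
    rw [← intervalIntegral.integral_of_le hlu.le, intervalIntegral.integral_deriv_eq_sub
        (fun s _ => hφ.smooth.differentiable (by simp) s) (hφ'.intervalIntegrable _ _),
      hφk.eq_zero (by simp : l ∉ Ioo l u), hφk.eq_zero (by simp : u ∉ Ioo l u), sub_zero]
  have e5 : ∫ s in Ioo a b, F s * deriv φ s = ∫ s in Ioc l u, F s * deriv φ s := by
    rw [hφ.deriv.setIntegral_eq]
    refine (setIntegral_eq_integral_of_forall_compl_eq_zero fun s hs => ?_).symm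
    rw [hφk.deriv.eq_zero fun h => hs ⟨h.1, h.2.le⟩, mul_zero]
  have hswap := integral_integral_swap
    (f := fun t s => W.indicator (fun z : ℝ × ℝ => deriv φ z.2) (t, s)) hint
  rw [e1, e2, hswap, e3, e5]
  simp only [sub_mul]
  rw [integral_sub (hiφ'.const_mul (F u)) hFφ, integral_const_mul, e4]
  ring

/-- A function which is monotone on a set of full measure has a positive Radon measure as
derivative. -/
theorem MonotoneOn.exists_derivative_measure {p : ℝ → ℝ} {S : Set ℝ}
    (hae : ∀ᵐ s, s ∈ Ioo a b → s ∈ S) (hp : MonotoneOn p S) :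
    ∃ τ : Measure ℝ, τ (Ioo a b)ᶜ = 0 ∧ (∀ K ⊆ Ioo a b, IsCompact K → τ K < ⊤) ∧
      LocallyIntegrableOn p (Ioo a b) ∧
      ∀ φ, IsTestFunction (Ioo a b) φ → ∫ s in Ioo a b, p s * deriv φ s = -∫ s, φ s ∂τ := by
  have hex : ∀ l u, a ≤ l → u ≤ b → l < u → ∃ s ∈ S, l < s ∧ s < u := by
    intro l u hl hu hlu
    by_contra! h
    have h0 : volume (Ioo l u) = 0 := by
      refine measure_mono_null (fun s hs => ?_) (ae_iff.1 hae)
      exact fun h' : s ∈ Ioo a b → s ∈ S =>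
        absurd hs.2 (not_lt.2 (h s (h' ⟨hl.trans_lt hs.1, hs.2.trans_le hu⟩) hs.1))
    rw [Real.volume_Ioo] at h0
    exact absurd (ENNReal.ofReal_eq_zero.1 h0) (by linarith)
  -- the monotone extension of `p` to the whole interval
  set P : ℝ → ℝ := fun t => sSup (p '' (S ∩ Iic t)) with hP
  have hbdd : ∀ t ∈ Ioo a b, BddAbove (p '' (S ∩ Iic t)) := by
    intro t ht
    obtain ⟨x, hx, h1, _⟩ := hex t b ht.1.le le_rfl ht.2
    refine ⟨p x, ?_⟩
    rintro _ ⟨s, hs, rfl⟩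
    exact hp hs.1 hx (le_trans hs.2 h1.le)
  have hne : ∀ t ∈ Ioo a b, (p '' (S ∩ Iic t)).Nonempty := by
    intro t ht
    obtain ⟨x, hx, _, h2⟩ := hex a t le_rfl ht.2.le ht.1
    exact ⟨p x, x, ⟨hx, h2.le⟩, rfl⟩
  have hmono : MonotoneOn P (Ioo a b) := fun s hs t ht hst =>
    csSup_le_csSup (hbdd t ht) (hne s hs)
      (image_mono (inter_subset_inter_right _ (Iic_subset_Iic.2 hst)))
  have hPp : ∀ s ∈ S, P s = p s := fun s hs => by
    refine IsGreatest.csSup_eq ⟨⟨s, ⟨hs, self_mem_Iic⟩, rfl⟩, ?_⟩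
    rintro _ ⟨t, ht, rfl⟩
    exact hp ht.1 hs ht.2
  obtain ⟨τ, F, h0, hF, hτ, hfin, hFP⟩ := hmono.exists_stieltjes_measure
  have hpF : ∀ᵐ s, s ∈ Ioo a b → p s = F s := by
    filter_upwards [hae, hFP] with s h1 h2 hs
    rw [h2 hs, hPp s (h1 hs)]
  refine ⟨τ, h0, hfin, ?_, fun φ hφ => ?_⟩
  · rw [locallyIntegrableOn_iff isOpen_Ioo.isLocallyClosed]
    intro K hK hKc
    have h1 : IntegrableOn F K := (hF.mono hK).integrableOn_isCompact hKc
    refine h1.congr ?_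
    refine (ae_restrict_iff' hKc.measurableSet).2 ?_
    filter_upwards [hpF] with s hs hsK using (hs (hK hsK)).symm
  · rw [← integral_deriv_mul_eq_of_measure_Ioc hF hτ hφ]
    refine setIntegral_congr_ae measurableSet_Ioo ?_
    filter_upwards [hpF] with s hs hsI
    rw [hs hsI]

/-- The difference of two positive Radon measures is a signed Radon measure, with explicit Jordan
decomposition. -/
theorem exists_realRadonMeasure_sub {τ₁ τ₂ : Measure ℝ} (h₁ : τ₁ (Ioo a b)ᶜ = 0)
    (h₂ : τ₂ (Ioo a b)ᶜ = 0) (f₁ : ∀ K ⊆ Ioo a b, IsCompact K → τ₁ K < ⊤)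
    (f₂ : ∀ K ⊆ Ioo a b, IsCompact K → τ₂ K < ⊤) :
    ∃ μ : RealRadonMeasure (Ioo a b), ∀ φ, IsTestFunction (Ioo a b) φ →
      ∫ s, φ s ∂μ.pos - ∫ s, φ s ∂μ.neg = ∫ s, φ s ∂τ₁ - ∫ s, φ s ∂τ₂ := by
  have := sigmaFinite_of_finite_on_compacts h₁ f₁
  have := sigmaFinite_of_finite_on_compacts h₂ f₂
  set ν := τ₁ + τ₂ with hν
  set u₁ := τ₁.rnDeriv ν with hu₁
  set u₂ := τ₂.rnDeriv ν with hu₂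
  have m₁ : Measurable u₁ := Measure.measurable_rnDeriv _ _
  have m₂ : Measurable u₂ := Measure.measurable_rnDeriv _ _
  have e₁ : ν.withDensity u₁ = τ₁ := Measure.withDensity_rnDeriv_eq _ _
    (Measure.absolutelyContinuous_of_le (Measure.le_add_right le_rfl))
  have e₂ : ν.withDensity u₂ = τ₂ := Measure.withDensity_rnDeriv_eq _ _
    (Measure.absolutelyContinuous_of_le (Measure.le_add_left le_rfl))
  -- truncated subtraction in `[0,∞]`: the two densities never are positive at the same point
  set pos := ν.withDensity fun s => u₁ s - u₂ s with hpos
  set neg := ν.withDensity fun s => u₂ s - u₁ s with hneg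
  have lp : pos ≤ τ₁ := by
    rw [← e₁]
    exact withDensity_mono (Eventually.of_forall fun s => tsub_le_self)
  have ln : neg ≤ τ₂ := by
    rw [← e₂]
    exact withDensity_mono (Eventually.of_forall fun s => tsub_le_self)
  have fp : ∀ K ⊆ Ioo a b, IsCompact K → pos K < ⊤ := fun K hK hKc => (lp K).trans_lt (f₁ K hK hKc)
  have fn : ∀ K ⊆ Ioo a b, IsCompact K → neg K < ⊤ := fun K hK hKc => (ln K).trans_lt (f₂ K hK hKc)
  have hsum : pos + τ₂ = neg + τ₁ := by
    rw [← e₁, ← e₂, hpos, hneg, ← withDensity_add_right _ m₂, ← withDensity_add_right _ m₁]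
    congr 1
    ext s
    simp only [Pi.add_apply]
    rw [tsub_add_eq_max, tsub_add_eq_max, max_comm]
  refine ⟨⟨pos, neg, le_antisymm ((lp _).trans_eq h₁) zero_le,
    le_antisymm ((ln _).trans_eq h₂) zero_le, fp, fn, ?_⟩, fun φ hφ => ?_⟩
  · refine ⟨{s | u₁ s ≤ u₂ s}, measurableSet_le m₁ m₂, ?_, ?_⟩
    · rw [hpos, withDensity_apply _ (measurableSet_le m₁ m₂)]
      refine (setLIntegral_congr_fun (measurableSet_le m₁ m₂) fun s hs => ?_).trans lintegral_zero
      exact tsub_eq_zero_of_le hs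
    · rw [hneg, withDensity_apply _ (measurableSet_le m₁ m₂).compl]
      refine (setLIntegral_congr_fun (measurableSet_le m₁ m₂).compl fun s hs => ?_).trans
        lintegral_zero
      exact tsub_eq_zero_of_le (not_le.1 fun h : u₁ s ≤ u₂ s => hs h).le
  · have h3 : ∫ s, φ s ∂(pos + τ₂) = ∫ s, φ s ∂(neg + τ₁) := by rw [hsum]
    rw [integral_add_measure (hφ.integrable fp) (hφ.integrable f₂),
      integral_add_measure (hφ.integrable fn) (hφ.integrable f₁)] at h3
    simp only
    linarith

/-- If `|∫ v φ'| ≤ C sup |φ|` for test functions with support in a compact subinterval, then `v`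
belongs to `BV_loc`: on the mollification points it is a difference of monotone functions. -/
theorem memBVLoc_of_bound {v : ℝ → ℝ} (hv : LocallyIntegrableOn v (Ioo a b))
    (hb : ∀ α β, a < α → β < b → ∃ C : ℝ, ∀ φ, IsTestFunction (Ioo α β) φ → (∀ s, |φ s| ≤ 1) →
      |∫ s in Ioo a b, v s * deriv φ s| ≤ C) : MemBVLoc (Ioo a b) v := by
  obtain ⟨p, q, hp, hq, hpq⟩ :=
    (locallyBoundedVariationOn_of_bound hv hb).exists_monotoneOn_sub_monotoneOn
  obtain ⟨τ₁, h₁, f₁, i₁, e₁⟩ :=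
    MonotoneOn.exists_derivative_measure (ae_mem_mollificationPoints hv) hp
  obtain ⟨τ₂, h₂, f₂, i₂, e₂⟩ :=
    MonotoneOn.exists_derivative_measure (ae_mem_mollificationPoints hv) hq
  obtain ⟨μ, hμ⟩ := exists_realRadonMeasure_sub h₁ h₂ f₁ f₂
  refine ⟨μ, hv, fun φ hφ => ?_⟩
  rw [hμ φ hφ, hpq]
  simp only [Pi.sub_apply, sub_mul]
  rw [integral_sub (hφ.deriv.integrableOn_mul i₁) (hφ.deriv.integrableOn_mul i₂), e₁ φ hφ, e₂ φ hφ]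
  ring

end MonotoneMeasure

/-! ### The formula and the regularity of the profile -/

section Main

open Set Metric

variable {d : ℕ} {R r : ℝ} {g g' : ℝ → ℝ} {μ : RealRadonMeasure (Ioo 0 R)}

theorem ofReal_sphereArea (d : ℕ) : ENNReal.ofReal (sphereArea d) =
    d * volume (ball (0 : EuclideanSpace ℝ (Fin d)) 1) := by
  rw [sphereArea, ofReal_measureReal, Measure.toSphere_apply_univ, finrank_euclideanSpace_fin]

theorem sphereArea_pos (hd : 2 ≤ d) : 0 < sphereArea d := by
  rw [← ENNReal.ofReal_pos, ofReal_sphereArea]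
  refine ENNReal.mul_pos ?_ (measure_ball_pos _ _ one_pos).ne'
  simp only [ne_eq, Nat.cast_eq_zero]
  omega

theorem ofReal_integral_le_hessianSchattenVar (hd : 2 ≤ d) (hr : r ∈ Ioc 0 R)
    (hf : LocallyIntegrableOn (fun x : EuclideanSpace ℝ (Fin d) => g ‖x‖) (ball 0 R)) {p : ℝ≥0∞}
    {F : EuclideanSpace ℝ (Fin d) → Matrix (Fin d) (Fin d) ℝ}
    (hF : IsHessianTestField p (ball 0 r) F) :
    ENNReal.ofReal (∫ s in Ioo 0 R, g s * doubleDivergencePart F s) ≤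
      hessianSchattenVar p (fun x : EuclideanSpace ℝ (Fin d) => g ‖x‖) (ball 0 r) := by
  rw [← setIntegral_radial_doubleDivergence hd hr.1 hr.2 hf hF.smooth hF.hasCompactSupport
    hF.tsupport_subset]
  exact le_iSup₂ (f := fun F (_ : IsHessianTestField p (ball 0 r) F) =>
    ENNReal.ofReal (∫ x in ball (0 : EuclideanSpace ℝ (Fin d)) r,
      ∑ i, ∑ j, g ‖x‖ * partialDeriv i (partialDeriv j (fun y => F y i j)) x)) F hF

/-- The Hessian–Schatten variation of a radial function is the radial energy of its profile; both
may be infinite. -/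
theorem hessianSchattenVar_radial (hd : 2 ≤ d) (hr : r ∈ Ioc 0 R)
    (hf : LocallyIntegrableOn (fun x : EuclideanSpace ℝ (Fin d) => g ‖x‖) (ball 0 R))
    (hg_int : ∀ r ∈ Ioo 0 R, ∫⁻ s in Ioo 0 r, ENNReal.ofReal (s ^ (d - 1) * |g s|) < ⊤)
    (hw : IsWeakDeriv (Ioo 0 R) g g') (hμ : IsDerivMeasure (Ioo 0 R) g' μ) {p : ℝ≥0∞}
    (hp : 1 ≤ p) :
    hessianSchattenVar p (fun x : EuclideanSpace ℝ (Fin d) => g ‖x‖) (ball 0 r) =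
      d * volume (ball (0 : EuclideanSpace ℝ (Fin d)) 1) * radialEnergy d p g' μ r := by
  have hσ := sphereArea_pos hd
  rw [← ofReal_sphereArea]
  apply le_antisymm
  · by_cases hE : radialEnergy d p g' μ r = ⊤
    · rw [hE, ENNReal.mul_top (ENNReal.ofReal_pos.2 hσ).ne']
      exact le_top
    · refine iSup₂_le fun F hF => ?_
      rw [setIntegral_radial_doubleDivergence hd hr.1 hr.2 hf hF.smooth hF.hasCompactSupport
        hF.tsupport_subset]
      refine (ENNReal.ofReal_le_ofReal
        (integral_mul_doubleDivergence_le hd hp hr hg_int hw hμ hE hF)).trans (le_of_eq ?_)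
      rw [ENNReal.ofReal_mul hσ.le, ENNReal.ofReal_toReal hE]
  · by_cases hV : hessianSchattenVar p (fun x : EuclideanSpace ℝ (Fin d) => g ‖x‖) (ball 0 r) = ⊤
    · rw [hV]
      exact le_top
    set V := hessianSchattenVar p (fun x : EuclideanSpace ℝ (Fin d) => g ‖x‖) (ball 0 r) with hVdef
    have key : radialEnergy d p g' μ r ≤ ENNReal.ofReal (V.toReal / sphereArea d) := by
      refine radialEnergy_le_of_radialField hd hp hr.2 hw.locallyIntegrableOn_deriv
        fun a b ha hb hab => ?_
      rw [le_div_iff₀' hσ, ← integral_mul_doubleDivergence_radialField hd hr.2 hw hμ ha hb,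
        ← ENNReal.ofReal_le_iff_le_toReal hV]
      exact ofReal_integral_le_hessianSchattenVar hd hr hf
        (isHessianTestField_radialField hd ha hb hab)
    refine (mul_le_mul_right key _).trans (le_of_eq ?_)
    rw [← ENNReal.ofReal_mul hσ.le, mul_div_cancel₀ _ hσ.ne', ENNReal.ofReal_toReal hV]

/-- Testing with the fields `φ(|x|) |x|^{1-d} n⊗n` bounds the second distributional derivative of
the profile away from the origin. -/
theorem integral_mul_second_deriv_le (hd : 2 ≤ d) (hR : 0 < R)
    (hf : LocallyIntegrableOn (fun x : EuclideanSpace ℝ (Fin d) => g ‖x‖) (ball 0 R)) {q : ℝ≥0∞}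
    (hV : hessianSchattenVar q (fun x : EuclideanSpace ℝ (Fin d) => g ‖x‖) (ball 0 R) ≠ ⊤)
    {α β : ℝ} (hα : 0 < α) (hβ : β ≤ R) {φ : ℝ → ℝ} (hφ : IsTestFunction (Ioo α β) φ) {M : ℝ}
    (hM : 0 < M) (hφM : ∀ s, |φ s| ≤ M) :
    ∫ s in Ioo 0 R, g s * deriv (deriv φ) s ≤
      (hessianSchattenVar q (fun x : EuclideanSpace ℝ (Fin d) => g ‖x‖) (ball 0 R)).toReal
        / (sphereArea d * α ^ (d - 1)) * M := by
  have hσ := sphereArea_pos hd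
  have hαd : 0 < α ^ (d - 1) := pow_pos hα _
  -- the normalisation which makes the field `c φ(s) s^{1-d} n⊗n` admissible
  set c : ℝ := α ^ (d - 1) / M with hc
  have hc0 : 0 < c := div_pos hαd hM
  have hsub : Ioo α β ⊆ Ioo 0 R := Ioo_subset_Ioo hα.le hβ
  have ta : IsTestFunction (Ioo 0 R) fun s => φ s * (c * (s ^ (d - 1))⁻¹) :=
    (hφ.mono hsub).mul_contDiffAt fun s hs =>
      contDiffAt_const.mul ((contDiffAt_id.pow _).inv (pow_pos hs.1 _).ne')
  set a : ℝ → ℝ := fun s => φ s * (c * (s ^ (d - 1))⁻¹) with ha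
  have hbound : ∀ s, |a s| ≤ 1 := by
    intro s
    by_cases hs : s ∈ Ioo α β
    · have hs0 : 0 < s := hα.trans hs.1
      have hsd : 0 < s ^ (d - 1) := pow_pos hs0 _
      have h1 : α ^ (d - 1) ≤ s ^ (d - 1) := pow_le_pow_left₀ hα.le hs.1.le _
      rw [ha, abs_mul, abs_of_pos (mul_pos hc0 (inv_pos.2 hsd))]
      calc |φ s| * (c * (s ^ (d - 1))⁻¹) ≤ M * (c * (s ^ (d - 1))⁻¹) :=
            mul_le_mul_of_nonneg_right (hφM s) (by positivity)
        _ = α ^ (d - 1) / s ^ (d - 1) := by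
            rw [hc]
            field_simp
        _ ≤ 1 := (div_le_one hsd).2 h1
    · simp only [ha, hφ.eq_zero hs, zero_mul, abs_zero, zero_le_one]
  have hF := isHessianTestField_radialField (d := d) (q := q) hd ta (isTestFunction_zero (Ioo 0 R))
    fun s => by
      rw [radialNorm_zero_right (one_le_conjExponent q)]
      exact hbound s
  have h1 := ofReal_integral_le_hessianSchattenVar hd ⟨hR, le_rfl⟩ hf hF
  rw [ENNReal.ofReal_le_iff_le_toReal hV] at h1
  have h2 : (fun t => sphereArea d * (t ^ (d - 1) * a t)) = fun t => sphereArea d * c * φ t := by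
    ext t
    by_cases ht : t ∈ Ioo α β
    · have : t ^ (d - 1) ≠ 0 := (pow_pos (hα.trans ht.1) _).ne'
      simp only [ha]
      field_simp
    · simp only [ha, hφ.eq_zero ht, zero_mul, mul_zero]
  have h3 : ∀ s, deriv (fun t => deriv (fun t => sphereArea d * (t ^ (d - 1) * a t)) t
        - sphereArea d * (t ^ (d - 2) * (((d - 1 : ℕ) : ℝ) * 0))) s
      = sphereArea d * c * deriv (deriv φ) s := by
    intro s
    rw [h2]
    simp only [mul_zero, sub_zero]
    have h4 : (deriv fun t => sphereArea d * c * φ t) = fun t => sphereArea d * c * deriv φ t := by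
      ext t
      rw [deriv_const_mul _ (hφ.smooth.differentiable (by simp) t)]
    rw [h4, deriv_const_mul _ (hφ.deriv.smooth.differentiable (by simp) s)]
  have h5 : ∫ s in Ioo 0 R, g s * doubleDivergencePart (radialField a (fun _ => 0) :
      EuclideanSpace ℝ (Fin d) → Matrix (Fin d) (Fin d) ℝ) s =
      sphereArea d * c * ∫ s in Ioo 0 R, g s * deriv (deriv φ) s := by
    rw [← integral_const_mul]
    refine setIntegral_congr_fun measurableSet_Ioo fun s hs => ?_
    rw [doubleDivergencePart_radialField hd ta (isTestFunction_zero (Ioo 0 R)) hs.1, h3]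
    ring
  rw [h5, ← le_div_iff₀' (by positivity)] at h1
  refine h1.trans (le_of_eq ?_)
  rw [hc]
  field_simp

/-- The two-sided version of `integral_mul_second_deriv_le`, with a constant depending only on the
support. -/
theorem exists_bound_second_deriv (hd : 2 ≤ d) (hR : 0 < R)
    (hf : LocallyIntegrableOn (fun x : EuclideanSpace ℝ (Fin d) => g ‖x‖) (ball 0 R)) {q : ℝ≥0∞}
    (hV : hessianSchattenVar q (fun x : EuclideanSpace ℝ (Fin d) => g ‖x‖) (ball 0 R) ≠ ⊤)
    {α β : ℝ} (hα : 0 < α) (hβ : β ≤ R) :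
    ∃ C : ℝ, 0 ≤ C ∧ ∀ φ, IsTestFunction (Ioo α β) φ → ∀ M, 0 ≤ M → (∀ s, |φ s| ≤ M) →
      |∫ s in Ioo 0 R, g s * deriv (deriv φ) s| ≤ C * M := by
  have hσ := sphereArea_pos hd
  refine ⟨(hessianSchattenVar q (fun x : EuclideanSpace ℝ (Fin d) => g ‖x‖) (ball 0 R)).toReal
    / (sphereArea d * α ^ (d - 1)), div_nonneg ENNReal.toReal_nonneg (mul_nonneg hσ.le (pow_nonneg hα.le (d - 1))),
    fun φ hφ M hM hφM => ?_⟩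
  rcases hM.eq_or_lt with rfl | hM
  · have h0 : φ = fun _ => 0 := funext fun s => abs_nonpos_iff.1 (hφM s)
    simp [h0]
  have h1 := integral_mul_second_deriv_le hd hR hf hV hα hβ hφ hM hφM
  have h2 := integral_mul_second_deriv_le hd hR hf hV hα hβ
    (φ := fun s => -φ s) (by simpa using (isTestFunction_zero _).sub hφ) hM
    (fun s => by rw [abs_neg]; exact hφM s)
  simp only [deriv.fun_neg', mul_neg, integral_neg] at h2
  exact abs_le.2 ⟨by linarith, h1⟩

/-- The `ℓ^p` norms on `ℝ^d` are equivalent, so finiteness of the energy does not depend on the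
exponent. -/
theorem radialEnergy_ne_top_of_ne_top (hd : 2 ≤ d) {p q : ℝ≥0∞} (hp : 1 ≤ p) (hq : 1 ≤ q)
    (hE : radialEnergy d q g' μ R ≠ ⊤) : radialEnergy d p g' μ R ≠ ⊤ := by
  rw [radialEnergy] at hE ⊢
  obtain ⟨h1, h2⟩ := ENNReal.add_ne_top.1 hE
  refine ENNReal.add_ne_top.2 ⟨h1, ne_top_of_le_ne_top
    (ENNReal.mul_ne_top (ENNReal.ofReal_ne_top (r := 1 + ((d - 1 : ℕ) : ℝ))) h2) ?_⟩
  rw [← lintegral_const_mul' _ _ ENNReal.ofReal_ne_top]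
  refine setLIntegral_mono' measurableSet_Ioo fun s hs => ?_
  rw [← ENNReal.ofReal_mul (by positivity), ← mul_assoc]
  refine ENNReal.ofReal_le_ofReal (mul_le_mul_of_nonneg_right ?_ (pow_nonneg hs.1.le _))
  have h3 := radialNorm_le (m := d - 1) hp (s * μ.density s) (g' s)
  have h4 := abs_fst_le_radialNorm (m := d - 1) hq (s * μ.density s) (g' s)
  have h5 := abs_snd_le_radialNorm (m := d - 1) (by omega) hq (s * μ.density s) (g' s)
  refine h3.trans ?_
  rw [add_mul, one_mul]
  exact add_le_add h4 (mul_le_mul_of_nonneg_left h5 (by positivity))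

end Main

theorem proposition1p9 (d : ℕ) (hd : 2 ≤ d) (R : ℝ) (hR : 0 < R) (g : ℝ → ℝ)
    (hg : LocallyIntegrableOn g (Set.Ioo 0 R))
    (hg_int : ∀ r ∈ Set.Ioo 0 R, ∫⁻ s in Set.Ioo 0 r, ENNReal.ofReal (s ^ (d - 1) * |g s|) < ⊤)
    (f : EuclideanSpace ℝ (Fin d) → ℝ) (hf : ∀ x, f x = g ‖x‖) :
    LocallyIntegrableOn f (Metric.ball 0 R) ∧
    -- bounded variation of `f` gives the regularity of `g` and the formula
    (∀ q : ℝ≥0∞, 1 ≤ q → HasBoundedHessianSchattenVar q f (Metric.ball 0 R) →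
      MemW11Loc (Set.Ioo 0 R) g ∧
      ∀ g' : ℝ → ℝ, IsWeakDeriv (Set.Ioo 0 R) g g' →
        MemBVLoc (Set.Ioo 0 R) g' ∧
        ∀ μ : RealRadonMeasure (Set.Ioo 0 R), IsDerivMeasure (Set.Ioo 0 R) g' μ →
          ∀ r ∈ Set.Ioc 0 R, ∀ p : ℝ≥0∞, 1 ≤ p →
            hessianSchattenVar p f (Metric.ball 0 r) =
              d * volume (Metric.ball (0 : EuclideanSpace ℝ (Fin d)) 1)
                * radialEnergy d p g' μ r) ∧
    -- conversely, regularity of `g` and finite energy give bounded variation and the formula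
    (∀ (g' : ℝ → ℝ) (μ : RealRadonMeasure (Set.Ioo 0 R)),
      IsWeakDeriv (Set.Ioo 0 R) g g' → IsDerivMeasure (Set.Ioo 0 R) g' μ →
      ∀ q : ℝ≥0∞, 1 ≤ q → radialEnergy d q g' μ R < ⊤ →
        (∀ p : ℝ≥0∞, 1 ≤ p → HasBoundedHessianSchattenVar p f (Metric.ball 0 R)) ∧
        ∀ r ∈ Set.Ioc 0 R, ∀ p : ℝ≥0∞, 1 ≤ p →
          hessianSchattenVar p f (Metric.ball 0 r) =
            d * volume (Metric.ball (0 : EuclideanSpace ℝ (Fin d)) 1)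
              * radialEnergy d p g' μ r) := by
  obtain rfl : f = fun x => g ‖x‖ := funext hf
  have hfi := locallyIntegrableOn_radial hd hg hg_int
  have formula : ∀ (g' : ℝ → ℝ) (μ : RealRadonMeasure (Set.Ioo 0 R)),
      IsWeakDeriv (Set.Ioo 0 R) g g' → IsDerivMeasure (Set.Ioo 0 R) g' μ →
      ∀ r ∈ Set.Ioc 0 R, ∀ p : ℝ≥0∞, 1 ≤ p →
        hessianSchattenVar p (fun x : EuclideanSpace ℝ (Fin d) => g ‖x‖) (Metric.ball 0 r) =
          d * volume (Metric.ball (0 : EuclideanSpace ℝ (Fin d)) 1)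
            * radialEnergy d p g' μ r :=
    fun g' μ hw hμ r hr p hp => hessianSchattenVar_radial hd hr hfi hg_int hw hμ hp
  refine ⟨hfi, fun q _ hbv => ?_,
    fun g' μ hw hμ q hq hE => ⟨fun p hp => ⟨hfi, ?_⟩, formula g' μ hw hμ⟩⟩
  · refine ⟨memW11Loc_of_bound hg fun α β hα hβ => ?_,
      fun g' hw => ⟨?_, fun μ hμ => formula g' μ hw hμ⟩⟩
    · obtain ⟨C, hC0, hC⟩ := exists_bound_second_deriv hd hR hfi hbv.2.ne hα hβ.le
      exact exists_bound_of_second_derivative hg hα hβ hC hC0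
    · refine memBVLoc_of_bound hw.locallyIntegrableOn_deriv fun α β hα hβ => ?_
      obtain ⟨C, _, hC⟩ := exists_bound_second_deriv hd hR hfi hbv.2.ne hα hβ.le
      refine ⟨C * 1, fun φ hφ hφ1 => ?_⟩
      have h1 := hw.integral_eq _ (hφ.mono (Set.Ioo_subset_Ioo hα.le hβ.le)).deriv
      rw [← abs_neg, ← h1]
      exact hC φ hφ 1 zero_le_one hφ1
  · rw [formula g' μ hw hμ R ⟨hR, le_rfl⟩ p hp, ← ofReal_sphereArea]
    exact ENNReal.mul_lt_top ENNReal.ofReal_lt_top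
      (lt_top_iff_ne_top.2 (radialEnergy_ne_top_of_ne_top hd hp hq hE.ne))
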